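/- Let $0<\beta<1/2$, $\theta\in\{0,1\}$ (the one-sided cases), $0<K_m$ and $K_M\in\mathbb R$. Consider diffusivities $K\in L^\infty(0,1)$ with $K_m\le K\le K_M$ a.e. Notation. $H^\mu_0(0,1)$ is the completion of $C_0^\infty(0,1)$ in the norm $\|w\|_{H^\mu}=(\|w\|_{L^2(\mathbb R)}^2+\||\omega|^\mu\mathcal F w\|_{L^2(\mathbb R)}^2)^{1/2}$ with $\mathcal F$ the unitary Fourier transform, and $H^{-1}(0,1)$ is the dual of $H^1_0(0,1)$. For integer $m\ge 0$, $H^m(0,1)$ is the space of functions whose weak derivatives up to order $m$ lie in $L^2(0,1)$. Put $${}^l I^{\beta}w(x)=\tfrac1{\Gamma(\beta)}\int_0^x\frac{w(s)}{(x-s)^{1-\beta}}ds,\qquad {}^r I^{\beta}w(x)=\tfrac1{\Gamma(\beta)}\int_x^1\frac{w(s)}{(s-x)^{1-\beta}}ds,\qquad I^\beta_\theta=\theta\,{}^lI^\beta+(1-\theta)\,{}^rI^\beta .$$ For $f\in H^{-1}(0,1)$, a weak solution of $-D[K\,D I^\beta_\theta u]=f$, $u(0)=u(1)=0$, is a $u\in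 H^{1-\beta}_0(0,1)$ with $$A(u,v):=(K\,D I^\beta_\theta u,\,Dv)_{L^2(0,1)}=\langle f,v\rangle\qquad\text{for all }v\in H^1_0(0,1).$$ Let $w_l\in H^1(0,1)$ be the solution of $(K\,Dw_l,Dv)_{L^2(0,1)}=0$ for all $v\in H^1_0(0,1)$, $w_l(0)=1$, $w_l(1)=0$, and let $u_l\in H^{1-\beta}_0(0,1)$ be the solution of $$I^\beta_\theta u_l(x)-(1-\theta)\,({}^rI^\beta u_l)(0)\,(1-x)-\theta\,({}^lI^\beta u_l)(1)\,x=w_l(x)-(1-x),\qquad 0\le x\le1.$$ Theorem. For every such $K$, the following hold. 1. The functions $w_l$ and $u_l$ exist and are unique, and the nondegeneracy condition $$1+\theta\,({}^lI^\beta u_l)(1)-(1-\theta)\,({}^rI^\beta u_l)(0)\ne0$$ holds. 2. For every $f\in H^{-1}(0,1)$ a weak solution exists, and it is unique if and only if the nondegeneracy condition holds (hence it is unique). 3. $D I^\beta_\theta u\in L^2(0,1)$ for every $u\in H_0^{1-\beta}(0,1)$, and the bilinear form $A$ is bounded and weakly coercive on $H^{1-\beta}_0(0,1)\times H^1_0(0,1)$: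 there are constants $M$ and $\kappa>0$, depending only on $\beta,\theta,K_m,K_M$, such that $|A(w,v)|\le M\|w\|_{H^{1-\beta}}\|v\|_{H^1}$, $$\inf_{0\ne w\in H^{1-\beta}_0}\ \sup_{0\ne v\in H^1_0}\frac{A(w,v)}{\|w\|_{H^{1-\beta}}\|v\|_{H^1}}\ge\kappa,\qquad \sup_{w\in H^{1-\beta}_0}A(w,v)>0\quad\text{for all }0\ne v\in H^1_0 .$$ For every $f\in H^{-1}(0,1)$ there is a unique weak solution $u$, and $\|u\|_{H^{1-\beta}}\le\kappa^{-1}\|f\|_{H^{-1}}$ with the same $\kappa$. 4. Let $m\ge0$ be an integer. If moreover $K\in C^{m+1}[0,1]$ and $f\in H^m(0,1)$ (acting by $\langle f,v\rangle=\int_0^1 fv$), then the unique weak solution $u$ satisfies $I^\beta_\theta u\in H^{m+2}(0,1)$ and $$\|I^\beta_\theta u\|_{H^{m+2}(0,1)}\le C\big(\|K\|_{C^{m+1}[0,1]}+\|f\|_{H^m(0,1)}\big),$$ where $C>0$ depends only on $\beta,\theta,m,K_m,K_M$ and an upper bound for $\|K\|_{C^{m+1}[0,1]}$, and not on $f$.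 -/

import Mathlib

open MeasureTheory
open scoped FourierTransform ContDiff

namespace FracDiff

noncomputable section

/-- Lebesgue measure on the interval `(0,1)`. -/
def unitMeasure : Measure ℝ := volume.restrict (Set.Ioo (0 : ℝ) 1)

/-- `φ ∈ C_0^∞(0,1)`: smooth with compact support contained in `(0,1)`. -/
def IsTestFunction (φ : ℝ → ℝ) : Prop :=
  ContDiff ℝ ∞ φ ∧ HasCompactSupport φ ∧ tsupport φ ⊆ Set.Ioo (0 : ℝ) 1

/-! ### The spaces `H^μ_0(0,1)` and `H^{-1}(0,1)` -/

/-- The Hilbert sum `L²(ℝ;ℝ) × L²(ℝ;ℂ)` with norm `‖(a,b)‖² = ‖a‖² + ‖b‖²`. -/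
abbrev L2Pair : Type := WithLp 2 (Lp ℝ 2 (volume : Measure ℝ) × Lp ℂ 2 (volume : Measure ℝ))

/-- The pairs `(φ, |ω|^μ 𝓕φ)`, `φ ∈ C_0^∞(0,1)`. With the transform `∫ e^{-2πixξ} φ(x) dx`
the angular frequency is `ω = 2πξ`, so the norm of the pair is the norm
`(‖φ‖²_{L²} + ‖ |ω|^μ 𝓕φ ‖²_{L²})^{1/2}` of `H^μ(ℝ)` (with unitary `𝓕`). -/
def testGraph (μ : ℝ) : Set L2Pair :=
  {p | ∃ φ : ℝ → ℝ, IsTestFunction φ ∧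
    (p.fst : ℝ → ℝ) =ᵐ[volume] φ ∧
    (p.snd : ℝ → ℂ) =ᵐ[volume]
      fun ξ => (((2 * Real.pi * |ξ|) ^ μ : ℝ) : ℂ) * 𝓕 (fun x : ℝ => (φ x : ℂ)) ξ}

/-- `H^μ_0(0,1)`: the completion of `C_0^∞(0,1)` in the norm of `H^μ(ℝ)`, realised as the closure
of the isometric image `testGraph μ` (already a linear subspace) in a Hilbert space. -/
def H0Submodule (μ : ℝ) : Submodule ℝ L2Pair :=
  (Submodule.span ℝ (testGraph μ)).topologicalClosure

/-- The Hilbert space `H^μ_0(0,1)`; its norm is that of `H^μ(ℝ)`. -/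
def H0 (μ : ℝ) : Type := H0Submodule μ

instance (μ : ℝ) : NormedAddCommGroup (H0 μ) :=
  inferInstanceAs (NormedAddCommGroup (H0Submodule μ))

instance (μ : ℝ) : InnerProductSpace ℝ (H0 μ) :=
  inferInstanceAs (InnerProductSpace ℝ (H0Submodule μ))

/-- The function (an `L²` class on `ℝ`) underlying an element of `H^μ_0(0,1)`. -/
def H0.fn {μ : ℝ} (u : H0 μ) : ℝ → ℝ := (u.1.fst : Lp ℝ 2 (volume : Measure ℝ))

/-- `H^{-1}(0,1)`, the dual of `H^1_0(0,1)`, with the dual norm. -/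
abbrev HNeg1 : Type := StrongDual ℝ (H0 1)

/-! ### Weak derivatives and `H^m(0,1)` for integers `m` -/

/-- `g ∈ L²(0,1)` is the weak derivative of order `k` of `w` on `(0,1)`. -/
def IsWeakDeriv (k : ℕ) (w g : ℝ → ℝ) : Prop :=
  MemLp g 2 unitMeasure ∧ ∀ φ : ℝ → ℝ, IsTestFunction φ →
    ∫ x, w x * iteratedDeriv k φ x ∂unitMeasure = (-1) ^ k * ∫ x, g x * φ x ∂unitMeasure

/-- `w ∈ H^m(0,1)`. -/
def MemH (m : ℕ) (w : ℝ → ℝ) : Prop :=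
  MemLp w 2 unitMeasure ∧ ∀ k ≤ m, ∃ g, IsWeakDeriv k w g

open Classical in
/-- The weak derivative `D^k w` on `(0,1)` (unique almost everywhere when it exists in `L²`). -/
def weakDeriv (k : ℕ) (w : ℝ → ℝ) : ℝ → ℝ :=
  if h : ∃ g, IsWeakDeriv k w g then h.choose else 0

/-- The norm of `H^m(0,1)`. -/
def normH (m : ℕ) (w : ℝ → ℝ) : ℝ :=
  Real.sqrt (∑ k ∈ Finset.range (m + 1), ∫ x, weakDeriv k w x ^ 2 ∂unitMeasure)

/-- The norm of `C^n[0,1]`. -/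
def normC (n : ℕ) (K : ℝ → ℝ) : ℝ :=
  ∑ k ∈ Finset.range (n + 1),
    ⨆ x : Set.Icc (0 : ℝ) 1, |iteratedDerivWithin k K (Set.Icc 0 1) x|

/-! ### Fractional integrals -/

/-- The left fractional integral of order `σ` on `(0,1)`. -/
def leftInt (σ : ℝ) (w : ℝ → ℝ) (x : ℝ) : ℝ :=
  1 / Real.Gamma σ * ∫ s in (0 : ℝ)..x, w s / (x - s) ^ (1 - σ)

/-- The right fractional integral of order `σ` on `(0,1)`. -/
def rightInt (σ : ℝ) (w : ℝ → ℝ) (x : ℝ) : ℝ :=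
  1 / Real.Gamma σ * ∫ s in x..(1 : ℝ), w s / (s - x) ^ (1 - σ)

/-- The two-sided fractional integral operator `I^β_θ`. -/
def fracInt (β θ : ℝ) (w : ℝ → ℝ) (x : ℝ) : ℝ :=
  θ * leftInt β w x + (1 - θ) * rightInt β w x

/-! ### The boundary-value problem -/

/-- `K ∈ L^∞(0,1)` with `K_m ≤ K ≤ K_M` almost everywhere. -/
def IsDiffusivity (Km KM : ℝ) (K : ℝ → ℝ) : Prop :=
  AEStronglyMeasurable K unitMeasure ∧ ∀ᵐ x ∂unitMeasure, Km ≤ K x ∧ K x ≤ KM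

/-- The bilinear form `A(u,v) = (K D I^β_θ u, D v)_{L²(0,1)}`. -/
def formA (β θ : ℝ) (K : ℝ → ℝ) (u : H0 (1 - β)) (v : H0 1) : ℝ :=
  ∫ x, K x * weakDeriv 1 (fracInt β θ u.fn) x * weakDeriv 1 v.fn x ∂unitMeasure

/-- `u ∈ H^{1-β}_0(0,1)` solves the Petrov-Galerkin formulation with right-hand side `f`. -/
def IsWeakSolution (β θ : ℝ) (K : ℝ → ℝ) (f : H0 1 → ℝ) (u : H0 (1 - β)) : Prop :=
  ∀ v : H0 1, formA β θ K u v = f v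

/-- `w` is (the continuous representative of) the weak solution `w_l` in `H^1(0,1)` of
`-D(K D w) = 0`, `w(0) = 1`, `w(1) = 0`. -/
def IsWl (K w : ℝ → ℝ) : Prop :=
  ContinuousOn w (Set.Icc 0 1) ∧ MemH 1 w ∧ w 0 = 1 ∧ w 1 = 0 ∧
    ∀ v : H0 1, ∫ x, K x * weakDeriv 1 w x * weakDeriv 1 v.fn x ∂unitMeasure = 0

/-- `u_l ∈ H^{1-β}_0(0,1)` solves
`I^β_θ u_l - (1-θ) (ʳI^β u_l)(0) (1-x) - θ (ˡI^β u_l)(1) x = w_l - (1-x)` on `[0,1]`. -/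
def IsUl (β θ : ℝ) (wl : ℝ → ℝ) (ul : H0 (1 - β)) : Prop :=
  ∀ x ∈ Set.Icc (0 : ℝ) 1,
    fracInt β θ ul.fn x - (1 - θ) * rightInt β ul.fn 0 * (1 - x) - θ * leftInt β ul.fn 1 * x
      = wl x - (1 - x)

/-- The nondegeneracy condition `1 + θ (ˡI^β u_l)(1) - (1-θ) (ʳI^β u_l)(0) ≠ 0`. -/
def Nondegenerate (β θ : ℝ) (K : ℝ → ℝ) : Prop :=
  ∀ (wl : ℝ → ℝ) (ul : H0 (1 - β)), IsWl K wl → IsUl β θ wl ul →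
    1 + θ * leftInt β ul.fn 1 - (1 - θ) * rightInt β ul.fn 0 ≠ 0

end

end FracDiff

/-! In the one-sided cases the problem reduces to two operators into L²(0,1), each an isomorphism
onto the orthogonal complement of a single function.

The operator T = D I^β_θ on H^{1-β}_0 is bounded above and below, and its range is p^⊥, where p is
(1-s)^{-β} for θ = 1 and s^{-β} for θ = 0; p is square integrable because β < 1/2
(`exists_fracDeriv`). The derivative S on H^1_0 is an isomorphism onto 1^⊥
(`exists_weakDeriv_H0_one`). Hence A(u,v) = (K T u, S v). To solve A(u,·) = f, represent f as (S v₀,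
S ·) and look for K T u = S v₀ - a with a constant a, which S v does not see. The range condition on
T u reads ∫ p K⁻¹ (S v₀ - a) = 0, and it fixes a because ∫ p/K > 0. So solvability rests on the
positivity of p and of K. The same decomposition with constants gives the inf-sup bound
(`exists_infSup`).

The lower bound for T is a Fourier argument. Damp the left and right potentials of ψ by e^{-ε|x|};
their symbols are z^{-β} and its conjugate, with z = ε + 2πiξ. By Parseval their L² product has
symbol (z^{-β})², whose real part is at least cos(πβ)|z^{-β}|². One potential vanishes for x ≤ 0 and
the other for x ≥ 1, so the product lives on (0,1), and Cauchy–Schwarz there bounds the full-line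
norm by the norm on (0,1) (`damped_estimate`). Taking ψ = φ' and letting ε → 0 gives the claim.

For u_l, the range condition forces the nondegeneracy number to equal ∫(p/K) / (∫(1/K) ∫p), which is
positive. For regularity, T u = K⁻¹(a - ∫₀ˣ f), where a is the mean of ∫₀ˣ f with respect to the
positive weight p/K, so |a| ≤ ‖f‖; the rest is a product rule in H^n (`exists_hBound_div`). -/

namespace FracDiff

/-! ### Beta integral, semigroup law and reflection for fractional integrals. -/

section FractionalIntegrals

open Set

/-- The Beta integral on the interval `(s, x)`, together with the convergence of the integral. -/
lemma integral_beta_kernel {a b s x : ℝ} (ha : 0 < a) (hb : 0 < b) (h : s < x) :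
    IntegrableOn (fun t => (x - t) ^ (a - 1) * (t - s) ^ (b - 1)) (Ioo s x) ∧
    ∫ t in Ioo s x, (x - t) ^ (a - 1) * (t - s) ^ (b - 1) =
      (x - s) ^ (a + b - 1) * (Real.Gamma a * Real.Gamma b / Real.Gamma (a + b)) := by
  have hL : 0 < x - s := sub_pos.2 h
  have key : ∫ t in Ioo s x, (x - t) ^ (a - 1) * (t - s) ^ (b - 1) =
      (x - s) ^ (a + b - 1) * (Real.Gamma a * Real.Gamma b / Real.Gamma (a + b)) := by
    have h1 := Complex.betaIntegral_scaled (b : ℂ) (a : ℂ) hL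
    rw [Complex.betaIntegral_eq_Gamma_mul_div _ _ (by simpa) (by simpa)] at h1
    have h2 : ∫ t in (0:ℝ)..(x - s), (t : ℂ) ^ ((b : ℂ) - 1) * (((x - s : ℝ) : ℂ) - t) ^ ((a : ℂ) - 1)
        = ((∫ t in (0:ℝ)..(x - s), t ^ (b - 1) * ((x - s) - t) ^ (a - 1) : ℝ) : ℂ) := by
      rw [← intervalIntegral.integral_ofReal]
      apply intervalIntegral.integral_congr
      intro t ht
      rw [uIcc_of_le hL.le] at ht
      have e1 := Complex.ofReal_cpow ht.1 (b - 1)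
      have e2 := Complex.ofReal_cpow (sub_nonneg.2 ht.2) (a - 1)
      push_cast at e1 e2 ⊢
      rw [e1, e2]
    rw [h2, Complex.Gamma_ofReal, Complex.Gamma_ofReal, ← Complex.ofReal_add, Complex.Gamma_ofReal,
      show ((b + a : ℝ) : ℂ) - 1 = ((b + a - 1 : ℝ) : ℂ) by push_cast; ring,
      ← Complex.ofReal_cpow hL.le] at h1
    have h3 : ∫ t in (0:ℝ)..(x - s), t ^ (b - 1) * ((x - s) - t) ^ (a - 1) =
        (x - s) ^ (b + a - 1) * (Real.Gamma b * Real.Gamma a / Real.Gamma (b + a)) := by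
      exact_mod_cast h1
    rw [← integral_Ioc_eq_integral_Ioo, ← intervalIntegral.integral_of_le h.le]
    have h4 := intervalIntegral.integral_comp_sub_right (a := s) (b := x)
      (fun t => t ^ (b - 1) * ((x - s) - t) ^ (a - 1)) s
    rw [sub_self, h3] at h4
    rw [add_comm a b, mul_comm (Real.Gamma a), ← h4]
    apply intervalIntegral.integral_congr
    intro t _
    simp only [sub_sub_sub_cancel_right]
    ring
  refine ⟨?_, key⟩
  -- A non-integrable function has Bochner integral 0, while the value just computed is positive.
  by_contra hcon
  have := integral_undef hcon
  rw [key] at this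
  have hpos : 0 < (x - s) ^ (a + b - 1) * (Real.Gamma a * Real.Gamma b / Real.Gamma (a + b)) := by
    have := Real.Gamma_pos_of_pos ha
    have := Real.Gamma_pos_of_pos hb
    have := Real.Gamma_pos_of_pos (add_pos ha hb)
    positivity
  exact hpos.ne' this

lemma leftInt_eq_setIntegral (σ : ℝ) (w : ℝ → ℝ) {x : ℝ} (hx : 0 ≤ x) :
    leftInt σ w x = 1 / Real.Gamma σ * ∫ s in Ioo 0 x, (x - s) ^ (σ - 1) * w s := by
  rw [leftInt, intervalIntegral.integral_of_le hx, integral_Ioc_eq_integral_Ioo]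
  congr 1
  refine setIntegral_congr_fun measurableSet_Ioo fun s hs => ?_
  have : 0 < x - s := sub_pos.2 hs.2
  rw [show σ - 1 = -(1 - σ) by ring, Real.rpow_neg this.le]
  field_simp

/-- The semigroup property of the left fractional integral. -/
lemma leftInt_leftInt {a b : ℝ} (ha : 0 < a) (hb : 0 < b) (hab : 1 ≤ a + b) {g : ℝ → ℝ} {x : ℝ}
    (hx : 0 ≤ x) (hg : IntegrableOn g (Ioo 0 x)) :
    leftInt a (leftInt b g) x = leftInt (a + b) g x := by
  have hGa := Real.Gamma_pos_of_pos ha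
  have hGb := Real.Gamma_pos_of_pos hb
  have hGab := Real.Gamma_pos_of_pos (add_pos ha hb)
  -- The integrand on the triangle s < t < x, extended by zero to a square so that Fubini applies.
  set F : ℝ → ℝ → ℝ := fun s t => (Ioo s x).indicator
    (fun t => (x - t) ^ (a - 1) * (t - s) ^ (b - 1)) t * g s with hF
  have hslice : ∀ s, (fun t => F s t) = fun t => (Ioo s x).indicator
    (fun t => (x - t) ^ (a - 1) * (t - s) ^ (b - 1)) t * g s := fun s => rfl
  have hmeas : AEStronglyMeasurable (Function.uncurry F)
      ((volume.restrict (Ioo 0 x)).prod (volume.restrict (Ioo 0 x))) := by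
    have hS : MeasurableSet {p : ℝ × ℝ | p.1 < p.2 ∧ p.2 < x} :=
      (measurableSet_lt measurable_fst measurable_snd).inter
        (measurableSet_lt measurable_snd measurable_const)
    have h1 : Measurable ({p : ℝ × ℝ | p.1 < p.2 ∧ p.2 < x}.indicator
        (fun p : ℝ × ℝ => (x - p.2) ^ (a - 1) * (p.2 - p.1) ^ (b - 1))) :=
      Measurable.indicator (by fun_prop) hS
    exact h1.aestronglyMeasurable.mul hg.aestronglyMeasurable.comp_fst
  have hIoo : ∀ s ∈ Ioo 0 x, Integrable (fun t => F s t) (volume.restrict (Ioo 0 x)) := by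
    intro s hs
    rw [hslice]
    exact (((integral_beta_kernel ha hb hs.2).1.integrable_indicator
      measurableSet_Ioo).mul_const _).integrableOn
  have hval : ∀ s ∈ Ioo 0 x, ∀ c : ℝ, ∫ t in Ioo 0 x, (Ioo s x).indicator
      (fun t => (x - t) ^ (a - 1) * (t - s) ^ (b - 1)) t * c =
      (x - s) ^ (a + b - 1) * (Real.Gamma a * Real.Gamma b / Real.Gamma (a + b)) * c := by
    intro s hs c
    rw [integral_mul_const, setIntegral_indicator measurableSet_Ioo,
      inter_eq_self_of_subset_right (Ioo_subset_Ioo_left hs.1.le),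
      (integral_beta_kernel ha hb hs.2).2]
  have hint : Integrable (Function.uncurry F)
      ((volume.restrict (Ioo 0 x)).prod (volume.restrict (Ioo 0 x))) := by
    rw [integrable_prod_iff hmeas]
    refine ⟨(ae_restrict_iff' measurableSet_Ioo).2 (ae_of_all _ hIoo), ?_⟩
    have : ∀ s ∈ Ioo 0 x, ∫ t in Ioo 0 x, ‖Function.uncurry F (s, t)‖ =
      (Real.Gamma a * Real.Gamma b / Real.Gamma (a + b)) * ((x - s) ^ (a + b - 1) * ‖g s‖) := by
      intro s hs
      rw [← mul_assoc, mul_comm (Real.Gamma a * Real.Gamma b / Real.Gamma (a + b)), ← hval s hs]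
      refine setIntegral_congr_fun measurableSet_Ioo fun t ht => ?_
      simp only [Function.uncurry, hF, norm_mul]
      congr 1
      rw [Real.norm_of_nonneg]
      refine indicator_nonneg (fun t ht => ?_) _
      have := sub_pos.2 ht.1
      have := sub_pos.2 ht.2
      positivity
    rw [integrable_congr ((ae_restrict_iff' measurableSet_Ioo).2 (ae_of_all _ this))]
    refine Integrable.const_mul ?_ _
    -- Since a + b ≥ 1, the inner integral (x - s)^(a+b-1) is bounded, so integrability of g is
    -- enough.
    refine Integrable.bdd_mul hg.norm (c := x ^ (a + b - 1)) ?_ ?_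
    · exact Measurable.aestronglyMeasurable (by fun_prop)
    · refine (ae_restrict_iff' measurableSet_Ioo).2 (ae_of_all _ fun s hs => ?_)
      rw [Real.norm_of_nonneg (Real.rpow_nonneg (sub_nonneg.2 hs.2.le) _)]
      exact Real.rpow_le_rpow (sub_nonneg.2 hs.2.le) (by linarith [hs.1]) (by linarith)
  have hswap := integral_integral_swap hint
  rw [leftInt_eq_setIntegral _ _ hx, leftInt_eq_setIntegral _ _ hx]
  have e1 : ∫ s in Ioo 0 x, ∫ t in Ioo 0 x, F s t =
      (Real.Gamma a * Real.Gamma b / Real.Gamma (a + b)) *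
        ∫ s in Ioo 0 x, (x - s) ^ (a + b - 1) * g s := by
    rw [← integral_const_mul]
    refine setIntegral_congr_fun measurableSet_Ioo fun s hs => ?_
    simp only [hF]
    rw [hval s hs]
    ring
  have e2 : ∫ t in Ioo 0 x, ∫ s in Ioo 0 x, F s t =
      Real.Gamma b * ∫ t in Ioo 0 x, (x - t) ^ (a - 1) * leftInt b g t := by
    rw [← integral_const_mul]
    refine setIntegral_congr_fun measurableSet_Ioo fun t ht => ?_
    simp only [hF]
    rw [leftInt_eq_setIntegral _ _ ht.1.le]
    have : ∀ s ∈ Ioo 0 x, (Ioo s x).indicator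
      (fun t => (x - t) ^ (a - 1) * (t - s) ^ (b - 1)) t * g s =
      (Ioo 0 t).indicator (fun s => (x - t) ^ (a - 1) * ((t - s) ^ (b - 1) * g s)) s := by
      intro s hs
      by_cases hst : s < t
      · rw [indicator_of_mem (show t ∈ Ioo s x from ⟨hst, ht.2⟩),
          indicator_of_mem (show s ∈ Ioo 0 t from ⟨hs.1, hst⟩)]
        ring
      · rw [indicator_of_notMem (fun h => hst h.1), indicator_of_notMem (fun h => hst h.2), zero_mul]
    rw [setIntegral_congr_fun measurableSet_Ioo this, setIntegral_indicator measurableSet_Ioo,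
      inter_eq_self_of_subset_right (Ioo_subset_Ioo_right ht.2.le), integral_const_mul]
    field_simp
  rw [e1, e2] at hswap
  have : ∫ t in Ioo 0 x, (x - t) ^ (a - 1) * leftInt b g t = (Real.Gamma a / Real.Gamma (a + b)) *
        ∫ s in Ioo 0 x, (x - s) ^ (a + b - 1) * g s := by
    apply mul_left_cancel₀ hGb.ne'
    rw [← hswap]; ring
  rw [this]
  field_simp

lemma leftInt_one (w : ℝ → ℝ) (x : ℝ) : leftInt 1 w x = ∫ s in (0 : ℝ)..x, w s := by
  simp [leftInt]

/-- The left fractional integral only depends on the almost everywhere class on `(0,1)`. -/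
lemma leftInt_congr_ae (σ : ℝ) {w w' : ℝ → ℝ} (h : w =ᵐ[unitMeasure] w') {x : ℝ}
    (hx : x ∈ Icc (0 : ℝ) 1) : leftInt σ w x = leftInt σ w' x := by
  rw [leftInt_eq_setIntegral _ _ hx.1, leftInt_eq_setIntegral _ _ hx.1]
  congr 1
  refine integral_congr_ae ?_
  have := ae_restrict_of_ae_restrict_of_subset (Ioo_subset_Ioo_right hx.2) h
  filter_upwards [this] with s hs
  rw [hs]

/-- The reflection x ↦ 1 - x exchanges the two sides; through it most facts for θ = 0 follow from
those for θ = 1. -/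
lemma rightInt_eq_leftInt (σ : ℝ) (w : ℝ → ℝ) (x : ℝ) :
    rightInt σ w x = leftInt σ (fun s => w (1 - s)) (1 - x) := by
  rw [rightInt, leftInt]
  congr 1
  have := intervalIntegral.integral_comp_sub_left (a := x) (b := 1)
    (fun s => w (1 - s) / (1 - x - s) ^ (1 - σ)) 1
  rw [sub_self] at this
  rw [← this]
  apply intervalIntegral.integral_congr
  intro s _
  simp only [sub_sub_cancel]
  congr 2
  ring

end FractionalIntegrals

end FracDiff

namespace FracDiff

/-! ### Test functions and the lemma of du Bois-Reymond. -/

section TestFunctions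

open Set

instance : IsProbabilityMeasure unitMeasure :=
  ⟨by simp [unitMeasure]⟩

lemma ae_unitMeasure_iff {p : ℝ → Prop} :
    (∀ᵐ x ∂unitMeasure, p x) ↔ ∀ᵐ x, x ∈ Ioo (0 : ℝ) 1 → p x :=
  ae_restrict_iff' measurableSet_Ioo

lemma ae_unitMeasure_of_forall {p : ℝ → Prop} (h : ∀ x ∈ Ioo (0 : ℝ) 1, p x) :
    ∀ᵐ x ∂unitMeasure, p x :=
  ae_unitMeasure_iff.2 (ae_of_all _ h)

lemma integral_unitMeasure (f : ℝ → ℝ) : ∫ x, f x ∂unitMeasure = ∫ x in (0 : ℝ)..1, f x := by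
  rw [unitMeasure, intervalIntegral.integral_of_le zero_le_one, integral_Ioc_eq_integral_Ioo]

lemma Integrable.intervalIntegrable_unit {f : ℝ → ℝ} (hf : Integrable f unitMeasure) {a b : ℝ}
    (ha : a ∈ Icc (0 : ℝ) 1) (hb : b ∈ Icc (0 : ℝ) 1) : IntervalIntegrable f volume a b := by
  have : IntegrableOn f (Icc 0 1) := by
    rw [integrableOn_Icc_iff_integrableOn_Ioo]; exact hf
  refine (this.mono_set ?_).intervalIntegrable
  exact uIcc_subset_Icc ha hb

namespace IsTestFunction

variable {φ ψ : ℝ → ℝ}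

lemma continuous (h : IsTestFunction φ) : Continuous φ := h.1.continuous

lemma differentiable (h : IsTestFunction φ) : Differentiable ℝ φ := h.1.differentiable (by simp)

lemma eq_zero_of_notMem (h : IsTestFunction φ) {x : ℝ} (hx : x ∉ Ioo (0 : ℝ) 1) : φ x = 0 :=
  image_eq_zero_of_notMem_tsupport fun hx' => hx (h.2.2 hx')

lemma isTestFunction_deriv (h : IsTestFunction φ) : IsTestFunction (deriv φ) := by
  refine ⟨?_, h.2.1.deriv, (tsupport_deriv_subset).trans h.2.2⟩
  exact (contDiff_infty_iff_deriv.1 h.1).2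

lemma isTestFunction_iteratedDeriv (h : IsTestFunction φ) (k : ℕ) : IsTestFunction (iteratedDeriv k φ) := by
  induction k with
  | zero => simpa using h
  | succ k ih => rw [iteratedDeriv_succ]; exact ih.isTestFunction_deriv

lemma add (h : IsTestFunction φ) (h' : IsTestFunction ψ) : IsTestFunction (φ + ψ) :=
  ⟨h.1.add h'.1, h.2.1.add h'.2.1, (tsupport_add _ _).trans (union_subset h.2.2 h'.2.2)⟩

lemma smul (h : IsTestFunction φ) (c : ℝ) : IsTestFunction (c • φ) :=
  ⟨h.1.const_smul c, h.2.1.smul_left (f := fun _ => c),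
    (tsupport_smul_subset_right (fun _ => c) φ).trans h.2.2⟩

lemma zero : IsTestFunction (0 : ℝ → ℝ) :=
  ⟨contDiff_const, HasCompactSupport.zero, by simp [tsupport]⟩

lemma comp_one_sub (h : IsTestFunction φ) : IsTestFunction (fun x => φ (1 - x)) := by
  have e : (fun x => φ (1 - x)) = φ ∘ (Homeomorph.subLeft (1 : ℝ)) := rfl
  refine ⟨h.1.comp (by fun_prop), ?_, ?_⟩
  · rw [e]; exact h.2.1.comp_homeomorph _
  · rw [e, tsupport_comp_eq_preimage]
    intro x hx
    have := h.2.2 hx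
    simp only [Homeomorph.subLeft_apply, mem_Ioo] at this
    constructor <;> linarith [this.1, this.2]

lemma integral_deriv_eq (h : IsTestFunction φ) (a b : ℝ) :
    ∫ x in a..b, deriv φ x = φ b - φ a :=
  intervalIntegral.integral_deriv_eq_sub (fun x _ => h.differentiable x)
    (h.isTestFunction_deriv.continuous.intervalIntegrable _ _)

lemma memLp (h : IsTestFunction φ) (p : ENNReal) (μ : Measure ℝ) [IsFiniteMeasureOnCompacts μ] :
    MemLp φ p μ := h.continuous.memLp_of_hasCompactSupport h.2.1

lemma integrable (h : IsTestFunction φ) : Integrable φ :=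
  h.continuous.integrable_of_hasCompactSupport h.2.1

lemma exists_bound (h : IsTestFunction φ) : ∃ M : ℝ, ∀ x, |φ x| ≤ M :=
  h.2.1.exists_bound_of_continuous h.continuous

/-- The primitive from 0 vanishes to the left of the support of ψ, and the zero mean makes it vanish
to the right as well. -/
lemma exists_primitive (h : IsTestFunction ψ) (h0 : ∫ x, ψ x ∂unitMeasure = 0) :
    ∃ φ, IsTestFunction φ ∧ deriv φ = ψ := by
  have hd : ∀ x, HasDerivAt (fun x => ∫ s in (0 : ℝ)..x, ψ s) (ψ x) x := fun x =>
    intervalIntegral.integral_hasDerivAt_right (h.continuous.intervalIntegrable _ _)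
      (h.continuous.stronglyMeasurableAtFilter _ _) h.continuous.continuousAt
  have hderiv : deriv (fun x => ∫ s in (0 : ℝ)..x, ψ s) = ψ := funext fun x => (hd x).deriv
  obtain ⟨a, b, ha, hb, hab⟩ : ∃ a b : ℝ, 0 < a ∧ b < 1 ∧ tsupport ψ ⊆ Icc a b := by
    rcases (tsupport ψ).eq_empty_or_nonempty with he | hne
    -- For ψ = 0 the interval [1, 0] is empty, as the support is.
    · exact ⟨1, 0, one_pos, zero_lt_one, by simp [he]⟩
    · have hc : IsCompact (tsupport ψ) := h.2.1
      exact ⟨sInf (tsupport ψ), sSup (tsupport ψ), (h.2.2 (hc.sInf_mem hne)).1,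
        (h.2.2 (hc.sSup_mem hne)).2, fun x hx =>
          ⟨csInf_le hc.bddBelow hx, le_csSup hc.bddAbove hx⟩⟩
  have hz : ∀ x, x ∉ Icc a b → ψ x = 0 := fun x hx =>
    image_eq_zero_of_notMem_tsupport fun h => hx (hab h)
  have hsupp : Function.support (fun x => ∫ s in (0 : ℝ)..x, ψ s) ⊆ Icc a b := by
    intro x hx
    by_contra hcon
    apply hx
    simp only
    rw [mem_Icc, not_and_or, not_le, not_le] at hcon
    rcases hcon with hxa | hxb
    · rw [intervalIntegral.integral_congr (g := fun _ => 0), intervalIntegral.integral_zero]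
      intro s hs
      refine hz s fun h => ?_
      have := (mem_uIcc.1 hs)
      rcases this with ⟨h1, h2⟩ | ⟨h1, h2⟩ <;> linarith [h.1]
    · rw [integral_unitMeasure] at h0
      rw [← intervalIntegral.integral_add_adjacent_intervals
        (h.continuous.intervalIntegrable 0 1) (h.continuous.intervalIntegrable 1 x), h0, zero_add,
        intervalIntegral.integral_congr (g := fun _ => 0), intervalIntegral.integral_zero]
      intro s hs
      refine hz s fun h => ?_
      have := (mem_uIcc.1 hs)
      rcases this with ⟨h1, h2⟩ | ⟨h1, h2⟩ <;> linarith [h.2]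
  refine ⟨fun x => ∫ s in (0 : ℝ)..x, ψ s, ⟨?_, ?_, ?_⟩, hderiv⟩
  · rw [contDiff_infty_iff_deriv, hderiv]
    exact ⟨fun x => (hd x).differentiableAt, h.1⟩
  · exact HasCompactSupport.of_support_subset_isCompact isCompact_Icc hsupp
  · refine (closure_minimal hsupp isClosed_Icc).trans fun x hx => ⟨by linarith [hx.1], by linarith [hx.2]⟩

end IsTestFunction

lemma exists_isTestFunction_integral_eq_one :
    ∃ φ, IsTestFunction φ ∧ ∫ x, φ x ∂unitMeasure = 1 := by
  let f : ContDiffBump (1 / 2 : ℝ) := ⟨1 / 8, 1 / 4, by norm_num, by norm_num⟩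
  have hs : tsupport (f.normed volume) ⊆ Ioo (0 : ℝ) 1 := by
    rw [f.tsupport_normed_eq, Real.closedBall_eq_Icc]
    intro x hx
    simp only [f, mem_Icc] at hx
    constructor <;> linarith [hx.1, hx.2]
  refine ⟨f.normed volume, ⟨f.contDiff_normed, f.hasCompactSupport_normed, hs⟩, ?_⟩
  rw [unitMeasure, setIntegral_eq_integral_of_forall_compl_eq_zero, f.integral_normed]
  exact fun x hx => image_eq_zero_of_notMem_tsupport fun h => hx (hs h)

/-- The fundamental lemma of the calculus of variations on `(0,1)`. -/
lemma ae_eq_zero_of_forall_integral_mul_eq_zero {q : ℝ → ℝ} (hq : Integrable q unitMeasure)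
    (h : ∀ φ, IsTestFunction φ → ∫ x, q x * φ x ∂unitMeasure = 0) : q =ᵐ[unitMeasure] 0 := by
  have hq' : IntegrableOn q (Ioo 0 1) := hq
  refine ae_unitMeasure_iff.2 (isOpen_Ioo.ae_eq_zero_of_integral_contDiff_smul_eq_zero
    hq'.locallyIntegrableOn fun g hg hc hs => ?_)
  have := h g ⟨hg, hc, hs⟩
  rw [← this, unitMeasure, setIntegral_eq_integral_of_forall_compl_eq_zero]
  · exact integral_congr_ae (ae_of_all _ fun x => mul_comm _ _)
  · intro x hx
    rw [image_eq_zero_of_notMem_tsupport (fun h => hx (hs h)), mul_zero]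

/-- The lemma of du Bois-Reymond on `(0,1)`. -/
lemma ae_eq_const_of_forall_integral_mul_deriv_eq_zero {q : ℝ → ℝ} (hq : Integrable q unitMeasure)
    (h : ∀ φ, IsTestFunction φ → ∫ x, q x * deriv φ x ∂unitMeasure = 0) :
    ∃ c : ℝ, q =ᵐ[unitMeasure] fun _ => c := by
  obtain ⟨ψ, hψ, hψ1⟩ := exists_isTestFunction_integral_eq_one
  have hmul : ∀ {φ}, IsTestFunction φ → Integrable (fun x => q x * φ x) unitMeasure := by
    intro φ hφ
    obtain ⟨M, hM⟩ := hφ.exists_bound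
    exact hq.mul_bdd (c := M) hφ.continuous.aestronglyMeasurable (ae_of_all _ hM)
  refine ⟨∫ x, q x * ψ x ∂unitMeasure, ?_⟩
  have key := ae_eq_zero_of_forall_integral_mul_eq_zero
    (hq.sub (integrable_const (∫ x, q x * ψ x ∂unitMeasure))) fun φ hφ => ?_
  · filter_upwards [key] with x hx
    exact sub_eq_zero.1 hx
  -- Subtracting (∫ φ) ψ leaves a test function of mean zero, that is, the derivative of a test
  -- function.
  · have h1 : IsTestFunction (φ + (-∫ x, φ x ∂unitMeasure) • ψ) := hφ.add (hψ.smul _)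
    have iφ : Integrable φ unitMeasure := hφ.integrable.restrict
    have iψ : Integrable ψ unitMeasure := hψ.integrable.restrict
    have h2 : ∫ x, (φ + (-∫ x, φ x ∂unitMeasure) • ψ) x ∂unitMeasure = 0 := by
      simp only [Pi.add_apply, Pi.smul_apply, smul_eq_mul]
      rw [integral_add iφ (iψ.const_mul _), integral_const_mul, hψ1]
      ring
    obtain ⟨χ, hχ, hχ'⟩ := h1.exists_primitive h2
    have h3 := h χ hχ
    rw [hχ'] at h3
    simp only [Pi.add_apply, Pi.smul_apply, smul_eq_mul, Pi.sub_apply, mul_add, sub_mul] at h3 ⊢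
    rw [integral_add (hmul hφ), integral_congr_ae (ae_of_all _ fun x => mul_left_comm _ _ _),
      integral_const_mul] at h3
    · rw [integral_sub (hmul hφ) (iφ.const_mul _), integral_const_mul]
      linarith
    · refine ((hmul hψ).const_mul (-∫ x, φ x ∂unitMeasure)).congr (ae_of_all _ fun x => ?_)
      simp only
      ring

/-- The space of test functions as a linear space. -/
def testSpace : Submodule ℝ (ℝ → ℝ) where
  carrier := {φ | IsTestFunction φ}
  add_mem' h h' := h.add h'
  zero_mem' := IsTestFunction.zero
  smul_mem' c _ h := h.smul c

end TestFunctions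

end FracDiff

namespace FracDiff

/-! ### Norms and Cauchy–Schwarz in L². -/

section SquareIntegrable

open Set

variable {α : Type*} [MeasurableSpace α] {μ : Measure α}

lemma norm_sq_toLp {f : α → ℝ} (hf : MemLp f 2 μ) : ‖hf.toLp f‖ ^ 2 = ∫ x, f x ^ 2 ∂μ := by
  rw [← real_inner_self_eq_norm_sq, L2.inner_def]
  refine integral_congr_ae ?_
  filter_upwards [hf.coeFn_toLp] with x hx
  simp [hx, sq]

lemma inner_toLp {f g : α → ℝ} (hf : MemLp f 2 μ) (hg : MemLp g 2 μ) :
    inner ℝ (hf.toLp f) (hg.toLp g) = ∫ x, f x * g x ∂μ := by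
  rw [L2.inner_def]
  refine integral_congr_ae ?_
  filter_upwards [hf.coeFn_toLp, hg.coeFn_toLp] with x hx hx'
  simp [hx, hx', mul_comm]

/-- The Cauchy-Schwarz inequality for square integrable functions. -/
lemma sq_integral_mul_le {f g : α → ℝ} (hf : MemLp f 2 μ) (hg : MemLp g 2 μ) :
    (∫ x, f x * g x ∂μ) ^ 2 ≤ (∫ x, f x ^ 2 ∂μ) * ∫ x, g x ^ 2 ∂μ := by
  rw [← inner_toLp hf hg, ← norm_sq_toLp hf, ← norm_sq_toLp hg, ← mul_pow, ← sq_abs]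
  gcongr
  exact abs_real_inner_le_norm _ _

end SquareIntegrable

/-! ### The kernel on (0,1)² and fractional integration by parts. -/

section Kernel

open Set

lemma integral_unitMeasure_comp_one_sub (f : ℝ → ℝ) :
    ∫ x, f (1 - x) ∂unitMeasure = ∫ x, f x ∂unitMeasure := by
  simp [integral_unitMeasure]

lemma measurePreserving_one_sub : MeasurePreserving (fun x : ℝ => 1 - x) unitMeasure unitMeasure := by
  have h := (Measure.measurePreserving_sub_left (volume : Measure ℝ) 1).restrict_preimage
    (measurableSet_Ioo (a := (0 : ℝ)) (b := 1))
  have e : (fun t : ℝ => 1 - t) ⁻¹' Ioo 0 1 = Ioo 0 1 := by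
    ext x
    simp only [mem_Ioo, mem_preimage]
    constructor <;> rintro ⟨h1, h2⟩ <;> constructor <;> linarith
  rwa [e] at h

/-- Integrating in x first gives (1-s)^σ/σ, which is bounded, so h need only be integrable. -/
lemma integrable_kernel {σ : ℝ} (hσ : 0 < σ) {h : ℝ → ℝ} (hh : Integrable h unitMeasure) :
    Integrable (fun p : ℝ × ℝ => (Ioo p.1 1).indicator (fun x => (x - p.1) ^ (σ - 1)) p.2 * h p.1)
      (unitMeasure.prod unitMeasure) := by
  have hb : ∀ s ∈ Ioo (0 : ℝ) 1, IntegrableOn (fun x => (x - s) ^ (σ - 1)) (Ioo s 1) ∧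
      ∫ x in Ioo s 1, (x - s) ^ (σ - 1) = (1 - s) ^ σ / σ := by
    intro s hs
    have := integral_beta_kernel one_pos hσ hs.2
    simp only [sub_self, Real.rpow_zero, one_mul, Real.Gamma_one, add_sub_cancel_left] at this
    refine ⟨this.1, this.2.trans ?_⟩
    rw [add_comm, Real.Gamma_add_one hσ.ne']
    have := Real.Gamma_pos_of_pos hσ
    field_simp
  have hmeas : Measurable (fun p : ℝ × ℝ =>
      (Ioo p.1 1).indicator (fun x => (x - p.1) ^ (σ - 1)) p.2) := by
    have hS : MeasurableSet {p : ℝ × ℝ | p.1 < p.2 ∧ p.2 < 1} :=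
      (measurableSet_lt measurable_fst measurable_snd).inter
        (measurableSet_lt measurable_snd measurable_const)
    exact Measurable.indicator (f := fun p : ℝ × ℝ => (p.2 - p.1) ^ (σ - 1)) (by fun_prop) hS
  have hm : AEStronglyMeasurable (fun p : ℝ × ℝ =>
      (Ioo p.1 1).indicator (fun x => (x - p.1) ^ (σ - 1)) p.2 * h p.1)
      (unitMeasure.prod unitMeasure) :=
    hmeas.aestronglyMeasurable.mul hh.aestronglyMeasurable.comp_fst
  rw [integrable_prod_iff hm]
  constructor
  · refine ae_unitMeasure_of_forall fun s hs => ?_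
    exact (((hb s hs).1.integrable_indicator measurableSet_Ioo).mul_const (h s)).integrableOn
  · have : ∀ s ∈ Ioo (0 : ℝ) 1, ∫ x, ‖(Ioo s 1).indicator (fun x => (x - s) ^ (σ - 1)) x * h s‖
        ∂unitMeasure = (1 - s) ^ σ / σ * ‖h s‖ := by
      intro s hs
      simp only [norm_mul]
      rw [integral_mul_const, ← (hb s hs).2]
      congr 1
      rw [integral_congr_ae (g := (Ioo s 1).indicator (fun x => (x - s) ^ (σ - 1))), unitMeasure,
        setIntegral_indicator measurableSet_Ioo,
        inter_eq_self_of_subset_right (Ioo_subset_Ioo_left hs.1.le)]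
      refine ae_of_all _ fun x => Real.norm_of_nonneg (indicator_nonneg (fun t ht => ?_) _)
      have := sub_pos.2 ht.1
      positivity
    rw [integrable_congr (ae_unitMeasure_of_forall this)]
    refine hh.norm.bdd_mul (c := 1 / σ) (Measurable.aestronglyMeasurable (by fun_prop)) ?_
    refine ae_unitMeasure_of_forall fun s hs => ?_
    have h1 : 0 ≤ 1 - s := by linarith [hs.2]
    rw [Real.norm_of_nonneg (by positivity)]
    gcongr
    exact Real.rpow_le_one h1 (by linarith [hs.1]) hσ.le

lemma leftInt_eq_integral_kernel (σ : ℝ) (h : ℝ → ℝ) {x : ℝ} (hx : x ∈ Ioo (0 : ℝ) 1) :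
    leftInt σ h x = 1 / Real.Gamma σ *
      ∫ s, (Ioo s 1).indicator (fun x => (x - s) ^ (σ - 1)) x * h s ∂unitMeasure := by
  rw [leftInt_eq_setIntegral _ _ hx.1.le, unitMeasure,
    ← inter_eq_self_of_subset_right (Ioo_subset_Ioo_right hx.2.le),
    ← setIntegral_indicator measurableSet_Ioo]
  congr 1
  refine setIntegral_congr_fun measurableSet_Ioo fun s hs => ?_
  by_cases hsx : s < x
  · simp [indicator, hsx, hs.1, hx.2]
  · simp [indicator, hsx]

lemma rightInt_eq_integral_kernel (σ : ℝ) (g : ℝ → ℝ) {s : ℝ} (hs : s ∈ Ioo (0 : ℝ) 1) :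
    rightInt σ g s = 1 / Real.Gamma σ *
      ∫ x, (Ioo s 1).indicator (fun x => (x - s) ^ (σ - 1)) x * g x ∂unitMeasure := by
  rw [rightInt, unitMeasure, intervalIntegral.integral_of_le hs.2.le,
    integral_Ioc_eq_integral_Ioo,
    ← inter_eq_self_of_subset_right (Ioo_subset_Ioo_left (b := 1) hs.1.le),
    ← setIntegral_indicator measurableSet_Ioo]
  congr 1
  refine setIntegral_congr_fun measurableSet_Ioo fun x hx => ?_
  by_cases hsx : s < x
  · have : 0 < x - s := sub_pos.2 hsx
    have hx' : x ∈ Ioo s 1 := ⟨hsx, hx.2⟩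
    rw [inter_eq_self_of_subset_right (Ioo_subset_Ioo_left hs.1.le), indicator_of_mem hx',
      indicator_of_mem hx']
    rw [show σ - 1 = -(1 - σ) by ring, Real.rpow_neg this.le]
    field_simp
  · simp [indicator, hsx]

lemma integrable_leftInt {σ : ℝ} (hσ : 0 < σ) {h : ℝ → ℝ} (hh : Integrable h unitMeasure) :
    Integrable (leftInt σ h) unitMeasure := by
  refine (((integrable_kernel hσ hh).integral_prod_right).const_mul (1 / Real.Gamma σ)).congr ?_
  exact ae_unitMeasure_of_forall fun x hx => (leftInt_eq_integral_kernel σ h hx).symm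

/-- Fractional integration by parts. -/
lemma integral_mul_rightInt {σ : ℝ} (hσ : 0 < σ) {h g : ℝ → ℝ} {M : ℝ}
    (hh : Integrable h unitMeasure) (hg : AEStronglyMeasurable g unitMeasure)
    (hM : ∀ᵐ x ∂unitMeasure, |g x| ≤ M) :
    ∫ s, h s * rightInt σ g s ∂unitMeasure = ∫ x, leftInt σ h x * g x ∂unitMeasure := by
  have hint : Integrable (Function.uncurry fun s x : ℝ =>
      (Ioo s 1).indicator (fun x => (x - s) ^ (σ - 1)) x * h s * g x)
      (unitMeasure.prod unitMeasure) :=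
    (integrable_kernel hσ hh).mul_bdd (c := M) hg.comp_snd
      (Measure.quasiMeasurePreserving_snd.ae hM)
  have hswap := integral_integral_swap hint
  have e1 : ∫ s, h s * rightInt σ g s ∂unitMeasure = 1 / Real.Gamma σ * ∫ s, ∫ x,
      (Ioo s 1).indicator (fun x => (x - s) ^ (σ - 1)) x * h s * g x ∂unitMeasure ∂unitMeasure := by
    rw [← integral_const_mul]
    refine integral_congr_ae (ae_unitMeasure_of_forall fun s hs => ?_)
    simp only
    rw [rightInt_eq_integral_kernel σ g hs, mul_left_comm, ← integral_const_mul]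
    congr 2
    ext x
    ring
  have e2 : ∫ x, leftInt σ h x * g x ∂unitMeasure = 1 / Real.Gamma σ * ∫ x, ∫ s,
      (Ioo s 1).indicator (fun x => (x - s) ^ (σ - 1)) x * h s * g x ∂unitMeasure ∂unitMeasure := by
    rw [← integral_const_mul]
    refine integral_congr_ae (ae_unitMeasure_of_forall fun x hx => ?_)
    simp only
    rw [leftInt_eq_integral_kernel σ h hx, integral_mul_const, mul_assoc]
  rw [e1, e2, hswap]

lemma abs_leftInt_le {σ : ℝ} (hσ : 0 < σ) {g : ℝ → ℝ} {M : ℝ} (hM : ∀ s, |g s| ≤ M) {x : ℝ}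
    (hx : x ∈ Icc (0 : ℝ) 1) : |leftInt σ g x| ≤ M / Real.Gamma (σ + 1) := by
  have hM0 : 0 ≤ M := (abs_nonneg _).trans (hM 0)
  have hG := Real.Gamma_pos_of_pos hσ
  rcases hx.1.eq_or_lt with rfl | hx0
  · simp only [leftInt, intervalIntegral.integral_same, mul_zero, abs_zero]
    exact div_nonneg hM0 (Real.Gamma_pos_of_pos (by linarith)).le
  obtain ⟨hi, hv⟩ := integral_beta_kernel hσ one_pos hx0
  simp only [sub_self, Real.rpow_zero, mul_one, Real.Gamma_one, add_sub_cancel_right,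
    sub_zero] at hi hv
  rw [leftInt_eq_setIntegral _ _ hx.1, abs_mul, abs_of_nonneg (by positivity)]
  have h1 : |∫ s in Ioo 0 x, (x - s) ^ (σ - 1) * g s| ≤ ∫ s in Ioo 0 x, (x - s) ^ (σ - 1) * M := by
    rw [← Real.norm_eq_abs]
    refine norm_integral_le_of_norm_le (hi.mul_const M) ?_
    refine (ae_restrict_iff' measurableSet_Ioo).2 (ae_of_all _ fun s hs => ?_)
    have : 0 < x - s := sub_pos.2 hs.2
    rw [norm_mul, Real.norm_of_nonneg (by positivity)]
    exact mul_le_mul_of_nonneg_left (hM s) (by positivity)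
  rw [integral_mul_const, hv] at h1
  refine (mul_le_mul_of_nonneg_left h1 (by positivity)).trans ?_
  have h2 : x ^ σ ≤ 1 := Real.rpow_le_one hx.1 hx.2 hσ.le
  have hG1 := Real.Gamma_pos_of_pos (show 0 < σ + 1 by linarith)
  have : 1 / Real.Gamma σ * (x ^ σ * (Real.Gamma σ / Real.Gamma (σ + 1)) * M) =
    x ^ σ * (M / Real.Gamma (σ + 1)) := by field_simp
  rw [this]
  exact mul_le_of_le_one_left (by positivity) h2

lemma memLp_leftInt {σ : ℝ} (hσ : 0 < σ) {g : ℝ → ℝ} {M : ℝ}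
    (hg : AEStronglyMeasurable g unitMeasure) (hM : ∀ s, |g s| ≤ M) :
    MemLp (leftInt σ g) 2 unitMeasure := by
  have hi : Integrable g unitMeasure := ⟨hg, HasFiniteIntegral.of_bounded (ae_of_all _ hM)⟩
  exact MemLp.of_bound (integrable_leftInt hσ hi).aestronglyMeasurable _
    (ae_unitMeasure_of_forall fun x hx => abs_leftInt_le hσ hM (Ioo_subset_Icc_self hx))

/-- The square has exponent -2β > -1; here β < 1/2 is essential. -/
lemma memLp_one_sub_rpow {β : ℝ} (hβ' : β < 1 / 2) :
    MemLp (fun s : ℝ => (1 - s) ^ (-β)) 2 unitMeasure := by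
  rw [memLp_two_iff_integrable_sq (Measurable.aestronglyMeasurable (by fun_prop))]
  have := (integral_beta_kernel (a := 1 - 2 * β) (b := 1) (by linarith) one_pos (zero_lt_one' ℝ)).1
  refine this.congr_fun (fun s hs => ?_) measurableSet_Ioo
  have h1 : 0 < 1 - s := by linarith [hs.2]
  simp only [sub_self, Real.rpow_zero, mul_one]
  rw [← Real.rpow_natCast, ← Real.rpow_mul h1.le]
  congr 1
  push_cast
  ring

end Kernel

/-! ### Left fractional integrals of derivatives of test functions. -/

section TestFunctionIntegrals

open Set

variable {β : ℝ} {φ : ℝ → ℝ}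

lemma leftInt_congr_Ioo (σ : ℝ) {w w' : ℝ → ℝ} {x : ℝ} (hx : 0 ≤ x)
    (h : ∀ s ∈ Ioo 0 x, w s = w' s) : leftInt σ w x = leftInt σ w' x := by
  rw [leftInt_eq_setIntegral _ _ hx, leftInt_eq_setIntegral _ _ hx]
  congr 1
  exact setIntegral_congr_fun measurableSet_Ioo fun s hs => by simp only [h s hs]

lemma IsTestFunction.leftInt_one_deriv (hφ : IsTestFunction φ) (x : ℝ) :
    leftInt 1 (deriv φ) x = φ x := by
  rw [leftInt_one, hφ.integral_deriv_eq, hφ.eq_zero_of_notMem (x := 0) (by simp), sub_zero]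

/-- By the semigroup law I^1 I^β φ' = I^β I^1 φ' = I^β φ: differentiation commutes with the
fractional integral on functions vanishing at 0. -/
lemma IsTestFunction.leftInt_eq (hβ : 0 < β) (hφ : IsTestFunction φ) {x : ℝ} (hx : 0 ≤ x) :
    leftInt β φ x = ∫ t in (0 : ℝ)..x, leftInt β (deriv φ) t := by
  have hi : IntegrableOn (deriv φ) (Ioo 0 x) := hφ.isTestFunction_deriv.integrable.integrableOn
  rw [← leftInt_one, leftInt_leftInt one_pos hβ (by linarith) hx hi, add_comm,
    ← leftInt_leftInt hβ one_pos (by linarith) hx hi]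
  exact leftInt_congr_Ioo β hx fun s _ => (hφ.leftInt_one_deriv s).symm

/-- Inversion formula: I^{1-β} I^β φ' = I^1 φ' = φ. Both the orthogonality to the weight and the sup
bound come from it. -/
lemma IsTestFunction.eq_leftInt_leftInt (hβ : 0 < β) (hβ' : β < 1 / 2) (hφ : IsTestFunction φ)
    {x : ℝ} (hx : 0 ≤ x) : φ x = leftInt (1 - β) (leftInt β (deriv φ)) x := by
  rw [leftInt_leftInt (by linarith) hβ (by linarith) hx hφ.isTestFunction_deriv.integrable.integrableOn,
    sub_add_cancel, hφ.leftInt_one_deriv]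

lemma IsTestFunction.memLp_leftInt_deriv (hβ : 0 < β) (hφ : IsTestFunction φ) :
    MemLp (leftInt β (deriv φ)) 2 unitMeasure := by
  obtain ⟨M, hM⟩ := hφ.isTestFunction_deriv.exists_bound
  exact memLp_leftInt hβ hφ.isTestFunction_deriv.continuous.aestronglyMeasurable hM

/-- This is the inversion formula at x = 1, where φ vanishes. -/
lemma IsTestFunction.integral_weight_mul_leftInt (hβ : 0 < β) (hβ' : β < 1 / 2)
    (hφ : IsTestFunction φ) :
    ∫ s, (1 - s) ^ (-β) * leftInt β (deriv φ) s ∂unitMeasure = 0 := by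
  have h := hφ.eq_leftInt_leftInt hβ hβ' zero_le_one
  rw [hφ.eq_zero_of_notMem (by simp), leftInt_eq_setIntegral _ _ zero_le_one, sub_sub_cancel_left] at h
  have hG := Real.Gamma_pos_of_pos (show 0 < 1 - β by linarith)
  exact (mul_eq_zero.1 h.symm).resolve_left (by positivity)

/-- Cauchy–Schwarz in the inversion formula. The Gamma quotient is the integral of (1-s)^{-2β} over
(0,1), finite because β < 1/2. -/
lemma IsTestFunction.sq_le_leftInt (hβ : 0 < β) (hβ' : β < 1 / 2) (hφ : IsTestFunction φ) (x : ℝ) :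
    φ x ^ 2 ≤ (1 / Real.Gamma (1 - β)) ^ 2 * (Real.Gamma (1 - 2 * β) / Real.Gamma (2 - 2 * β)) *
      ∫ s, leftInt β (deriv φ) s ^ 2 ∂unitMeasure := by
  have hG1 := Real.Gamma_pos_of_pos (show 0 < 1 - 2 * β by linarith)
  have hG2 := Real.Gamma_pos_of_pos (show 0 < 2 - 2 * β by linarith)
  by_cases hx : x ∈ Ioo (0 : ℝ) 1
  swap
  · rw [hφ.eq_zero_of_notMem hx]
    have : 0 ≤ ∫ s, leftInt β (deriv φ) s ^ 2 ∂unitMeasure := integral_nonneg fun s => sq_nonneg _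
    rw [zero_pow two_ne_zero]
    positivity
  rw [hφ.eq_leftInt_leftInt hβ hβ' hx.1.le, leftInt_eq_setIntegral _ _ hx.1.le, mul_pow, mul_assoc]
  refine mul_le_mul_of_nonneg_left ?_ (sq_nonneg _)
  obtain ⟨hi, hv⟩ := integral_beta_kernel (a := 1 - 2 * β) (b := 1) (by linarith) one_pos hx.1
  simp only [sub_self, Real.rpow_zero, mul_one, Real.Gamma_one, add_sub_cancel_right,
    sub_zero] at hi hv
  have hsq : ∀ s ∈ Ioo 0 x, (x - s) ^ (1 - 2 * β - 1) = ((x - s) ^ (1 - β - 1)) ^ 2 := by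
    intro s hs
    have h1 : 0 < x - s := by linarith [hs.2]
    rw [← Real.rpow_natCast, ← Real.rpow_mul h1.le]
    congr 1
    push_cast
    ring
  have hm1 : MemLp (fun s : ℝ => (x - s) ^ (1 - β - 1)) 2 (volume.restrict (Ioo 0 x)) := by
    rw [memLp_two_iff_integrable_sq (Measurable.aestronglyMeasurable (by fun_prop))]
    exact hi.congr_fun hsq measurableSet_Ioo
  have hm2 := (hφ.memLp_leftInt_deriv hβ)
  have hle : volume.restrict (Ioo 0 x) ≤ unitMeasure :=
    Measure.restrict_mono (Ioo_subset_Ioo_right hx.2.le) le_rfl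
  refine (sq_integral_mul_le hm1 (hm2.mono_measure hle)).trans ?_
  refine mul_le_mul ?_ ?_ (integral_nonneg fun s => sq_nonneg _) (by positivity)
  · rw [← setIntegral_congr_fun measurableSet_Ioo hsq, hv, show 1 - 2 * β + 1 = 2 - 2 * β by ring]
    exact mul_le_of_le_one_left (by positivity) (Real.rpow_le_one hx.1.le hx.2.le (by linarith))
  · exact integral_mono_measure hle (ae_of_all _ fun s => sq_nonneg _) hm2.integrable_sq

/-- Lebesgue differentiation: almost everywhere q is the derivative of its primitive. -/
lemma ae_eq_zero_of_forall_primitive_eq_zero {q : ℝ → ℝ} (hq : Integrable q unitMeasure)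
    (h : ∀ x ∈ Icc (0 : ℝ) 1, ∫ s in (0 : ℝ)..x, q s = 0) : q =ᵐ[unitMeasure] 0 := by
  have hi : IntervalIntegrable q volume 0 1 := Integrable.intervalIntegrable_unit hq (by simp) (by simp)
  refine ae_unitMeasure_iff.2 ?_
  filter_upwards [hi.ae_hasDerivAt_integral] with x hx hx01
  have h1 := hx (by rw [uIcc_of_le zero_le_one]; exact Ioo_subset_Icc_self hx01) 0 (by simp)
  refine h1.unique ((hasDerivAt_const x (0 : ℝ)).congr_of_eventuallyEq ?_)
  filter_upwards [Ioo_mem_nhds hx01.1 hx01.2] with y hy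
  exact h y (Ioo_subset_Icc_self hy)

/-- A function orthogonal to all right fractional integrals of derivatives of test functions is a
multiple of `s ^ (-β)`. -/
lemma ae_eq_of_forall_integral_mul_rightInt_eq_zero (hβ : 0 < β) (hβ' : β < 1 / 2) {h : ℝ → ℝ}
    (hh : Integrable h unitMeasure)
    (h0 : ∀ φ, IsTestFunction φ → ∫ s, h s * rightInt β (deriv φ) s ∂unitMeasure = 0) :
    ∃ c : ℝ, h =ᵐ[unitMeasure] fun s => c * s ^ (-β) := by
  -- Integration by parts moves the fractional integral onto h, so I^β h is orthogonal to all φ' and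
  -- hence constant.
  obtain ⟨C, hC⟩ := ae_eq_const_of_forall_integral_mul_deriv_eq_zero (integrable_leftInt hβ hh)
    fun φ hφ => by
      obtain ⟨M, hM⟩ := hφ.isTestFunction_deriv.exists_bound
      rw [← integral_mul_rightInt hβ hh hφ.isTestFunction_deriv.continuous.aestronglyMeasurable (ae_of_all _ hM),
        h0 φ hφ]
  have hG := Real.Gamma_pos_of_pos (show 0 < 1 - β by linarith)
  refine ⟨C / Real.Gamma (1 - β), ?_⟩
  have hpow : Integrable (fun s : ℝ => s ^ (-β)) unitMeasure := by
    have := (intervalIntegral.intervalIntegrable_rpow' (a := 0) (b := 1) (r := -β) (by linarith)).1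
    rw [unitMeasure, ← IntegrableOn, ← integrableOn_Ioc_iff_integrableOn_Ioo]
    exact this
  -- Applying I^{1-β} to I^β h = C gives ∫₀ˣ h = C/Γ(1-β) ∫₀ˣ s^{-β}.
  have hprim : ∀ x ∈ Icc (0 : ℝ) 1,
      ∫ s in (0 : ℝ)..x, (h s - C / Real.Gamma (1 - β) * s ^ (-β)) = 0 := by
    intro x hx
    have e0 : ∫ s in (0 : ℝ)..x, h s = leftInt (1 - β) (leftInt β h) x := by
      rw [leftInt_leftInt (by linarith) hβ (by linarith) hx.1
        (IntegrableOn.mono_set hh (Ioo_subset_Ioo_right hx.2)), sub_add_cancel, leftInt_one]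
    rw [intervalIntegral.integral_sub (Integrable.intervalIntegrable_unit hh (by simp) hx)
      ((Integrable.intervalIntegrable_unit hpow (by simp) hx).const_mul _), e0, leftInt_congr_ae _ hC hx, leftInt,
      intervalIntegral.integral_const_mul]
    have e : ∫ s in (0 : ℝ)..x, C / (x - s) ^ (1 - (1 - β)) =
        C * ∫ s in (0 : ℝ)..x, s ^ (-β) := by
      have := intervalIntegral.integral_comp_sub_left (a := 0) (b := x)
        (fun s : ℝ => C * s ^ (-β)) x
      rw [sub_self, sub_zero] at this
      rw [← intervalIntegral.integral_const_mul, ← this]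
      refine intervalIntegral.integral_congr fun s hs => ?_
      rw [uIcc_of_le hx.1] at hs
      simp only [sub_sub_cancel]
      rw [Real.rpow_neg (sub_nonneg.2 hs.2), div_eq_mul_inv]
    rw [e]
    ring
  have := ae_eq_zero_of_forall_primitive_eq_zero
    (hh.sub (hpow.const_mul (C / Real.Gamma (1 - β)))) hprim
  filter_upwards [this] with s hs
  exact sub_eq_zero.1 hs

end TestFunctionIntegrals

end FracDiff

namespace FracDiff

/-! ### Uniform statements for θ = 0 and θ = 1. -/

section TwoSided

open Set

variable {β θ : ℝ} {φ : ℝ → ℝ}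

/-- The weight spanning the orthogonal complement of the range of `D I^β_θ`. -/
noncomputable def weight (β θ s : ℝ) : ℝ := (1 - (θ * s + (1 - θ) * (1 - s))) ^ (-β)

lemma weight_one (β : ℝ) : weight β 1 = fun s => (1 - s) ^ (-β) := by
  ext s
  simp [weight]

lemma weight_zero (β : ℝ) : weight β 0 = fun s => s ^ (-β) := by
  ext s
  simp [weight]

lemma weight_one_sub (β s : ℝ) : weight β 1 (1 - s) = weight β 0 s := by
  simp [weight]

lemma fracInt_one (β : ℝ) (w : ℝ → ℝ) : fracInt β 1 w = leftInt β w := by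
  ext x
  simp [fracInt]

lemma fracInt_zero (β : ℝ) (w : ℝ → ℝ) : fracInt β 0 w = rightInt β w := by
  ext x
  simp [fracInt]

lemma weight_pos (hθ : θ = 0 ∨ θ = 1) {s : ℝ} (hs : s ∈ Ioo (0 : ℝ) 1) : 0 < weight β θ s := by
  obtain ⟨h0, h1⟩ := hs
  rcases hθ with rfl | rfl
  · rw [weight_zero]
    positivity
  · rw [weight_one]
    exact Real.rpow_pos_of_pos (sub_pos.2 h1) _

lemma memLp_weight (hβ' : β < 1 / 2) (hθ : θ = 0 ∨ θ = 1) : MemLp (weight β θ) 2 unitMeasure := by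
  have h := memLp_one_sub_rpow hβ'
  rw [← weight_one] at h
  rcases hθ with rfl | rfl
  · exact (h.comp_measurePreserving measurePreserving_one_sub).congr_norm
      (by rw [weight_zero]; exact Measurable.aestronglyMeasurable (by fun_prop))
      (ae_of_all _ fun s => by simp [weight_one_sub])
  · exact h

lemma deriv_comp_one_sub (φ : ℝ → ℝ) (x : ℝ) :
    deriv (fun s => φ (1 - s)) x = -deriv φ (1 - x) := by
  rw [deriv_comp_const_sub]

lemma leftInt_neg (σ : ℝ) (w : ℝ → ℝ) (x : ℝ) : leftInt σ (fun s => -w s) x = -leftInt σ w x := by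
  simp only [leftInt, neg_div, intervalIntegral.integral_neg, mul_neg]

lemma rightInt_deriv (β : ℝ) (φ : ℝ → ℝ) (x : ℝ) :
    rightInt β (deriv φ) x = -leftInt β (deriv fun s => φ (1 - s)) (1 - x) := by
  rw [rightInt_eq_leftInt, ← leftInt_neg]
  congr 1
  ext s
  rw [deriv_comp_one_sub, neg_neg]

lemma integral_sq_rightInt_deriv (β : ℝ) (φ : ℝ → ℝ) :
    ∫ x, rightInt β (deriv φ) x ^ 2 ∂unitMeasure =
      ∫ x, leftInt β (deriv fun s => φ (1 - s)) x ^ 2 ∂unitMeasure := by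
  rw [← integral_unitMeasure_comp_one_sub]
  simp [rightInt_deriv]

namespace IsTestFunction

lemma memLp_fracInt_deriv (hβ : 0 < β) (hθ : θ = 0 ∨ θ = 1) (hφ : IsTestFunction φ) :
    MemLp (fracInt β θ (deriv φ)) 2 unitMeasure := by
  rcases hθ with rfl | rfl
  · rw [fracInt_zero]
    have := ((hφ.comp_one_sub.memLp_leftInt_deriv hβ).comp_measurePreserving
      measurePreserving_one_sub).neg
    refine this.ae_eq (ae_of_all _ fun x => ?_)
    rw [rightInt_deriv]
    rfl
  · rw [fracInt_one]
    exact hφ.memLp_leftInt_deriv hβ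

lemma fracInt_eq (hβ : 0 < β) (hθ : θ = 0 ∨ θ = 1) (hφ : IsTestFunction φ) {x : ℝ}
    (hx : x ∈ Icc (0 : ℝ) 1) :
    fracInt β θ φ x = fracInt β θ φ 0 + ∫ t in (0 : ℝ)..x, fracInt β θ (deriv φ) t := by
  have hi := (hφ.memLp_fracInt_deriv hβ hθ).integrable (by norm_num)
  rcases hθ with rfl | rfl
  · have key : ∀ x ∈ Icc (0 : ℝ) 1, rightInt β φ x = -∫ t in x..1, rightInt β (deriv φ) t := by
      intro x hx
      rw [rightInt_eq_leftInt, hφ.comp_one_sub.leftInt_eq hβ (sub_nonneg.2 hx.2)]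
      have := intervalIntegral.integral_comp_sub_left (a := x) (b := 1)
        (fun t => leftInt β (deriv fun s => φ (1 - s)) t) 1
      rw [sub_self] at this
      rw [← this, ← intervalIntegral.integral_neg]
      refine intervalIntegral.integral_congr fun t _ => ?_
      rw [rightInt_deriv, neg_neg]
    rw [fracInt_zero] at hi ⊢
    have h1 : (1 : ℝ) ∈ Icc (0 : ℝ) 1 := ⟨zero_le_one, le_rfl⟩
    have h0 : (0 : ℝ) ∈ Icc (0 : ℝ) 1 := ⟨le_rfl, zero_le_one⟩
    have := intervalIntegral.integral_add_adjacent_intervals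
      (Integrable.intervalIntegrable_unit hi h0 hx) (Integrable.intervalIntegrable_unit hi hx h1)
    rw [key x hx, key 0 h0, fracInt_zero, ← this]
    ring
  · rw [fracInt_one, fracInt_one, hφ.leftInt_eq hβ hx.1, hφ.leftInt_eq hβ le_rfl]
    simp

lemma integral_weight_mul_fracInt (hβ : 0 < β) (hβ' : β < 1 / 2) (hθ : θ = 0 ∨ θ = 1)
    (hφ : IsTestFunction φ) :
    ∫ s, weight β θ s * fracInt β θ (deriv φ) s ∂unitMeasure = 0 := by
  rcases hθ with rfl | rfl
  · rw [fracInt_zero, ← integral_unitMeasure_comp_one_sub]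
    have := hφ.comp_one_sub.integral_weight_mul_leftInt hβ hβ'
    simpa [rightInt_deriv, weight_zero, integral_neg] using this
  · rw [fracInt_one, weight_one]
    exact hφ.integral_weight_mul_leftInt hβ hβ'

lemma sq_le_fracInt (hβ : 0 < β) (hβ' : β < 1 / 2) (hθ : θ = 0 ∨ θ = 1) (hφ : IsTestFunction φ)
    (x : ℝ) :
    φ x ^ 2 ≤ (1 / Real.Gamma (1 - β)) ^ 2 * (Real.Gamma (1 - 2 * β) / Real.Gamma (2 - 2 * β)) *
      ∫ s, fracInt β θ (deriv φ) s ^ 2 ∂unitMeasure := by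
  rcases hθ with rfl | rfl
  · rw [fracInt_zero, integral_sq_rightInt_deriv]
    simpa using hφ.comp_one_sub.sq_le_leftInt hβ hβ' (1 - x)
  · rw [fracInt_one]
    exact hφ.sq_le_leftInt hβ hβ' x

end IsTestFunction

/-- A function orthogonal to `I^β_θ φ'` for all test functions `φ` is a multiple of the weight. -/
lemma ae_eq_of_forall_integral_mul_fracInt_eq_zero (hβ : 0 < β) (hβ' : β < 1 / 2)
    (hθ : θ = 0 ∨ θ = 1) {h : ℝ → ℝ} (hh : Integrable h unitMeasure)
    (h0 : ∀ φ, IsTestFunction φ → ∫ s, h s * fracInt β θ (deriv φ) s ∂unitMeasure = 0) :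
    ∃ c : ℝ, h =ᵐ[unitMeasure] fun s => c * weight β θ s := by
  rcases hθ with rfl | rfl
  · simp only [fracInt_zero] at h0
    rw [weight_zero]
    exact ae_eq_of_forall_integral_mul_rightInt_eq_zero hβ hβ' hh h0
  · have hh' : Integrable (fun s => h (1 - s)) unitMeasure :=
      (measurePreserving_one_sub.integrable_comp hh.aestronglyMeasurable).2 hh
    obtain ⟨c, hc⟩ := ae_eq_of_forall_integral_mul_rightInt_eq_zero hβ hβ' hh' fun φ hφ => by
      have := h0 _ hφ.comp_one_sub
      rw [fracInt_one, ← integral_unitMeasure_comp_one_sub] at this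
      simpa [rightInt_deriv, integral_neg] using this
    refine ⟨c, ?_⟩
    have := measurePreserving_one_sub.quasiMeasurePreserving.ae_eq_comp hc
    filter_upwards [this] with s hs
    simpa [weight_one] using hs

end TwoSided

end FracDiff

namespace FracDiff

/-! ### The complex Laplace transform of a power. -/

section LaplaceTransform

open Set Complex ProbabilityTheory

lemma integrableOn_rpow_mul_exp {β r : ℝ} (hβ : 0 < β) (hr : 0 < r) :
    IntegrableOn (fun t : ℝ => t ^ (β - 1) * Real.exp (-(r * t))) (Ioi 0) := by
  by_contra h
  have h0 := integral_undef h
  rw [Real.integral_rpow_mul_exp_neg_mul_Ioi hβ hr] at h0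
  have := Real.Gamma_pos_of_pos hβ
  have : 0 < (1 / r) ^ β * Real.Gamma β := by positivity
  exact this.ne' h0

/-- The Laplace transform of `t ^ (β - 1)` on the right half plane. -/
lemma integral_rpow_mul_cexp {β : ℝ} (hβ : 0 < β) {z : ℂ} (hz : 0 < z.re) :
    ∫ t in Ioi (0 : ℝ), ((t ^ (β - 1) : ℝ) : ℂ) * cexp (-(z * t)) =
      Real.Gamma β * z ^ (-(β : ℂ)) := by
  -- With t^{β-1} as a density, the Laplace transform is a complex moment generating function, which
  -- is analytic in the interior of its strip of convergence.
  set ν : Measure ℝ := (volume.restrict (Ioi 0)).withDensity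
    fun t => ((Real.toNNReal (t ^ (β - 1)) : NNReal) : ENNReal) with hν
  have hmeas : Measurable fun t : ℝ => Real.toNNReal (t ^ (β - 1)) := by fun_prop
  have hM : ∀ w : ℂ, complexMGF id ν w =
      ∫ t in Ioi (0 : ℝ), ((t ^ (β - 1) : ℝ) : ℂ) * cexp (w * t) := by
    intro w
    rw [complexMGF, hν, integral_withDensity_eq_integral_smul hmeas]
    refine setIntegral_congr_fun measurableSet_Ioi fun t ht => ?_
    have : 0 ≤ t ^ (β - 1) := Real.rpow_nonneg (le_of_lt ht) _
    simp only [NNReal.smul_def, Real.coe_toNNReal _ this, id]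
    rfl
  have hset : Iio (0 : ℝ) ⊆ interior (integrableExpSet id ν) := by
    refine interior_maximal (fun r hr => ?_) isOpen_Iio
    rw [integrableExpSet, mem_ofPred_eq, hν, integrable_withDensity_iff_integrable_smul hmeas]
    refine (integrableOn_rpow_mul_exp hβ (neg_pos.2 hr)).congr_fun (fun t ht => ?_) measurableSet_Ioi
    have : 0 ≤ t ^ (β - 1) := Real.rpow_nonneg (le_of_lt ht) _
    simp only [NNReal.smul_def, Real.coe_toNNReal _ this, id, smul_eq_mul, neg_mul, neg_neg]
  have hA : AnalyticOnNhd ℂ (complexMGF id ν) {w | w.re < 0} :=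
    analyticOnNhd_complexMGF.mono fun w hw => hset hw
  have hB : AnalyticOnNhd ℂ (fun w : ℂ => Real.Gamma β * (-w) ^ (-(β : ℂ))) {w | w.re < 0} := by
    refine DifferentiableOn.analyticOnNhd ?_ (isOpen_lt continuous_re continuous_const)
    refine DifferentiableOn.const_mul ?_ _
    refine DifferentiableOn.cpow (by fun_prop) (by fun_prop) fun w hw => Or.inl ?_
    simpa using hw
  have hcv : Convex ℝ {w : ℂ | w.re < 0} := convex_halfSpace_re_lt 0
  have hreal : ∀ r : ℝ, 0 < r → complexMGF id ν (-r : ℝ) =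
      Real.Gamma β * (-((-r : ℝ) : ℂ)) ^ (-(β : ℂ)) := by
    intro r hr
    rw [hM]
    have h1 := Real.integral_rpow_mul_exp_neg_mul_Ioi hβ hr
    have h2 : ∫ t in Ioi (0 : ℝ), ((t ^ (β - 1) : ℝ) : ℂ) * cexp ((-r : ℝ) * t) =
        ((∫ t in Ioi (0 : ℝ), t ^ (β - 1) * Real.exp (-(r * t)) : ℝ) : ℂ) := by
      rw [← integral_complex_ofReal]
      congr 1
      ext t
      push_cast
      ring_nf
    rw [h2, h1, ofReal_neg, neg_neg, ← ofReal_neg, ← ofReal_cpow hr.le, one_div,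
      Real.inv_rpow hr.le, Real.rpow_neg hr.le, ofReal_mul, mul_comm]
  -- Identity theorem: both sides are analytic on Re w < 0 and agree on the negative reals, which
  -- accumulate at -1.
  have hfreq : ∃ᶠ w in nhdsWithin (-1 : ℂ) {-1}ᶜ, complexMGF id ν w =
      Real.Gamma β * (-w) ^ (-(β : ℂ)) := by
    have ht : Filter.Tendsto (fun r : ℝ => ((-r : ℝ) : ℂ)) (nhdsWithin 1 {1}ᶜ)
        (nhdsWithin (-1 : ℂ) {-1}ᶜ) := by
      refine tendsto_nhdsWithin_iff.2 ⟨?_, ?_⟩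
      · refine (Continuous.tendsto' (by fun_prop) _ _ (by simp)).mono_left nhdsWithin_le_nhds
      · filter_upwards [self_mem_nhdsWithin] with r hr hr'
        exact hr (by simpa using hr')
    refine ht.frequently (Filter.Eventually.frequently ?_)
    filter_upwards [nhdsWithin_le_nhds (Ioi_mem_nhds (zero_lt_one' ℝ))] with r hr
    exact hreal r hr
  have := hA.eqOn_of_preconnected_of_frequently_eq hB hcv.isPreconnected
    (show (-1 : ℂ) ∈ {w : ℂ | w.re < 0} by simp) hfreq (show -z ∈ {w : ℂ | w.re < 0} by simpa)
  simp only [hM, neg_neg] at this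
  rw [← this]
  simp only [neg_mul]

end LaplaceTransform

/-! ### Fourier transform of the damped kernel, and Parseval. -/

section FourierEstimates

open Set Complex

/-- The exponentially damped kernel of the fractional integral on the whole line. -/
noncomputable def dampedKernel (β ε : ℝ) : ℝ → ℂ :=
  (Ioi 0).indicator fun y => ((1 / Real.Gamma β * (y ^ (β - 1) * Real.exp (-(ε * y))) : ℝ) : ℂ)

lemma integrable_dampedKernel {β ε : ℝ} (hβ : 0 < β) (hε : 0 < ε) :
    Integrable (dampedKernel β ε) :=
  (integrable_indicator_iff measurableSet_Ioi).2
    ((integrableOn_rpow_mul_exp hβ hε).const_mul (1 / Real.Gamma β)).ofReal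

/-- The Fourier transform is the Laplace transform at z = ε + 2πiξ; the damping keeps z in the open
right half plane. -/
lemma fourier_dampedKernel {β ε : ℝ} (hβ : 0 < β) (hε : 0 < ε) (ξ : ℝ) :
    𝓕 (dampedKernel β ε) ξ = (ε + 2 * Real.pi * ξ * I : ℂ) ^ (-(β : ℂ)) := by
  have hG := (Real.Gamma_pos_of_pos hβ).ne'
  have hz : 0 < (ε + 2 * Real.pi * ξ * I : ℂ).re := by simp [hε]
  have h := integral_rpow_mul_cexp hβ hz
  rw [Real.fourier_eq', ← inv_mul_cancel_left₀ (ofReal_ne_zero.2 hG)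
    ((ε + 2 * Real.pi * ξ * I : ℂ) ^ (-(β : ℂ))), ← h, ← integral_const_mul,
    ← integral_indicator measurableSet_Ioi]
  congr 1
  ext y
  by_cases hy : y ∈ Ioi (0 : ℝ)
  · rw [dampedKernel, indicator_of_mem hy, indicator_of_mem hy, smul_eq_mul]
    push_cast
    rw [show -((ε + 2 * Real.pi * ξ * I : ℂ) * y) = ((-2 * Real.pi * (ξ * y) : ℝ) : ℂ) * I + (-(ε * y)) by
      push_cast; ring, Complex.exp_add]
    simp only [RCLike.inner_apply, conj_trivial]
    push_cast
    ring_nf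
  · rw [dampedKernel, indicator_of_notMem hy, indicator_of_notMem hy, smul_zero]

open scoped ComplexConjugate in
/-- Parseval's identity. -/
lemma integral_conj_fourier_mul_fourier {f g : ℝ → ℂ} (hf : Integrable f) (hg : Integrable g)
    (hgc : Continuous g) (hG : Integrable (𝓕 g)) :
    ∫ ξ, conj (𝓕 f ξ) * 𝓕 g ξ = ∫ x, conj (f x) * g x := by
  have h := VectorFourier.integral_sesq_fourierIntegral_eq_neg_flip (innerSL ℂ (E := ℂ))
    (L := innerₗ ℝ) Real.continuous_fourierChar (by exact continuous_inner) hf hG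
    (μ := volume) (ν := volume)
  have hinv := hgc.fourierInv_fourier_eq hg hG
  have e : ∀ x, VectorFourier.fourierIntegral Real.fourierChar volume (-(innerₗ ℝ).flip) (𝓕 g) x =
      g x := by
    intro x
    rw [← congrFun hinv x]
    simp [Real.fourierInv_eq, VectorFourier.fourierIntegral]
  simp only [innerSL_apply_apply, RCLike.inner_apply, e] at h
  simpa only [mul_comm] using! h

end FourierEstimates
end FracDiff

namespace FracDiff

/-! ### Fourier transforms of test functions. -/

section FourierOfTestFunctions

open Set Complex

namespace IsTestFunction

variable {φ : ℝ → ℝ}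

lemma contDiff_ofReal (h : IsTestFunction φ) : ContDiff ℝ ∞ (fun x => (φ x : ℂ)) :=
  ofRealCLM.contDiff.comp h.1

lemma hasCompactSupport_ofReal (h : IsTestFunction φ) : HasCompactSupport fun x => (φ x : ℂ) :=
  h.2.1.comp_left (g := ((↑) : ℝ → ℂ)) ofReal_zero

/-- A test function as a complex valued Schwartz function. -/
noncomputable def toSchwartz (h : IsTestFunction φ) : SchwartzMap ℝ ℂ :=
  h.hasCompactSupport_ofReal.toSchwartzMap h.contDiff_ofReal

lemma fourier_eq_toSchwartz (h : IsTestFunction φ) :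
    𝓕 (fun x => (φ x : ℂ)) = 𝓕 h.toSchwartz := by
  rw [SchwartzMap.fourier_coe]
  rfl

lemma integrable_ofReal (h : IsTestFunction φ) : Integrable fun x => (φ x : ℂ) := h.integrable.ofReal

lemma continuous_fourier (h : IsTestFunction φ) : Continuous (𝓕 fun x => (φ x : ℂ)) := by
  rw [h.fourier_eq_toSchwartz]
  exact (𝓕 h.toSchwartz).continuous

lemma integrable_fourier (h : IsTestFunction φ) : Integrable (𝓕 fun x => (φ x : ℂ)) := by
  rw [h.fourier_eq_toSchwartz]
  exact (𝓕 h.toSchwartz).integrable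

lemma integrable_norm_fourier_sq (h : IsTestFunction φ) :
    Integrable fun ξ => ‖𝓕 (fun x => (φ x : ℂ)) ξ‖ ^ 2 := by
  rw [h.fourier_eq_toSchwartz, ← memLp_two_iff_integrable_sq_norm
    (𝓕 h.toSchwartz).continuous.aestronglyMeasurable]
  exact (𝓕 h.toSchwartz).memLp 2

/-- Plancherel's theorem. -/
lemma integral_norm_fourier_sq (h : IsTestFunction φ) :
    ∫ ξ, ‖𝓕 (fun x => (φ x : ℂ)) ξ‖ ^ 2 = ∫ x, φ x ^ 2 := by
  rw [h.fourier_eq_toSchwartz, SchwartzMap.integral_norm_sq_fourier]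
  refine integral_congr_ae (ae_of_all _ fun x => ?_)
  change ‖(φ x : ℂ)‖ ^ 2 = _
  simp

lemma fourier_deriv_apply (h : IsTestFunction φ) (ξ : ℝ) :
    𝓕 (fun x => ((deriv φ x : ℝ) : ℂ)) ξ = 2 * Real.pi * I * ξ * 𝓕 (fun x => (φ x : ℂ)) ξ := by
  have hd : deriv (fun x => (φ x : ℂ)) = fun x => ((deriv φ x : ℝ) : ℂ) :=
    funext fun x => (h.differentiable x).hasDerivAt.ofReal_comp.deriv
  have := Real.fourier_deriv h.integrable_ofReal (h.contDiff_ofReal.differentiable (by simp))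
    (by rw [hd]; exact h.isTestFunction_deriv.integrable_ofReal)
  rw [hd] at this
  rw [this]
  rfl

lemma norm_fourier_deriv (h : IsTestFunction φ) (ξ : ℝ) :
    ‖𝓕 (fun x => ((deriv φ x : ℝ) : ℂ)) ξ‖ = 2 * Real.pi * |ξ| * ‖𝓕 (fun x => (φ x : ℂ)) ξ‖ := by
  rw [h.fourier_deriv_apply]
  simp [abs_of_pos Real.pi_pos]

/-- For 0 ≤ μ ≤ 1 one has t^{2μ} ≤ 1 + t², so the transforms of φ and φ' dominate. -/
lemma integrable_rpow_mul_fourier_sq (h : IsTestFunction φ) {μ : ℝ} (hμ : 0 ≤ μ) (hμ1 : μ ≤ 1) :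
    Integrable fun ξ => ((2 * Real.pi * |ξ|) ^ μ * ‖𝓕 (fun x => (φ x : ℂ)) ξ‖) ^ 2 := by
  refine (h.integrable_norm_fourier_sq.add
    h.isTestFunction_deriv.integrable_norm_fourier_sq).mono' ?_ (ae_of_all _ fun ξ => ?_)
  · have := h.continuous_fourier
    exact Measurable.aestronglyMeasurable (by fun_prop)
  · simp only [Pi.add_apply, h.norm_fourier_deriv, mul_pow]
    have ha : 0 ≤ 2 * Real.pi * |ξ| := by positivity
    rw [Real.norm_of_nonneg (by positivity), ← one_add_mul, ← mul_pow 2, ← mul_pow (2 * Real.pi)]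
    refine mul_le_mul_of_nonneg_right ?_ (sq_nonneg _)
    rcases le_total (2 * Real.pi * |ξ|) 1 with h1 | h1
    · have := Real.rpow_le_one ha h1 hμ
      have h2 : ((2 * Real.pi * |ξ|) ^ μ) ^ 2 ≤ 1 := pow_le_one₀ (by positivity) this
      nlinarith [sq_nonneg (2 * Real.pi * |ξ|)]
    · have := Real.rpow_le_rpow_of_exponent_le h1 hμ1
      rw [Real.rpow_one] at this
      have h2 : ((2 * Real.pi * |ξ|) ^ μ) ^ 2 ≤ (2 * Real.pi * |ξ|) ^ 2 := by gcongr
      linarith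

end IsTestFunction

/-- The square of z^{-β} has argument -2β arg z, of modulus at most πβ because |arg z| < π/2. -/
lemma re_sq_cpow_ge {β : ℝ} (hβ : 0 < β) (hβ' : β < 1 / 2) {z : ℂ} (hz : 0 < z.re) :
    Real.cos (Real.pi * β) * ‖z ^ (-(β : ℂ))‖ ^ 2 ≤ ((z ^ (-(β : ℂ))) ^ 2).re := by
  have hz0 : z ≠ 0 := by
    rintro rfl
    simp at hz
  have harg := abs_arg_lt_pi_div_two_iff.2 (Or.inl hz)
  rw [cpow_def_of_ne_zero hz0, ← Complex.exp_nat_mul, norm_exp, ← Real.exp_nat_mul, exp_re]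
  have e1 : (((2 : ℕ) : ℂ) * (log z * -(β : ℂ))).re = (2 : ℕ) * (log z * -(β : ℂ)).re := by
    simp
  have e2 : (((2 : ℕ) : ℂ) * (log z * -(β : ℂ))).im = -(2 * β * z.arg) := by
    simp [log_im]
    ring
  rw [e1, e2, mul_comm, Real.cos_neg]
  refine mul_le_mul_of_nonneg_left ?_ (Real.exp_pos _).le
  rw [← Real.cos_abs (2 * β * z.arg)]
  have h1 : |2 * β * z.arg| ≤ Real.pi * β := by
    rw [abs_mul, abs_of_pos (by positivity : 0 < 2 * β)]
    nlinarith
  exact Real.cos_le_cos_of_nonneg_of_le_pi (abs_nonneg _) (by nlinarith [Real.pi_pos]) h1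

/-! ### Two-sided estimate for the damped potentials and the limit ε → 0. -/

section DampedEstimate

open scoped Convolution ComplexConjugate

variable {β ε : ℝ} {φ : ℝ → ℝ}

/-- Since e^{-ε(x-t)} = e^{-εx} e^{εt}, the convolution on the line is a left fractional integral
between exponential weights. -/
lemma convolution_dampedKernel_of_nonneg (hφ : IsTestFunction φ) {x : ℝ} (hx : 0 ≤ x) :
    (dampedKernel β ε ⋆[ContinuousLinearMap.mul ℂ ℂ] fun t => (φ t : ℂ)) x =
      ((Real.exp (-(ε * x)) * leftInt β (fun s => Real.exp (ε * s) * φ s) x : ℝ) : ℂ) := by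
  rw [convolution_mul_swap, leftInt_eq_setIntegral _ _ hx, ← integral_const_mul,
    ← integral_const_mul, ← integral_complex_ofReal, ← integral_indicator measurableSet_Ioo]
  congr 1
  ext t
  by_cases ht : t ∈ Ioo 0 x
  · rw [indicator_of_mem ht, dampedKernel, indicator_of_mem (show x - t ∈ Ioi 0 from sub_pos.2 ht.2),
      ← ofReal_mul, show -(ε * (x - t)) = -(ε * x) + ε * t by ring, Real.exp_add]
    congr 1
    ring
  · rw [indicator_of_notMem ht]
    rw [mem_Ioo, not_and_or, not_lt, not_lt] at ht
    rcases ht with ht | ht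
    · rw [hφ.eq_zero_of_notMem (fun h => h.1.not_ge ht), ofReal_zero, mul_zero]
    · rw [dampedKernel, indicator_of_notMem (by simpa using ht), zero_mul]

/-- With `convolution_dampedKernel_neg_of_ge` this confines the product of the left and right
potentials to (0,1). -/
lemma convolution_dampedKernel_of_nonpos (hφ : IsTestFunction φ) {x : ℝ} (hx : x ≤ 0) :
    (dampedKernel β ε ⋆[ContinuousLinearMap.mul ℂ ℂ] fun t => (φ t : ℂ)) x = 0 := by
  rw [convolution_mul_swap]
  refine integral_eq_zero_of_ae (ae_of_all _ fun t => ?_)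
  rcases le_or_gt t 0 with ht | ht
  · simp [hφ.eq_zero_of_notMem (fun h => h.1.not_ge ht)]
  · simp [dampedKernel, (hx.trans_lt ht).le]

lemma convolution_dampedKernel_neg_of_ge (hφ : IsTestFunction φ) {x : ℝ} (hx : 1 ≤ x) :
    ((fun t => dampedKernel β ε (-t)) ⋆[ContinuousLinearMap.mul ℂ ℂ] fun t => (φ t : ℂ)) x = 0 := by
  rw [convolution_mul_swap]
  refine integral_eq_zero_of_ae (ae_of_all _ fun t => ?_)
  rcases le_or_gt 1 t with ht | ht
  · simp [hφ.eq_zero_of_notMem (fun h => h.2.not_ge ht)]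
  · simp [dampedKernel, (ht.trans_le hx).le]

lemma norm_fourier_dampedKernel (hβ : 0 < β) (hε : 0 < ε) (ξ : ℝ) :
    ‖𝓕 (dampedKernel β ε) ξ‖ = ‖(ε + 2 * Real.pi * ξ * I : ℂ)‖ ^ (-β) := by
  rw [fourier_dampedKernel hβ hε, ← ofReal_neg, norm_cpow_real]

lemma norm_fourier_dampedKernel_le (hβ : 0 < β) (hε : 0 < ε) (ξ : ℝ) :
    ‖𝓕 (dampedKernel β ε) ξ‖ ≤ ε ^ (-β) := by
  rw [norm_fourier_dampedKernel hβ hε]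
  refine Real.rpow_le_rpow_of_nonpos hε ?_ (by linarith)
  have := abs_re_le_norm (ε + 2 * Real.pi * ξ * I : ℂ)
  simpa [abs_of_pos hε] using this

lemma continuous_fourier_dampedKernel (hβ : 0 < β) (hε : 0 < ε) :
    Continuous (𝓕 (dampedKernel β ε)) := by
  rw [funext (fourier_dampedKernel hβ hε)]
  exact Continuous.cpow (by fun_prop) (by fun_prop) fun ξ => Or.inl (by simp [hε])

/-- Reflecting the kernel replaces z by its conjugate, and the principal power commutes with
conjugation away from the negative axis. -/
lemma fourier_dampedKernel_neg (hβ : 0 < β) (hε : 0 < ε) (ξ : ℝ) :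
    𝓕 (fun t => dampedKernel β ε (-t)) ξ = conj (𝓕 (dampedKernel β ε) ξ) := by
  have h1 : 𝓕 (fun t => dampedKernel β ε (-t)) ξ = 𝓕 (dampedKernel β ε) (-ξ) := by
    rw [Real.fourier_eq', Real.fourier_eq', ← integral_neg_eq_self]
    simp
  have hz : 0 < (ε + 2 * Real.pi * (-ξ : ℝ) * I : ℂ).re := by simp [hε]
  have h2 : (ε + 2 * Real.pi * (-ξ : ℝ) * I : ℂ).arg ≠ Real.pi := by
    have h2 := abs_arg_lt_pi_div_two_iff.2 (Or.inl hz)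
    have h3 := Real.pi_pos
    intro h
    rw [h, abs_of_pos h3] at h2
    linarith
  rw [h1, fourier_dampedKernel hβ hε, fourier_dampedKernel hβ hε,
    show (-(β : ℂ)) = conj (-(β : ℂ)) by simp, cpow_conj _ _ h2]
  simp [show (starRingEnd ℂ) 2 = 2 from map_ofNat _ 2]

/-- Two-sided estimate of the damped fractional integral on `(0,1)` by its Fourier transform. -/
lemma damped_estimate (hβ : 0 < β) (hβ' : β < 1 / 2) (hε : 0 < ε) (hφ : IsTestFunction φ) :
    Real.cos (Real.pi * β) ^ 2 *
        ∫ ξ, (‖𝓕 (dampedKernel β ε) ξ‖ * ‖𝓕 (fun x => (φ x : ℂ)) ξ‖) ^ 2 ≤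
      ∫ x, (Real.exp (-(ε * x)) * leftInt β (fun s => Real.exp (ε * s) * φ s) x) ^ 2 ∂unitMeasure ∧
    ∫ x, (Real.exp (-(ε * x)) * leftInt β (fun s => Real.exp (ε * s) * φ s) x) ^ 2 ∂unitMeasure ≤
      ∫ ξ, (‖𝓕 (dampedKernel β ε) ξ‖ * ‖𝓕 (fun x => (φ x : ℂ)) ξ‖) ^ 2 := by
  set ψ : ℝ → ℂ := fun x => (φ x : ℂ) with hψ
  set k := dampedKernel β ε with hk
  set k' : ℝ → ℂ := fun t => k (-t) with hk'
  have ik : Integrable k := integrable_dampedKernel hβ hε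
  have ik' : Integrable k' := ik.comp_neg
  have iψ : Integrable ψ := hφ.integrable_ofReal
  have cψ : Continuous ψ := hφ.contDiff_ofReal.continuous
  obtain ⟨M, hM⟩ := hφ.exists_bound
  have hψM : ∀ x, ‖ψ x‖ ≤ M := fun x => by
    rw [hψ, norm_real]
    exact hM x
  have bψ : BddAbove (range fun x => ‖ψ x‖) := ⟨M, by rintro _ ⟨x, rfl⟩; exact hψM x⟩
  set G := k ⋆[ContinuousLinearMap.mul ℂ ℂ] ψ with hG
  set G' := k' ⋆[ContinuousLinearMap.mul ℂ ℂ] ψ with hG'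
  have cG : Continuous G := bψ.continuous_convolution_right_of_integrable _ ik cψ
  have cG' : Continuous G' := bψ.continuous_convolution_right_of_integrable _ ik' cψ
  have iG : Integrable G := ik.integrable_convolution _ iψ
  have iG' : Integrable G' := ik'.integrable_convolution _ iψ
  have FG : ∀ ξ, 𝓕 G ξ = 𝓕 k ξ * 𝓕 ψ ξ := Real.fourier_mul_convolution_eq ik iψ
  have FG' : ∀ ξ, 𝓕 G' ξ = conj (𝓕 k ξ) * 𝓕 ψ ξ := fun ξ => by
    rw [hG', Real.fourier_mul_convolution_eq ik' iψ, hk', hk, fourier_dampedKernel_neg hβ hε]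
  have ck : Continuous (𝓕 k) := continuous_fourier_dampedKernel hβ hε
  have iFG : Integrable (𝓕 G) := by
    rw [funext FG]
    exact hφ.integrable_fourier.bdd_mul (c := ε ^ (-β)) ck.aestronglyMeasurable
      (ae_of_all _ (norm_fourier_dampedKernel_le hβ hε))
  have iFG' : Integrable (𝓕 G') := by
    rw [funext FG']
    exact hφ.integrable_fourier.bdd_mul (c := ε ^ (-β))
      (continuous_conj.comp ck).aestronglyMeasurable
      (ae_of_all _ fun ξ => by
        rw [RCLike.norm_conj]; exact norm_fourier_dampedKernel_le hβ hε ξ)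
  have bG : ∀ {h : ℝ → ℂ}, Integrable h → ∀ x,
      ‖(h ⋆[ContinuousLinearMap.mul ℂ ℂ] ψ) x‖ ≤ ∫ t, ‖h t‖ * M := by
    intro h hh x
    refine norm_integral_le_of_norm_le (hh.norm.mul_const M) (ae_of_all _ fun t => ?_)
    rw [ContinuousLinearMap.mul_apply', norm_mul]
    exact mul_le_mul_of_nonneg_left (hψM _) (norm_nonneg _)
  have sqG : ∀ {g : ℝ → ℂ} {C : ℝ}, Integrable g → (∀ x, ‖g x‖ ≤ C) →
      Integrable fun x => ‖g x‖ ^ 2 := by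
    intro g C hg hC
    simp_rw [sq]
    exact hg.norm.bdd_mul (c := C) hg.norm.aestronglyMeasurable
      (ae_of_all _ fun x => by rw [norm_norm]; exact hC x)
  have iG2 := sqG iG (bG ik)
  have iG2' := sqG iG' (bG ik')
  have hnorm : ∀ {g : ℝ → ℂ}, Integrable g → Continuous g → Integrable (𝓕 g) →
      ∫ x, ‖g x‖ ^ 2 = ∫ ξ, ‖𝓕 g ξ‖ ^ 2 := by
    intro g hg hgc hF
    have := integral_conj_fourier_mul_fourier hg hg hgc hF
    simp only [conj_mul'] at this
    norm_cast at this
    exact this.symm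
  have NG : ∫ x, ‖G x‖ ^ 2 = ∫ ξ, (‖𝓕 k ξ‖ * ‖𝓕 ψ ξ‖) ^ 2 := by
    rw [hnorm iG cG iFG]
    simp only [FG, norm_mul]
  have NG' : ∫ x, ‖G' x‖ ^ 2 = ∫ ξ, (‖𝓕 k ξ‖ * ‖𝓕 ψ ξ‖) ^ 2 := by
    rw [hnorm iG' cG' iFG']
    simp only [FG', norm_mul, RCLike.norm_conj]
  have XG : ∫ x, (Real.exp (-(ε * x)) * leftInt β (fun s => Real.exp (ε * s) * φ s) x) ^ 2
      ∂unitMeasure = ∫ x, ‖G x‖ ^ 2 ∂unitMeasure := by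
    refine integral_congr_ae (ae_unitMeasure_of_forall fun x hx => ?_)
    simp only [hG, hk, hψ]
    rw [convolution_dampedKernel_of_nonneg hφ hx.1.le, norm_real, Real.norm_eq_abs, sq_abs]
  set N := ∫ ξ, (‖𝓕 k ξ‖ * ‖𝓕 ψ ξ‖) ^ 2 with hN
  rw [XG]
  have hN0 : 0 ≤ N := integral_nonneg fun ξ => sq_nonneg _
  have hle : unitMeasure ≤ volume := Measure.restrict_le_self
  refine ⟨?_, ?_⟩
  swap
  · rw [← NG]
    exact integral_mono_measure hle (ae_of_all _ fun x => sq_nonneg _) iG2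
  -- Pair the right potential with the left one: the conjugate symbols combine to (z^{-β})², whose
  -- real part stays positive.
  have hcross := integral_conj_fourier_mul_fourier iG' iG cG iFG
  have hint : Integrable fun ξ => conj (𝓕 G' ξ) * 𝓕 G ξ := by
    refine (iFG.bdd_mul (c := ∫ t, ‖G' t‖) ?_ (ae_of_all _ fun ξ => ?_))
    · rw [funext FG']
      have := hφ.continuous_fourier
      exact (continuous_conj.comp ((continuous_conj.comp ck).mul this)).aestronglyMeasurable
    · rw [RCLike.norm_conj]
      exact VectorFourier.norm_fourierIntegral_le_integral_norm _ _ _ _ _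
  have hre : Real.cos (Real.pi * β) * N ≤ (∫ ξ, conj (𝓕 G' ξ) * 𝓕 G ξ).re := by
    have h1 := reCLM.integral_comp_comm hint
    simp only [reCLM_apply] at h1
    rw [← h1, hN, ← integral_const_mul]
    have hre : Integrable fun ξ => (conj (𝓕 G' ξ) * 𝓕 G ξ).re := hint.re
    refine integral_mono_of_nonneg ?_ hre (ae_of_all _ fun ξ => ?_)
    · refine ae_of_all _ fun ξ => mul_nonneg ?_ (sq_nonneg _)
      exact Real.cos_nonneg_of_neg_pi_div_two_le_of_le (by nlinarith [Real.pi_pos])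
        (by nlinarith [Real.pi_pos])
    · simp only [FG, FG', map_mul, conj_conj]
      rw [show 𝓕 k ξ * conj (𝓕 ψ ξ) * (𝓕 k ξ * 𝓕 ψ ξ) = 𝓕 k ξ ^ 2 * (conj (𝓕 ψ ξ) * 𝓕 ψ ξ) by ring,
        conj_mul', ← ofReal_pow, re_mul_ofReal, mul_pow, ← mul_assoc]
      refine mul_le_mul_of_nonneg_right ?_ (sq_nonneg _)
      rw [hk, fourier_dampedKernel hβ hε]
      exact re_sq_cpow_ge hβ hβ' (by simp [hε])
  -- The integral over the line becomes one over (0,1), since `G` vanishes for x ≤ 0 and `G'` for x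
  -- ≥ 1.
  have hcs : (∫ x, conj (G' x) * G x).re ≤ ∫ x, ‖G' x‖ * ‖G x‖ ∂unitMeasure := by
    refine (re_le_norm _).trans ((norm_integral_le_integral_norm _).trans (le_of_eq ?_))
    simp only [norm_mul, RCLike.norm_conj]
    rw [unitMeasure, setIntegral_eq_integral_of_forall_compl_eq_zero]
    intro x hx
    rw [mem_Ioo, not_and_or, not_lt, not_lt] at hx
    rcases hx with hx | hx
    · rw [hG, hk, convolution_dampedKernel_of_nonpos hφ hx, norm_zero, mul_zero]
    · rw [hG', hk', hk, convolution_dampedKernel_neg_of_ge hφ hx, norm_zero, zero_mul]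
  have mG : MemLp (fun x => ‖G x‖) 2 unitMeasure := by
    rw [memLp_two_iff_integrable_sq cG.norm.aestronglyMeasurable]
    exact iG2.restrict
  have mG' : MemLp (fun x => ‖G' x‖) 2 unitMeasure := by
    rw [memLp_two_iff_integrable_sq cG'.norm.aestronglyMeasurable]
    exact iG2'.restrict
  have hsq := sq_integral_mul_le mG' mG
  have hX' : ∫ x, ‖G' x‖ ^ 2 ∂unitMeasure ≤ N := by
    rw [← NG']
    exact integral_mono_measure hle (ae_of_all _ fun x => sq_nonneg _) iG2'
  have hX0 : 0 ≤ ∫ x, ‖G x‖ ^ 2 ∂unitMeasure := integral_nonneg fun x => sq_nonneg _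
  rw [hcross] at hre
  have hc : 0 ≤ Real.cos (Real.pi * β) :=
    Real.cos_nonneg_of_neg_pi_div_two_le_of_le (by nlinarith [Real.pi_pos])
        (by nlinarith [Real.pi_pos])
  have h1 : (Real.cos (Real.pi * β) * N) ^ 2 ≤ N * ∫ x, ‖G x‖ ^ 2 ∂unitMeasure := by
    refine (pow_le_pow_left₀ (by positivity) (hre.trans hcs) 2).trans (hsq.trans ?_)
    exact mul_le_mul_of_nonneg_right hX' hX0
  -- Cancel one factor N, which is possible unless N = 0.
  rcases hN0.eq_or_lt with h0 | h0
  · rw [← h0, mul_zero]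
    exact hX0
  · refine le_of_mul_le_mul_left ?_ h0
    linarith [h1]

open Filter Topology

/-- Dominated convergence in s and then in x: for ε ≤ 1 the weighted test function is at most
e·sup|φ|, since φ lives on (0,1). -/
lemma tendsto_integral_damped_leftInt (hβ : 0 < β) (hφ : IsTestFunction φ) :
    Tendsto (fun ε => ∫ x, (Real.exp (-(ε * x)) *
      leftInt β (fun s => Real.exp (ε * s) * φ s) x) ^ 2 ∂unitMeasure) (𝓝[>] 0)
      (𝓝 (∫ x, leftInt β φ x ^ 2 ∂unitMeasure)) := by
  obtain ⟨M, hM⟩ := hφ.exists_bound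
  have hε1 : ∀ᶠ ε : ℝ in 𝓝[>] 0, 0 < ε ∧ ε ≤ 1 := by
    filter_upwards [Ioc_mem_nhdsGT (zero_lt_one' ℝ)] with ε hε using hε
  have hb : ∀ {ε s : ℝ}, 0 < ε → ε ≤ 1 → |Real.exp (ε * s) * φ s| ≤ Real.exp 1 * M := by
    intro ε s h0 h1
    rw [abs_mul, abs_of_pos (Real.exp_pos _)]
    have hM0 : 0 ≤ M := (abs_nonneg _).trans (hM 0)
    by_cases hs : s ∈ Ioo (0 : ℝ) 1
    · exact mul_le_mul (Real.exp_le_exp.2 (by nlinarith [hs.1, hs.2])) (hM s) (abs_nonneg _)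
        (Real.exp_pos _).le
    · rw [hφ.eq_zero_of_notMem hs, abs_zero, mul_zero]
      positivity
  refine tendsto_integral_filter_of_dominated_convergence
    (fun _ => (Real.exp 1 * M / Real.Gamma (β + 1)) ^ 2) ?_ ?_ (integrable_const _) ?_
  · filter_upwards [hε1] with ε hε
    have hm : AEStronglyMeasurable (fun s => Real.exp (ε * s) * φ s) unitMeasure :=
      (Continuous.mul (by fun_prop) hφ.continuous).aestronglyMeasurable
    exact (((by fun_prop : Continuous fun x : ℝ => Real.exp (-(ε * x))).aestronglyMeasurable).mul
      (memLp_leftInt hβ hm fun s => hb hε.1 hε.2).aestronglyMeasurable).pow 2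
  · filter_upwards [hε1] with ε hε
    refine ae_unitMeasure_of_forall fun x hx => ?_
    rw [Real.norm_of_nonneg (sq_nonneg _), ← sq_abs, abs_mul, abs_of_pos (Real.exp_pos _)]
    refine pow_le_pow_left₀ (by positivity) ?_ 2
    refine (mul_le_of_le_one_left (abs_nonneg _) ?_).trans
      (abs_leftInt_le hβ (fun s => hb hε.1 hε.2) (Ioo_subset_Icc_self hx))
    exact Real.exp_le_one_iff.2 (by nlinarith [hε.1, hx.1])
  · refine ae_unitMeasure_of_forall fun x hx => ?_
    have h1 : Tendsto (fun ε : ℝ => Real.exp (-(ε * x))) (𝓝[>] 0) (𝓝 1) :=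
      (Continuous.tendsto' (by fun_prop) _ _ (by simp)).mono_left nhdsWithin_le_nhds
    have h2 : Tendsto (fun ε => leftInt β (fun s => Real.exp (ε * s) * φ s) x) (𝓝[>] 0)
        (𝓝 (leftInt β φ x)) := by
      simp only [leftInt_eq_setIntegral _ _ hx.1.le]
      refine Tendsto.const_mul _ ?_
      have hi := (integral_beta_kernel hβ one_pos hx.1).1
      simp only [sub_self, Real.rpow_zero, mul_one] at hi
      refine tendsto_integral_filter_of_dominated_convergence
        (fun s => (x - s) ^ (β - 1) * (Real.exp 1 * M)) ?_ ?_ (hi.mul_const _) ?_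
      · refine Eventually.of_forall fun ε => ?_
        have := hφ.continuous
        exact Measurable.aestronglyMeasurable (by fun_prop)
      · filter_upwards [hε1] with ε hε
        refine (ae_restrict_iff' measurableSet_Ioo).2 (ae_of_all _ fun s hs => ?_)
        have h0 : 0 < x - s := sub_pos.2 hs.2
        rw [norm_mul, Real.norm_of_nonneg (by positivity)]
        exact mul_le_mul_of_nonneg_left (hb hε.1 hε.2) (by positivity)
      · refine ae_of_all _ fun s => Tendsto.const_mul _ ?_
        exact (Continuous.tendsto' (by fun_prop) _ _ (by simp)).mono_left nhdsWithin_le_nhds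
    simpa using (h1.mul h2).pow 2

/-- The limit dominates: |ε + 2πiξ|^{-β} ≤ |2πξ|^{-β} for ξ ≠ 0, and at ξ = 0 the transform of φ'
vanishes. -/
lemma tendsto_integral_fourier_dampedKernel (hβ : 0 < β) (hβ' : β < 1 / 2)
    (hφ : IsTestFunction φ) :
    Tendsto (fun ε => ∫ ξ, (‖𝓕 (dampedKernel β ε) ξ‖ *
        ‖𝓕 (fun x => ((deriv φ x : ℝ) : ℂ)) ξ‖) ^ 2) (𝓝[>] 0)
      (𝓝 (∫ ξ, ((2 * Real.pi * |ξ|) ^ (1 - β) * ‖𝓕 (fun x => (φ x : ℂ)) ξ‖) ^ 2)) := by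
  have hlim : ∀ ξ : ℝ, (2 * Real.pi * |ξ|) ^ (1 - β) * ‖𝓕 (fun x => (φ x : ℂ)) ξ‖ =
      (2 * Real.pi * |ξ|) ^ (-β) * ‖𝓕 (fun x => ((deriv φ x : ℝ) : ℂ)) ξ‖ := by
    intro ξ
    rw [hφ.norm_fourier_deriv, ← mul_assoc]
    congr 1
    rcases eq_or_ne ξ 0 with rfl | h
    · simp [Real.zero_rpow (show 1 - β ≠ 0 by linarith)]
    · have : 0 < 2 * Real.pi * |ξ| := by positivity
      rw [← Real.rpow_add_one this.ne']
      congr 1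
      ring
  have hint := hφ.integrable_rpow_mul_fourier_sq (μ := 1 - β) (by linarith) (by linarith)
  simp only [hlim] at hint ⊢
  have hn : ∀ ξ : ℝ, ‖(2 * Real.pi * ξ * I : ℂ)‖ = 2 * Real.pi * |ξ| := fun ξ => by
    simp [abs_of_pos Real.pi_pos]
  refine tendsto_integral_filter_of_dominated_convergence _ ?_ ?_ hint ?_
  · filter_upwards [self_mem_nhdsWithin] with ε hε
    exact (((continuous_fourier_dampedKernel hβ hε).norm.mul
      hφ.isTestFunction_deriv.continuous_fourier.norm).pow 2).aestronglyMeasurable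
  · filter_upwards [self_mem_nhdsWithin] with ε hε
    refine ae_of_all _ fun ξ => ?_
    rw [Real.norm_of_nonneg (sq_nonneg _)]
    refine pow_le_pow_left₀ (by positivity) ?_ 2
    rcases eq_or_ne ξ 0 with rfl | h
    · rw [hφ.norm_fourier_deriv]
      simp
    · have : 0 < 2 * Real.pi * |ξ| := by positivity
      refine mul_le_mul_of_nonneg_right ?_ (norm_nonneg _)
      rw [norm_fourier_dampedKernel hβ hε]
      refine Real.rpow_le_rpow_of_nonpos this ?_ (by linarith)
      have := abs_im_le_norm (ε + 2 * Real.pi * ξ * I : ℂ)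
      simpa [abs_mul, abs_of_pos Real.pi_pos] using this
  · refine ae_of_all _ fun ξ => ?_
    rcases eq_or_ne ξ 0 with rfl | h
    · rw [hφ.norm_fourier_deriv]
      simp
    · have hpos : 0 < 2 * Real.pi * |ξ| := by positivity
      refine Tendsto.pow (Tendsto.mul_const _ ?_) 2
      have h1 : Tendsto (fun ε : ℝ => ‖(ε + 2 * Real.pi * ξ * I : ℂ)‖ ^ (-β)) (𝓝[>] 0)
          (𝓝 ((2 * Real.pi * |ξ|) ^ (-β))) := by
        refine Tendsto.rpow_const ?_ (Or.inl hpos.ne')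
        rw [← hn]
        exact (Continuous.tendsto' (by fun_prop) _ _ (by simp)).mono_left nhdsWithin_le_nhds
      refine h1.congr' ?_
      filter_upwards [self_mem_nhdsWithin] with ε hε
      rw [norm_fourier_dampedKernel hβ hε]

end DampedEstimate

variable {β θ : ℝ} {φ : ℝ → ℝ}

lemma IsTestFunction.leftInt_deriv_bounds (hβ : 0 < β) (hβ' : β < 1 / 2) (hφ : IsTestFunction φ) :
    Real.cos (Real.pi * β) ^ 2 *
        ∫ ξ, ((2 * Real.pi * |ξ|) ^ (1 - β) * ‖𝓕 (fun x => (φ x : ℂ)) ξ‖) ^ 2 ≤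
      ∫ x, leftInt β (deriv φ) x ^ 2 ∂unitMeasure ∧
    ∫ x, leftInt β (deriv φ) x ^ 2 ∂unitMeasure ≤
      ∫ ξ, ((2 * Real.pi * |ξ|) ^ (1 - β) * ‖𝓕 (fun x => (φ x : ℂ)) ξ‖) ^ 2 := by
  have h1 := tendsto_integral_damped_leftInt hβ hφ.isTestFunction_deriv
  have h2 := tendsto_integral_fourier_dampedKernel hβ hβ' hφ
  constructor
  · refine le_of_tendsto_of_tendsto (h2.const_mul _) h1 ?_
    filter_upwards [self_mem_nhdsWithin] with ε hε
    exact (damped_estimate hβ hβ' hε hφ.isTestFunction_deriv).1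
  · refine le_of_tendsto_of_tendsto h1 h2 ?_
    filter_upwards [self_mem_nhdsWithin] with ε hε
    exact (damped_estimate hβ hβ' hε hφ.isTestFunction_deriv).2

lemma norm_fourier_comp_one_sub (φ : ℝ → ℝ) (ξ : ℝ) :
    ‖𝓕 (fun x => (φ (1 - x) : ℂ)) ξ‖ = ‖𝓕 (fun x => (φ x : ℂ)) (-ξ)‖ := by
  have : 𝓕 (fun x => (φ (1 - x) : ℂ)) ξ =
      cexp (((-2 * Real.pi * ξ : ℝ) : ℂ) * I) * 𝓕 (fun x => (φ x : ℂ)) (-ξ) := by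
    rw [Real.fourier_eq', Real.fourier_eq', ← integral_const_mul, ← integral_sub_left_eq_self _ _ 1]
    congr 1
    ext x
    simp only [sub_sub_cancel, smul_eq_mul, RCLike.inner_apply, conj_trivial, ← mul_assoc,
      ← Complex.exp_add]
    congr 2
    push_cast
    ring
  rw [this, norm_mul, norm_exp_ofReal_mul_I, one_mul]

/-- The `L²(0,1)` norm of `D I^β_θ φ` is equivalent to the seminorm of order `1 - β`. -/
lemma IsTestFunction.fracInt_deriv_bounds (hβ : 0 < β) (hβ' : β < 1 / 2) (hθ : θ = 0 ∨ θ = 1)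
    (hφ : IsTestFunction φ) :
    Real.cos (Real.pi * β) ^ 2 *
        ∫ ξ, ((2 * Real.pi * |ξ|) ^ (1 - β) * ‖𝓕 (fun x => (φ x : ℂ)) ξ‖) ^ 2 ≤
      ∫ x, fracInt β θ (deriv φ) x ^ 2 ∂unitMeasure ∧
    ∫ x, fracInt β θ (deriv φ) x ^ 2 ∂unitMeasure ≤
      ∫ ξ, ((2 * Real.pi * |ξ|) ^ (1 - β) * ‖𝓕 (fun x => (φ x : ℂ)) ξ‖) ^ 2 := by
  rcases hθ with rfl | rfl
  · have h := hφ.comp_one_sub.leftInt_deriv_bounds hβ hβ'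
    have e : ∫ ξ, ((2 * Real.pi * |ξ|) ^ (1 - β) * ‖𝓕 (fun x => (φ (1 - x) : ℂ)) ξ‖) ^ 2 =
        ∫ ξ, ((2 * Real.pi * |ξ|) ^ (1 - β) * ‖𝓕 (fun x => (φ x : ℂ)) ξ‖) ^ 2 := by
      rw [← integral_neg_eq_self]
      simp only [norm_fourier_comp_one_sub, abs_neg, neg_neg]
    rw [e, ← integral_sq_rightInt_deriv] at h
    rwa [fracInt_zero]
  · rw [fracInt_one]
    exact hφ.leftInt_deriv_bounds hβ hβ'

end FourierOfTestFunctions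

end FracDiff

namespace FracDiff

/-! ### Density of test functions and extension by continuity. -/

section FractionalSobolevSpaces

open Set Filter Topology

instance (μ : ℝ) : CompleteSpace (H0 μ) :=
  (Submodule.isClosed_topologicalClosure (Submodule.span ℝ (testGraph μ))).completeSpace_coe

namespace IsTestFunction

variable {μ : ℝ} {φ ψ : ℝ → ℝ}

lemma memLp_symbol_mul_fourier (h : IsTestFunction φ) (hμ : μ ∈ Icc (0 : ℝ) 1) :
    MemLp (fun ξ => (((2 * Real.pi * |ξ|) ^ μ : ℝ) : ℂ) * 𝓕 (fun x : ℝ => (φ x : ℂ)) ξ) 2 volume := by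
  have hm : Measurable fun ξ => (((2 * Real.pi * |ξ|) ^ μ : ℝ) : ℂ) *
      𝓕 (fun x : ℝ => (φ x : ℂ)) ξ := by
    have := h.continuous_fourier
    fun_prop
  rw [memLp_two_iff_integrable_sq_norm hm.aestronglyMeasurable]
  refine (h.integrable_rpow_mul_fourier_sq hμ.1 hμ.2).congr (ae_of_all _ fun ξ => ?_)
  simp only
  rw [norm_mul, Complex.norm_real, Real.norm_of_nonneg (by positivity)]

lemma fourier_add (h : IsTestFunction φ) (h' : IsTestFunction ψ) (ξ : ℝ) :
    𝓕 (fun x => ((φ + ψ) x : ℂ)) ξ = 𝓕 (fun x => (φ x : ℂ)) ξ + 𝓕 (fun x => (ψ x : ℂ)) ξ := by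
  have h1 := (Real.fourierIntegral_convergent_iff ξ).2 h.integrable_ofReal
  have h2 := (Real.fourierIntegral_convergent_iff ξ).2 h'.integrable_ofReal
  rw [Real.fourier_eq, Real.fourier_eq, Real.fourier_eq, ← integral_add h1 h2]
  simp

lemma fourier_smul (c : ℝ) (φ : ℝ → ℝ) (ξ : ℝ) :
    𝓕 (fun x => ((c • φ) x : ℂ)) ξ = c * 𝓕 (fun x => (φ x : ℂ)) ξ := by
  rw [Real.fourier_eq', Real.fourier_eq', ← integral_const_mul]
  congr 1
  ext x
  simp
  ring

end IsTestFunction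

lemma isTestFunction_coe (φ : testSpace) : IsTestFunction (φ : ℝ → ℝ) := φ.2

lemma norm_sq_toLp_complex {α : Type*} [MeasurableSpace α] {μ : Measure α} {f : α → ℂ}
    (hf : MemLp f 2 μ) : ‖hf.toLp f‖ ^ 2 = ∫ x, ‖f x‖ ^ 2 ∂μ := by
  have h := L2.inner_def (𝕜 := ℂ) (hf.toLp f) (hf.toLp f)
  simp only [inner_self_eq_norm_sq_to_K] at h
  have e : ∀ r : ℝ, (RCLike.ofReal r : ℂ) ^ 2 = ((r ^ 2 : ℝ) : ℂ) := fun r => by simp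
  simp only [e] at h
  rw [integral_complex_ofReal, Complex.ofReal_inj] at h
  rw [h]
  refine integral_congr_ae ?_
  filter_upwards [hf.coeFn_toLp] with x hx
  rw [hx]

/-- The element of `H^μ_0(0,1)` given by a test function. -/
noncomputable def testPair {μ : ℝ} (hμ : μ ∈ Icc (0 : ℝ) 1) (φ : testSpace) : L2Pair :=
  WithLp.toLp 2 (((isTestFunction_coe φ).memLp 2 volume).toLp φ, ((isTestFunction_coe φ).memLp_symbol_mul_fourier hμ).toLp
    fun ξ => (((2 * Real.pi * |ξ|) ^ μ : ℝ) : ℂ) * 𝓕 (fun x : ℝ => ((φ : ℝ → ℝ) x : ℂ)) ξ)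

lemma testPair_mem_testGraph {μ : ℝ} (hμ : μ ∈ Icc (0 : ℝ) 1) (φ : testSpace) :
    testPair hμ φ ∈ testGraph μ :=
  ⟨φ, isTestFunction_coe φ, ((isTestFunction_coe φ).memLp 2 volume).coeFn_toLp,
    ((isTestFunction_coe φ).memLp_symbol_mul_fourier hμ).coeFn_toLp⟩

/-- The dense embedding of the test functions into `H^μ_0(0,1)`. -/
noncomputable def testEmbed {μ : ℝ} (hμ : μ ∈ Icc (0 : ℝ) 1) : testSpace →ₗ[ℝ] H0 μ where
  toFun φ := ⟨testPair hμ φ, Submodule.le_topologicalClosure _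
    (Submodule.subset_span (testPair_mem_testGraph hμ φ))⟩
  map_add' φ ψ := by
    refine Subtype.ext ?_
    change testPair hμ (φ + ψ) = testPair hμ φ + testPair hμ ψ
    simp only [testPair]
    rw [← WithLp.toLp_add, Prod.mk_add_mk, ← MemLp.toLp_add, ← MemLp.toLp_add]
    congr 2
    refine MemLp.toLp_congr _ _ (ae_of_all _ fun ξ => ?_)
    simp only [Submodule.coe_add, Pi.add_apply]
    rw [← mul_add, ← (isTestFunction_coe φ).fourier_add ψ.2]
    rfl
  map_smul' c φ := by
    refine Subtype.ext ?_
    change testPair hμ (c • φ) = c • testPair hμ φ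
    simp only [testPair]
    rw [← WithLp.toLp_smul, Prod.smul_mk, ← MemLp.toLp_const_smul, ← MemLp.toLp_const_smul]
    congr 2
    refine MemLp.toLp_congr _ _ (ae_of_all _ fun ξ => ?_)
    simp only [Submodule.coe_smul]
    rw [IsTestFunction.fourier_smul, Pi.smul_apply, Complex.real_smul]
    ring

lemma testEmbed_fn {μ : ℝ} (hμ : μ ∈ Icc (0 : ℝ) 1) (φ : testSpace) :
    (testEmbed hμ φ).fn =ᵐ[volume] φ :=
  ((isTestFunction_coe φ).memLp 2 volume).coeFn_toLp

lemma norm_sq_testEmbed {μ : ℝ} (hμ : μ ∈ Icc (0 : ℝ) 1) (φ : testSpace) :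
    ‖testEmbed hμ φ‖ ^ 2 = (∫ x, (φ : ℝ → ℝ) x ^ 2) +
      ∫ ξ, ((2 * Real.pi * |ξ|) ^ μ * ‖𝓕 (fun x => ((φ : ℝ → ℝ) x : ℂ)) ξ‖) ^ 2 := by
  change ‖testPair hμ φ‖ ^ 2 = _
  rw [WithLp.prod_norm_sq_eq_of_L2]
  have h1 : ‖(testPair hμ φ).fst‖ ^ 2 = _ := norm_sq_toLp ((isTestFunction_coe φ).memLp 2 volume)
  have h2 : ‖(testPair hμ φ).snd‖ ^ 2 = _ :=
    norm_sq_toLp_complex ((isTestFunction_coe φ).memLp_symbol_mul_fourier hμ)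
  have h3 : ∀ ξ : ℝ, ‖(((2 * Real.pi * |ξ|) ^ μ : ℝ) : ℂ)‖ = (2 * Real.pi * |ξ|) ^ μ := fun ξ => by
    rw [Complex.norm_real, Real.norm_of_nonneg (by positivity)]
  rw [h1, h2]
  simp only [norm_mul, h3]

/-- The pairs of test functions already form a subspace, so taking the span adds nothing before the
closure. -/
lemma denseRange_testEmbed {μ : ℝ} (hμ : μ ∈ Icc (0 : ℝ) 1) : DenseRange (testEmbed hμ) := by
  have hspan : ∀ p ∈ Submodule.span ℝ (testGraph μ), ∃ φ, (testEmbed hμ φ).1 = p := by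
    intro p hp
    induction hp using Submodule.span_induction with
    | mem p hp =>
      obtain ⟨φ, hφ, h1, h2⟩ := hp
      refine ⟨⟨φ, hφ⟩, ?_⟩
      refine (WithLp.equiv 2 _).injective (Prod.ext (Lp.ext ?_) (Lp.ext ?_))
      · exact (hφ.memLp 2 volume).coeFn_toLp.trans h1.symm
      · exact (hφ.memLp_symbol_mul_fourier hμ).coeFn_toLp.trans h2.symm
    | zero => exact ⟨0, by rw [map_zero]; rfl⟩
    | add p q _ _ hp hq =>
      obtain ⟨φ, rfl⟩ := hp
      obtain ⟨ψ, rfl⟩ := hq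
      exact ⟨φ + ψ, by rw [map_add]; rfl⟩
    | smul c p _ hp =>
      obtain ⟨φ, rfl⟩ := hp
      exact ⟨c • φ, by rw [map_smul]; rfl⟩
  intro u
  have hu : u.1 ∈ closure (Submodule.span ℝ (testGraph μ) : Set L2Pair) := u.2
  refine closure_subtype.2 (closure_mono ?_ hu)
  intro p hp
  obtain ⟨φ, rfl⟩ := hspan p hp
  exact ⟨_, ⟨φ, rfl⟩, rfl⟩

/-- The underlying function as a continuous linear map to `L²(ℝ)`. -/
noncomputable def fnL (μ : ℝ) : H0 μ →L[ℝ] Lp ℝ 2 (volume : Measure ℝ) :=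
  (WithLp.fstL 2 ℝ _ _).comp (H0Submodule μ).subtypeL

lemma coe_fnL {μ : ℝ} (u : H0 μ) : (fnL μ u : ℝ → ℝ) = u.fn := rfl

/-- Square integrable functions on `(0,1)` act on `H^μ_0(0,1)`. -/
lemma exists_dual_eq_integral_mul (μ : ℝ) {f : ℝ → ℝ} (hf : MemLp f 2 unitMeasure) :
    ∃ ℓ : StrongDual ℝ (H0 μ), ∀ v : H0 μ, ℓ v = ∫ x, f x * v.fn x ∂unitMeasure := by
  have hf' : MemLp ((Ioo (0 : ℝ) 1).indicator f) 2 volume :=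
    (memLp_indicator_iff_restrict measurableSet_Ioo).2 hf
  refine ⟨(innerSL ℝ (hf'.toLp _)).comp (fnL μ), fun v => ?_⟩
  rw [ContinuousLinearMap.comp_apply, innerSL_apply_apply, L2.inner_def, unitMeasure,
    ← integral_indicator measurableSet_Ioo]
  refine integral_congr_ae ?_
  filter_upwards [hf'.coeFn_toLp] with x hx
  rw [hx, coe_fnL]
  by_cases h : x ∈ Ioo (0 : ℝ) 1 <;> simp [h, mul_comm]

/-- Extension of a densely defined operator that is bounded from above and from below and whose
range has an orthogonal complement spanned by `p`. -/
lemma exists_extension_of_bounds {X H E : Type*} [AddCommGroup X] [Module ℝ X]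
    [NormedAddCommGroup H] [InnerProductSpace ℝ H] [CompleteSpace H]
    [NormedAddCommGroup E] [InnerProductSpace ℝ E] [CompleteSpace E]
    (e : X →ₗ[ℝ] H) (d : X →ₗ[ℝ] E) (he : DenseRange e) {c C : ℝ} (hc : 0 < c)
    (hC : ∀ x, ‖d x‖ ≤ C * ‖e x‖) (hc' : ∀ x, c * ‖e x‖ ≤ ‖d x‖) {p : E}
    (hp : ∀ x, inner ℝ p (d x) = 0)
    (hp' : ∀ h : E, (∀ x, inner ℝ h (d x) = 0) → ∃ a : ℝ, h = a • p) :
    ∃ T : H →L[ℝ] E, (∀ x, T (e x) = d x) ∧ (∀ w, ‖T w‖ ≤ C * ‖w‖) ∧ (∀ w, c * ‖w‖ ≤ ‖T w‖) ∧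
      ∀ g, inner ℝ p g = 0 ↔ ∃ w, T w = g := by
  have hT : ∀ x, d.extendOfNorm e (e x) = d x := LinearMap.extendOfNorm_eq he ⟨C, hC⟩
  set T := d.extendOfNorm e with hTdef
  have hlow : ∀ w, c * ‖w‖ ≤ ‖T w‖ := fun w =>
    he.induction_on (p := fun w => c * ‖w‖ ≤ ‖T w‖) w
      (isClosed_le (by fun_prop) (by fun_prop)) fun x => by rw [hT]; exact hc' x
  refine ⟨T, hT, LinearMap.norm_extendOfNorm_apply_le he C hC, hlow, fun g => ⟨fun hg => ?_, ?_⟩⟩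
  -- The lower bound makes the range closed, hence equal to its double orthogonal complement, which
  -- by `hp'` contains everything orthogonal to `p`.
  · have hanti : AntilipschitzWith (Real.toNNReal c⁻¹) T := by
      refine AddMonoidHomClass.antilipschitz_of_bound T fun w => ?_
      rw [Real.coe_toNNReal _ (inv_nonneg.2 hc.le), inv_mul_eq_div, le_div_iff₀ hc, mul_comm]
      exact hlow w
    have hclosed : IsClosed (T.range : Set E) := hanti.isClosed_range T.uniformContinuous
    have hR : (T.range)ᗮᗮ = T.range :=
      (Submodule.orthogonal_orthogonal_eq_closure _).trans
        (IsClosed.submodule_topologicalClosure_eq hclosed)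
    have : g ∈ (T.range)ᗮᗮ := by
      rw [Submodule.mem_orthogonal]
      intro h hh
      rw [Submodule.mem_orthogonal'] at hh
      obtain ⟨a, rfl⟩ := hp' h fun x => by
        rw [← hT]
        exact hh _ ⟨_, rfl⟩
      rw [real_inner_smul_left, hg, mul_zero]
    rw [hR] at this
    exact this
  · rintro ⟨w, rfl⟩
    exact he.induction_on (p := fun w => inner ℝ p (T w) = 0) w
      (isClosed_eq (by fun_prop) (by fun_prop)) fun x => by rw [hT]; exact hp x

end FractionalSobolevSpaces

end FracDiff

namespace FracDiff

/-! ### Weak derivatives and indefinite integrals. -/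

section WeakDerivatives

open Set

lemma integrable_mul_of_memLp {f g : ℝ → ℝ} (hf : MemLp f 2 unitMeasure)
    (hg : MemLp g 2 unitMeasure) : Integrable (fun x => f x * g x) unitMeasure :=
  hf.integrable_mul hg

lemma _root_.MeasureTheory.MemLp.integrable_unit {f : ℝ → ℝ} (hf : MemLp f 2 unitMeasure) :
    Integrable f unitMeasure := hf.integrable (by norm_num)

lemma IsWeakDeriv.ae_eq {k : ℕ} {w g g' : ℝ → ℝ} (h : IsWeakDeriv k w g) (h' : IsWeakDeriv k w g') :
    g =ᵐ[unitMeasure] g' := by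
  have hint := h.1.integrable_unit.sub h'.1.integrable_unit
  have := ae_eq_zero_of_forall_integral_mul_eq_zero hint fun φ hφ => by
    have e1 := h.2 φ hφ
    have e2 := h'.2 φ hφ
    rw [e1] at e2
    have e3 : ∫ x, g x * φ x ∂unitMeasure = ∫ x, g' x * φ x ∂unitMeasure :=
      mul_left_cancel₀ (pow_ne_zero k (by norm_num)) e2
    have m := hφ.memLp 2 unitMeasure
    simp only [Pi.sub_apply, sub_mul]
    rw [integral_sub (integrable_mul_of_memLp h.1 m) (integrable_mul_of_memLp h'.1 m), e3, sub_self]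
  filter_upwards [this] with x hx
  exact sub_eq_zero.1 hx

lemma weakDeriv_spec {k : ℕ} {w g : ℝ → ℝ} (h : IsWeakDeriv k w g) :
    IsWeakDeriv k w (weakDeriv k w) := by
  have hex : ∃ g, IsWeakDeriv k w g := ⟨g, h⟩
  rw [weakDeriv, dif_pos hex]
  exact hex.choose_spec

lemma IsWeakDeriv.weakDeriv_ae_eq {k : ℕ} {w g : ℝ → ℝ} (h : IsWeakDeriv k w g) :
    weakDeriv k w =ᵐ[unitMeasure] g := (weakDeriv_spec h).ae_eq h

lemma isWeakDeriv_zero {w : ℝ → ℝ} (h : MemLp w 2 unitMeasure) : IsWeakDeriv 0 w w :=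
  ⟨h, fun φ _ => by simp⟩

lemma isWeakDeriv_one_iff {w g : ℝ → ℝ} : IsWeakDeriv 1 w g ↔ MemLp g 2 unitMeasure ∧
    ∀ φ, IsTestFunction φ →
      ∫ x, w x * deriv φ x ∂unitMeasure = -∫ x, g x * φ x ∂unitMeasure := by
  simp [IsWeakDeriv, iteratedDeriv_one]

lemma absolutelyContinuous_primitive {g : ℝ → ℝ} (hg : Integrable g unitMeasure) :
    AbsolutelyContinuousOnInterval (fun x => ∫ s in (0 : ℝ)..x, g s) 0 1 :=
  (Integrable.intervalIntegrable_unit hg (by simp)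
    (by simp)).absolutelyContinuousOnInterval_intervalIntegral (by simp)

lemma ae_hasDerivAt_primitive {g : ℝ → ℝ} (hg : Integrable g unitMeasure) :
    ∀ᵐ x ∂unitMeasure, HasDerivAt (fun x => ∫ s in (0 : ℝ)..x, g s) (g x) x := by
  have hi : IntervalIntegrable g volume 0 1 :=
    Integrable.intervalIntegrable_unit hg (by simp) (by simp)
  refine ae_unitMeasure_iff.2 ?_
  filter_upwards [hi.ae_hasDerivAt_integral] with x hx hx01
  exact hx (by rw [uIcc_of_le zero_le_one]; exact Ioo_subset_Icc_self hx01) 0 (by simp)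

/-- Integration by parts for an indefinite integral. -/
lemma integral_primitive_mul_deriv {g φ : ℝ → ℝ} (hg : Integrable g unitMeasure)
    (hφ : IsTestFunction φ) :
    ∫ x, (∫ s in (0 : ℝ)..x, g s) * deriv φ x ∂unitMeasure = -∫ x, g x * φ x ∂unitMeasure := by
  have hac : AbsolutelyContinuousOnInterval φ 0 1 := by
    have h1 : AbsolutelyContinuousOnInterval (fun x => ∫ s in (0 : ℝ)..x, deriv φ s) 0 1 :=
      absolutelyContinuous_primitive hφ.isTestFunction_deriv.integrable.restrict
    have e : (fun x => ∫ s in (0 : ℝ)..x, deriv φ s) = φ := by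
      ext x
      rw [hφ.integral_deriv_eq, hφ.eq_zero_of_notMem (x := 0) (by simp), sub_zero]
    rwa [e] at h1
  have h := (absolutelyContinuous_primitive hg).integral_mul_deriv_eq_deriv_mul hac
  rw [hφ.eq_zero_of_notMem (x := 0) (by simp), hφ.eq_zero_of_notMem (x := 1) (by simp), mul_zero,
    mul_zero, sub_zero, zero_sub, ← integral_unitMeasure, ← integral_unitMeasure] at h
  rw [h]
  congr 1
  refine integral_congr_ae ?_
  filter_upwards [ae_hasDerivAt_primitive hg] with x hx
  rw [hx.deriv]

lemma isWeakDeriv_one_of_eq_primitive {w g : ℝ → ℝ} {c : ℝ} (hg : MemLp g 2 unitMeasure)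
    (h : ∀ᵐ x ∂unitMeasure, w x = c + ∫ s in (0 : ℝ)..x, g s) : IsWeakDeriv 1 w g := by
  refine isWeakDeriv_one_iff.2 ⟨hg, fun φ hφ => ?_⟩
  rw [← integral_primitive_mul_deriv hg.integrable_unit hφ]
  have e : ∫ x, w x * deriv φ x ∂unitMeasure =
      ∫ x, (c * deriv φ x + (∫ s in (0 : ℝ)..x, g s) * deriv φ x) ∂unitMeasure := by
    refine integral_congr_ae ?_
    filter_upwards [h] with x hx
    rw [hx, add_mul]
  have hc : ContinuousOn (fun x => ∫ s in (0 : ℝ)..x, g s) (uIcc 0 1) :=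
    (absolutelyContinuous_primitive hg.integrable_unit).continuousOn
  have hi : Integrable (fun x => (∫ s in (0 : ℝ)..x, g s) * deriv φ x) unitMeasure := by
    rw [uIcc_of_le zero_le_one] at hc
    exact (hc.mul hφ.isTestFunction_deriv.continuous.continuousOn).integrableOn_Icc.mono_set
      Ioo_subset_Icc_self
  have hi' : Integrable (fun x => c * deriv φ x) unitMeasure :=
    (hφ.isTestFunction_deriv.integrable.restrict (s := Ioo 0 1)).const_mul c
  rw [e, integral_add hi' hi,
    integral_const_mul, integral_unitMeasure, hφ.integral_deriv_eq,
    hφ.eq_zero_of_notMem (x := 0) (by simp), hφ.eq_zero_of_notMem (x := 1) (by simp)]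
  simp

/-- A function with a weak derivative is an indefinite integral almost everywhere. -/
lemma IsWeakDeriv.exists_eq_primitive {w g : ℝ → ℝ} (h : IsWeakDeriv 1 w g)
    (hw : Integrable w unitMeasure) :
    ∃ c, ∀ᵐ x ∂unitMeasure, w x = c + ∫ s in (0 : ℝ)..x, g s := by
  have hc : ContinuousOn (fun x => ∫ s in (0 : ℝ)..x, g s) (Icc 0 1) := by
    have := (absolutelyContinuous_primitive h.1.integrable_unit).continuousOn
    rwa [uIcc_of_le zero_le_one] at this
  have hi : Integrable (fun x => ∫ s in (0 : ℝ)..x, g s) unitMeasure :=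
    hc.integrableOn_Icc.mono_set Ioo_subset_Icc_self
  obtain ⟨c, hc'⟩ := ae_eq_const_of_forall_integral_mul_deriv_eq_zero (hw.sub hi) fun φ hφ => by
    obtain ⟨M, hM⟩ := hφ.isTestFunction_deriv.exists_bound
    have hm := hφ.isTestFunction_deriv.continuous.aestronglyMeasurable (μ := unitMeasure)
    simp only [Pi.sub_apply, sub_mul]
    rw [integral_sub (hw.mul_bdd (c := M) hm (ae_of_all _ hM))
      (hi.mul_bdd (c := M) hm (ae_of_all _ hM)), integral_primitive_mul_deriv h.1.integrable_unit hφ,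
      (isWeakDeriv_one_iff.1 h).2 φ hφ, sub_self]
  refine ⟨c, ?_⟩
  filter_upwards [hc'] with x hx
  simp only [Pi.sub_apply] at hx
  linarith

lemma eqOn_Icc_of_ae_eq {f g : ℝ → ℝ} (hf : ContinuousOn f (Icc 0 1)) (hg : ContinuousOn g (Icc 0 1))
    (h : ∀ᵐ x ∂unitMeasure, f x = g x) : EqOn f g (Icc 0 1) := by
  have h1 : EqOn f g (Ioo 0 1) :=
    Measure.eqOn_open_of_ae_eq h isOpen_Ioo (hf.mono Ioo_subset_Icc_self)
      (hg.mono Ioo_subset_Icc_self)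
  refine h1.of_subset_closure hf hg Ioo_subset_Icc_self ?_
  rw [closure_Ioo (by norm_num)]

end WeakDerivatives

/-! ### The isomorphisms D I^β_θ and D onto complements of one function. -/

section FractionalDerivative

open Set Filter Topology

/-- The square integrable functions on `(0,1)`. -/
abbrev UnitL2 : Type := Lp ℝ 2 unitMeasure

/-- The primitive at x is the inner product with the indicator of (0, x). -/
lemma continuous_primitive_apply {x : ℝ} (hx : x ∈ Icc (0 : ℝ) 1) :
    Continuous fun g : UnitL2 => ∫ s in (0 : ℝ)..x, g s := by
  have hs : MeasurableSet (Ioo (0 : ℝ) x) := measurableSet_Ioo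
  have : ∀ g : UnitL2, ∫ s in (0 : ℝ)..x, g s =
      inner ℝ (indicatorConstLp 2 hs (measure_ne_top unitMeasure _) (1 : ℝ)) g := by
    intro g
    have hr : unitMeasure.restrict (Ioo 0 x) = volume.restrict (Ioo 0 x) := by
      rw [unitMeasure, Measure.restrict_restrict hs,
        inter_eq_self_of_subset_left (Ioo_subset_Ioo_right hx.2)]
    rw [L2.inner_indicatorConstLp_one, hr, intervalIntegral.integral_of_le hx.1, integral_Ioc_eq_integral_Ioo]
  simp only [this]
  fun_prop

lemma primitive_congr_ae {f g : ℝ → ℝ} (h : f =ᵐ[unitMeasure] g) {x : ℝ}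
    (hx : x ∈ Icc (0 : ℝ) 1) : ∫ s in (0 : ℝ)..x, f s = ∫ s in (0 : ℝ)..x, g s := by
  rw [← leftInt_one, ← leftInt_one, leftInt_congr_ae 1 h hx]

/-- L² convergence alone would give no pointwise limit for small σ; a uniform bound lets the
integrable kernel dominate at every x, including the endpoints. -/
lemma tendsto_leftInt {σ : ℝ} (hσ : 0 < σ) {f : ℕ → ℝ → ℝ} {w : ℝ → ℝ} {M : ℝ}
    (hf : ∀ n, Continuous (f n)) (hM : ∀ n x, |f n x| ≤ M)
    (h : ∀ᵐ s ∂unitMeasure, Tendsto (fun n => f n s) atTop (𝓝 (w s))) {x : ℝ}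
    (hx : x ∈ Icc (0 : ℝ) 1) :
    Tendsto (fun n => leftInt σ (f n) x) atTop (𝓝 (leftInt σ w x)) := by
  rcases hx.1.eq_or_lt with rfl | hx0
  · simp [leftInt]
  simp only [leftInt_eq_setIntegral _ _ hx.1]
  refine Tendsto.const_mul _ ?_
  have hi := (integral_beta_kernel hσ one_pos hx0).1
  simp only [sub_self, Real.rpow_zero, mul_one] at hi
  refine tendsto_integral_of_dominated_convergence (fun s => (x - s) ^ (σ - 1) * M) ?_
    (hi.mul_const _) ?_ ?_
  · intro n
    have := hf n
    exact Measurable.aestronglyMeasurable (by fun_prop)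
  · intro n
    refine (ae_restrict_iff' measurableSet_Ioo).2 (ae_of_all _ fun s hs => ?_)
    have h0 : 0 < x - s := sub_pos.2 hs.2
    rw [norm_mul, Real.norm_of_nonneg (by positivity)]
    exact mul_le_mul_of_nonneg_left (hM n s) (by positivity)
  · have := ae_restrict_of_ae_restrict_of_subset (Ioo_subset_Ioo_right hx.2) h
    filter_upwards [this] with s hs
    exact hs.const_mul _

lemma tendsto_fracInt {β θ : ℝ} (hβ : 0 < β) {f : ℕ → ℝ → ℝ} {w : ℝ → ℝ} {M : ℝ}
    (hf : ∀ n, Continuous (f n)) (hM : ∀ n x, |f n x| ≤ M)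
    (h : ∀ᵐ s ∂unitMeasure, Tendsto (fun n => f n s) atTop (𝓝 (w s))) {x : ℝ}
    (hx : x ∈ Icc (0 : ℝ) 1) :
    Tendsto (fun n => fracInt β θ (f n) x) atTop (𝓝 (fracInt β θ w x)) := by
  refine ((tendsto_leftInt hβ hf hM h hx).const_mul _).add (Tendsto.const_mul _ ?_)
  simp only [rightInt_eq_leftInt]
  refine tendsto_leftInt hβ (fun n => (hf n).comp (by fun_prop)) (fun n x => hM n _)
    (measurePreserving_one_sub.quasiMeasurePreserving.ae h) ⟨by linarith [hx.2], by linarith [hx.1]⟩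

lemma leftInt_add_of_continuous {σ : ℝ} (hσ : 0 < σ) {f g : ℝ → ℝ} (hf : Continuous f)
    (hg : Continuous g) {x : ℝ} (hx : 0 ≤ x) :
    leftInt σ (f + g) x = leftInt σ f x + leftInt σ g x := by
  rcases hx.eq_or_lt with rfl | hx0
  · simp [leftInt]
  have hi := (integral_beta_kernel hσ one_pos hx0).1
  simp only [sub_self, Real.rpow_zero, mul_one] at hi
  have key : ∀ {f : ℝ → ℝ}, Continuous f →
      IntegrableOn (fun s => (x - s) ^ (σ - 1) * f s) (Ioo 0 x) := by
    intro f hf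
    obtain ⟨M, hM⟩ := (isCompact_Icc (a := (0 : ℝ)) (b := x)).exists_bound_of_continuousOn
      hf.continuousOn
    exact hi.mul_bdd (c := M) hf.aestronglyMeasurable ((ae_restrict_iff' measurableSet_Ioo).2
      (ae_of_all _ fun s hs => hM s (Ioo_subset_Icc_self hs)))
  rw [leftInt_eq_setIntegral _ _ hx, leftInt_eq_setIntegral _ _ hx, leftInt_eq_setIntegral _ _ hx,
    ← mul_add, ← integral_add (key hf) (key hg)]
  simp only [Pi.add_apply, mul_add]

lemma leftInt_smul (σ c : ℝ) (f : ℝ → ℝ) (x : ℝ) : leftInt σ (c • f) x = c * leftInt σ f x := by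
  simp only [leftInt, Pi.smul_apply, smul_eq_mul, mul_div_assoc, intervalIntegral.integral_const_mul]
  ring

lemma fracInt_add_of_continuous {β : ℝ} (hβ : 0 < β) (θ : ℝ) {f g : ℝ → ℝ} (hf : Continuous f)
    (hg : Continuous g) {x : ℝ} (hx : x ∈ Icc (0 : ℝ) 1) :
    fracInt β θ (f + g) x = fracInt β θ f x + fracInt β θ g x := by
  have h1 := leftInt_add_of_continuous hβ (f := fun s => f (1 - s)) (g := fun s => g (1 - s))
    (by fun_prop) (by fun_prop) (sub_nonneg.2 hx.2)
  simp only [fracInt, rightInt_eq_leftInt, leftInt_add_of_continuous hβ hf hg hx.1]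
  change _ + _ * leftInt β ((fun s => f (1 - s)) + fun s => g (1 - s)) (1 - x) = _
  rw [h1]
  ring

lemma fracInt_smul (β θ c : ℝ) (f : ℝ → ℝ) (x : ℝ) :
    fracInt β θ (c • f) x = c * fracInt β θ f x := by
  have h1 := leftInt_smul β c (fun s => f (1 - s)) (1 - x)
  simp only [fracInt, rightInt_eq_leftInt, leftInt_smul]
  change _ + _ * leftInt β (c • fun s => f (1 - s)) (1 - x) = _
  rw [h1]
  ring

lemma deriv_add_test (φ ψ : testSpace) :
    deriv ((φ + ψ : testSpace) : ℝ → ℝ) = deriv (φ : ℝ → ℝ) + deriv (ψ : ℝ → ℝ) :=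
  funext fun x => deriv_add ((isTestFunction_coe φ).differentiable x)
    ((isTestFunction_coe ψ).differentiable x)

lemma deriv_smul_test (c : ℝ) (φ : testSpace) :
    deriv ((c • φ : testSpace) : ℝ → ℝ) = c • deriv (φ : ℝ → ℝ) :=
  funext fun x => deriv_const_smul c ((isTestFunction_coe φ).differentiable x)

/-- `φ ↦ D I^β_θ φ` on test functions. -/
noncomputable def testFracDeriv {β θ : ℝ} (hβ : 0 < β) (hθ : θ = 0 ∨ θ = 1) :
    testSpace →ₗ[ℝ] UnitL2 where
  toFun φ := ((isTestFunction_coe φ).memLp_fracInt_deriv hβ hθ).toLp (fracInt β θ (deriv φ))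
  map_add' φ ψ := by
    rw [← MemLp.toLp_add]
    refine MemLp.toLp_congr _ _ (ae_unitMeasure_of_forall fun x hx => ?_)
    rw [deriv_add_test, fracInt_add_of_continuous hβ θ
      (isTestFunction_coe φ).isTestFunction_deriv.continuous
      (isTestFunction_coe ψ).isTestFunction_deriv.continuous (Ioo_subset_Icc_self hx)]
    rfl
  map_smul' c φ := by
    rw [RingHom.id_apply, ← MemLp.toLp_const_smul]
    refine MemLp.toLp_congr _ _ (ae_of_all _ fun x => ?_)
    rw [deriv_smul_test, fracInt_smul]
    rfl

/-- `φ ↦ Dφ` on test functions. -/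
noncomputable def testDeriv : testSpace →ₗ[ℝ] UnitL2 where
  toFun φ := ((isTestFunction_coe φ).isTestFunction_deriv.memLp 2 unitMeasure).toLp (deriv φ)
  map_add' φ ψ := by
    rw [← MemLp.toLp_add]
    exact MemLp.toLp_congr _ _ (ae_of_all _ fun x => congrFun (deriv_add_test φ ψ) x)
  map_smul' c φ := by
    rw [RingHom.id_apply, ← MemLp.toLp_const_smul]
    exact MemLp.toLp_congr _ _ (ae_of_all _ fun x => congrFun (deriv_smul_test c φ) x)

lemma norm_sq_testFracDeriv {β θ : ℝ} (hβ : 0 < β) (hθ : θ = 0 ∨ θ = 1) (φ : testSpace) :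
    ‖testFracDeriv hβ hθ φ‖ ^ 2 = ∫ x, fracInt β θ (deriv φ) x ^ 2 ∂unitMeasure :=
  norm_sq_toLp ((isTestFunction_coe φ).memLp_fracInt_deriv hβ hθ)

lemma norm_sq_testDeriv (φ : testSpace) :
    ‖testDeriv φ‖ ^ 2 = ∫ x, deriv (φ : ℝ → ℝ) x ^ 2 ∂unitMeasure :=
  norm_sq_toLp ((isTestFunction_coe φ).isTestFunction_deriv.memLp 2 unitMeasure)

lemma IsTestFunction.integral_eq {φ : ℝ → ℝ} (hφ : IsTestFunction φ) {F : ℝ → ℝ} (hF : F 0 = 0) :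
    ∫ x, F (φ x) ∂unitMeasure = ∫ x, F (φ x) := by
  rw [unitMeasure, setIntegral_eq_integral_of_forall_compl_eq_zero]
  intro x hx
  rw [hφ.eq_zero_of_notMem hx, hF]

lemma IsTestFunction.integral_sq_le {φ : ℝ → ℝ} (hφ : IsTestFunction φ) {C : ℝ}
    (h : ∀ x, φ x ^ 2 ≤ C) : ∫ x, φ x ^ 2 ≤ C := by
  rw [← hφ.integral_eq (F := fun y => y ^ 2) (by simp)]
  refine (integral_mono_of_nonneg (ae_of_all _ fun x => sq_nonneg _) (integrable_const C)
    (ae_of_all _ h)).trans ?_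
  simp

lemma inner_toLp_left {f : ℝ → ℝ} (hf : MemLp f 2 unitMeasure) (g : UnitL2) :
    inner ℝ (hf.toLp f) g = ∫ x, f x * g x ∂unitMeasure := by
  have := inner_toLp hf (Lp.memLp g)
  rwa [Lp.toLp_coeFn] at this

lemma ae_eq_of_tendsto_testEmbed {μ : ℝ} (hμ : μ ∈ Icc (0 : ℝ) 1) {φ : ℕ → testSpace} {w : H0 μ}
    (h : Tendsto (fun n => testEmbed hμ (φ n)) atTop (𝓝 w)) :
    ∃ ns : ℕ → ℕ, StrictMono ns ∧
      ∀ᵐ s ∂unitMeasure, Tendsto (fun n => (φ (ns n) : ℝ → ℝ) s) atTop (𝓝 (w.fn s)) := by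
  have h1 : Tendsto (fun n => fnL μ (testEmbed hμ (φ n))) atTop (𝓝 (fnL μ w)) :=
    ((fnL μ).continuous.tendsto w).comp h
  obtain ⟨ns, hns, h2⟩ := (tendstoInMeasure_of_tendsto_Lp h1).exists_seq_tendsto_ae
  refine ⟨ns, hns, ae_restrict_of_ae ?_⟩
  have h3 : ∀ᵐ s : ℝ, ∀ n, (testEmbed hμ (φ n)).fn s = (φ n : ℝ → ℝ) s :=
    ae_all_iff.2 fun n => testEmbed_fn hμ (φ n)
  filter_upwards [h2, h3] with s hs hs'
  simp only [coe_fnL, hs'] at hs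
  exact hs

/-- The operator `D I^β_θ` is an isomorphism from `H^{1-β}_0(0,1)` onto the orthogonal complement
of the weight. -/
theorem exists_fracDeriv {β θ : ℝ} (hβ : 0 < β) (hβ' : β < 1 / 2) (hθ : θ = 0 ∨ θ = 1) :
    ∃ c > 0, ∃ T : H0 (1 - β) →L[ℝ] UnitL2, (∀ w, ‖T w‖ ≤ ‖w‖) ∧ (∀ w, c * ‖w‖ ≤ ‖T w‖) ∧
      (∀ g : UnitL2, ∫ x, weight β θ x * g x ∂unitMeasure = 0 ↔ ∃ w, T w = g) ∧
      ∀ (w : H0 (1 - β)), ∀ x ∈ Icc (0 : ℝ) 1,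
        fracInt β θ w.fn x = fracInt β θ w.fn 0 + ∫ s in (0 : ℝ)..x, T w s := by
  have hμ : 1 - β ∈ Icc (0 : ℝ) 1 := ⟨by linarith, by linarith⟩
  set C₁ : ℝ := (1 / Real.Gamma (1 - β)) ^ 2 * (Real.Gamma (1 - 2 * β) / Real.Gamma (2 - 2 * β))
    with hC₁
  have hC₁0 : 0 < C₁ := by
    have := Real.Gamma_pos_of_pos (show 0 < 1 - β by linarith)
    have := Real.Gamma_pos_of_pos (show 0 < 1 - 2 * β by linarith)
    have := Real.Gamma_pos_of_pos (show 0 < 2 - 2 * β by linarith)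
    positivity
  have hcos : 0 < Real.cos (Real.pi * β) :=
    Real.cos_pos_of_mem_Ioo ⟨by nlinarith [Real.pi_pos], by nlinarith [Real.pi_pos]⟩
  have hsup : ∀ φ : testSpace, ∀ x, (φ : ℝ → ℝ) x ^ 2 ≤ C₁ * ‖testFracDeriv hβ hθ φ‖ ^ 2 := by
    intro φ x
    rw [norm_sq_testFracDeriv]
    exact (isTestFunction_coe φ).sq_le_fracInt hβ hβ' hθ x
  -- The term C₁ controls the L² part through the sup bound on an interval of length 1, the cosine
  -- term the seminorm of order 1 - β.
  set C₂ : ℝ := C₁ + 1 / Real.cos (Real.pi * β) ^ 2 with hC₂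
  have hC₂0 : 0 < C₂ := by positivity
  have hup : ∀ φ, ‖testFracDeriv hβ hθ φ‖ ≤ 1 * ‖testEmbed hμ φ‖ := by
    intro φ
    rw [one_mul]
    refine le_of_sq_le_sq ?_ (norm_nonneg _)
    rw [norm_sq_testFracDeriv, norm_sq_testEmbed]
    have h1 := ((isTestFunction_coe φ).fracInt_deriv_bounds hβ hβ' hθ).2
    have h2 : 0 ≤ ∫ x, (φ : ℝ → ℝ) x ^ 2 := integral_nonneg fun x => sq_nonneg _
    linarith
  have hlow : ∀ φ, (Real.sqrt C₂)⁻¹ * ‖testEmbed hμ φ‖ ≤ ‖testFracDeriv hβ hθ φ‖ := by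
    intro φ
    refine le_of_sq_le_sq ?_ (norm_nonneg _)
    rw [mul_pow, inv_pow, Real.sq_sqrt hC₂0.le, inv_mul_le_iff₀ hC₂0, norm_sq_testEmbed, hC₂, add_mul]
    refine add_le_add ((isTestFunction_coe φ).integral_sq_le (hsup φ)) ?_
    have h1 := ((isTestFunction_coe φ).fracInt_deriv_bounds hβ hβ' hθ).1
    rw [norm_sq_testFracDeriv, one_div, ← div_eq_inv_mul, le_div_iff₀ (by positivity), mul_comm]
    exact h1
  have hw := memLp_weight hβ' hθ
  have hp : ∀ φ, inner ℝ (hw.toLp (weight β θ)) (testFracDeriv hβ hθ φ) = 0 := fun φ =>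
    (inner_toLp hw ((isTestFunction_coe φ).memLp_fracInt_deriv hβ hθ)).trans
      ((isTestFunction_coe φ).integral_weight_mul_fracInt hβ hβ' hθ)
  have hp' : ∀ h : UnitL2, (∀ φ, inner ℝ h (testFracDeriv hβ hθ φ) = 0) →
      ∃ a : ℝ, h = a • hw.toLp (weight β θ) := by
    intro h hh
    obtain ⟨a, ha⟩ := ae_eq_of_forall_integral_mul_fracInt_eq_zero hβ hβ' hθ
      (Lp.memLp h).integrable_unit fun φ hφ => by
        have h1 := inner_toLp (Lp.memLp h) (hφ.memLp_fracInt_deriv hβ hθ)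
        rw [Lp.toLp_coeFn] at h1
        rw [← h1]
        exact hh ⟨φ, hφ⟩
    refine ⟨a, Lp.ext ?_⟩
    filter_upwards [ha, Lp.coeFn_smul a (hw.toLp (weight β θ)), hw.coeFn_toLp] with x h1 h2 h3
    rw [h1, h2, Pi.smul_apply, h3, smul_eq_mul]
  obtain ⟨T, hT, hT1, hT2, hT3⟩ := exists_extension_of_bounds (testEmbed hμ) (testFracDeriv hβ hθ)
    (denseRange_testEmbed hμ) (c := (Real.sqrt C₂)⁻¹) (by positivity) hup hlow hp hp'
  refine ⟨(Real.sqrt C₂)⁻¹, by positivity, T, fun w => by simpa using hT1 w, hT2, fun g => ?_, ?_⟩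
  · rw [← hT3, inner_toLp_left]
  · intro w x hx
    obtain ⟨u, hu, huw⟩ := mem_closure_iff_seq_limit.1 (denseRange_testEmbed hμ w)
    choose φ hφ using hu
    have hlim : Tendsto (fun n => testEmbed hμ (φ n)) atTop (𝓝 w) := by
      simpa only [hφ] using huw
    obtain ⟨ns, hns, hae⟩ := ae_eq_of_tendsto_testEmbed hμ hlim
    have hTlim : Tendsto (fun n => testFracDeriv hβ hθ (φ (ns n))) atTop (𝓝 (T w)) := by
      have := (T.continuous.tendsto w).comp (hlim.comp hns.tendsto_atTop)
      simpa only [Function.comp_def, hT] using this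
    -- Convergent images under T are bounded, so the sup bound makes the approximating test
    -- functions uniformly bounded; this gives the formula at every x, not just almost every x.
    obtain ⟨B, hB⟩ := hTlim.norm.bddAbove_range
    have hbd : ∀ n x, |(φ (ns n) : ℝ → ℝ) x| ≤ Real.sqrt (C₁ * B ^ 2) := by
      intro n x
      refine Real.abs_le_sqrt ((hsup _ x).trans ?_)
      have : ‖testFracDeriv hβ hθ (φ (ns n))‖ ≤ B := hB ⟨n, rfl⟩
      gcongr
    have hcont : ∀ n, Continuous (φ (ns n) : ℝ → ℝ) := fun n => (isTestFunction_coe _).continuous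
    have l1 := tendsto_fracInt (θ := θ) hβ hcont hbd hae hx
    have l2 := tendsto_fracInt (θ := θ) hβ hcont hbd hae (x := 0) (by simp)
    have l3 := ((continuous_primitive_apply hx).tendsto (T w)).comp hTlim
    refine tendsto_nhds_unique l1 ((l2.add l3).congr fun n => ?_)
    rw [(isTestFunction_coe (φ (ns n))).fracInt_eq hβ hθ hx]
    congr 1
    exact primitive_congr_ae
      ((isTestFunction_coe (φ (ns n))).memLp_fracInt_deriv hβ hθ).coeFn_toLp hx

/-- The weak derivative is an isomorphism from `H^1_0(0,1)` onto the functions of mean zero. -/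
theorem exists_weakDeriv_H0_one :
    ∃ S : H0 1 →L[ℝ] UnitL2, (∀ v, ‖S v‖ ≤ ‖v‖) ∧ (∀ v, 1 / 2 * ‖v‖ ≤ ‖S v‖) ∧
      (∀ g : UnitL2, ∫ x, g x ∂unitMeasure = 0 ↔ ∃ v, S v = g) ∧
      ∀ v : H0 1, IsWeakDeriv 1 v.fn (S v) := by
  have hμ : (1 : ℝ) ∈ Icc (0 : ℝ) 1 := by simp
  -- For μ = 1 the seminorm is the L² norm of φ', by Plancherel.
  have hsemi : ∀ φ : testSpace, ∫ ξ, ((2 * Real.pi * |ξ|) ^ (1 : ℝ) *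
      ‖𝓕 (fun x => ((φ : ℝ → ℝ) x : ℂ)) ξ‖) ^ 2 = ‖testDeriv φ‖ ^ 2 := by
    intro φ
    have h := (isTestFunction_coe φ).isTestFunction_deriv
    rw [norm_sq_testDeriv, h.integral_eq (F := fun y => y ^ 2) (by simp), ← h.integral_norm_fourier_sq]
    simp only [(isTestFunction_coe φ).norm_fourier_deriv, Real.rpow_one]
  have hsup : ∀ φ : testSpace, ∀ x, (φ : ℝ → ℝ) x ^ 2 ≤ ‖testDeriv φ‖ ^ 2 := by
    intro φ x
    have hφ := isTestFunction_coe φ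
    rw [norm_sq_testDeriv]
    by_cases hx : x ∈ Ioo (0 : ℝ) 1
    swap
    · rw [hφ.eq_zero_of_notMem hx]
      exact (by norm_num : (0 : ℝ) ^ 2 = 0).trans_le (integral_nonneg fun x => sq_nonneg _)
    have h1 : (φ : ℝ → ℝ) x = ∫ s, (Ioo 0 x).indicator (fun _ => (1 : ℝ)) s * deriv (φ : ℝ → ℝ) s
        ∂unitMeasure := by
      have h2 := hφ.integral_deriv_eq 0 x
      rw [hφ.eq_zero_of_notMem (x := 0) (by simp), sub_zero] at h2
      have hsub : Ioo 0 x ⊆ Ioo (0 : ℝ) 1 := Ioo_subset_Ioo_right hx.2.le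
      have h3 : ∀ s, (Ioo 0 x).indicator (fun _ => (1 : ℝ)) s * deriv (φ : ℝ → ℝ) s =
          (Ioo 0 x).indicator (deriv (φ : ℝ → ℝ)) s := fun s => by
        by_cases hs : s ∈ Ioo 0 x <;> simp [hs]
      simp only [h3]
      rw [← h2, intervalIntegral.integral_of_le hx.1.le, integral_Ioc_eq_integral_Ioo, unitMeasure,
        setIntegral_indicator measurableSet_Ioo, inter_eq_self_of_subset_right hsub]
    have hm : MemLp ((Ioo 0 x).indicator fun _ => (1 : ℝ)) 2 unitMeasure :=
      (memLp_const 1).indicator measurableSet_Ioo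
    rw [h1]
    refine (sq_integral_mul_le hm (hφ.isTestFunction_deriv.memLp 2 _)).trans ?_
    refine mul_le_of_le_one_left (integral_nonneg fun x => sq_nonneg _) ?_
    refine (integral_mono_of_nonneg (ae_of_all _ fun x => sq_nonneg _) (integrable_const (1 : ℝ))
      (ae_of_all _ fun s => ?_)).trans (by simp)
    by_cases hs : s ∈ Ioo 0 x <;> simp [hs]
  have hup : ∀ φ, ‖testDeriv φ‖ ≤ 1 * ‖testEmbed hμ φ‖ := by
    intro φ
    rw [one_mul]
    refine le_of_sq_le_sq ?_ (norm_nonneg _)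
    rw [norm_sq_testEmbed, hsemi]
    have h2 : 0 ≤ ∫ x, (φ : ℝ → ℝ) x ^ 2 := integral_nonneg fun x => sq_nonneg _
    linarith
  -- The sup bound gives ‖φ‖ ≤ ‖φ'‖ in L², hence a squared norm of at most 2‖φ'‖²; the constant 1/2
  -- is not sharp.
  have hlow : ∀ φ, 1 / 2 * ‖testEmbed hμ φ‖ ≤ ‖testDeriv φ‖ := by
    intro φ
    refine le_of_sq_le_sq ?_ (norm_nonneg _)
    rw [mul_pow, norm_sq_testEmbed, hsemi]
    have := (isTestFunction_coe φ).integral_sq_le (hsup φ)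
    nlinarith [sq_nonneg ‖testDeriv φ‖]
  have hw : MemLp (fun _ : ℝ => (1 : ℝ)) 2 unitMeasure := memLp_const 1
  have hp : ∀ φ, inner ℝ (hw.toLp _) (testDeriv φ) = 0 := fun φ => by
    have hφ := isTestFunction_coe φ
    refine (inner_toLp hw (hφ.isTestFunction_deriv.memLp 2 unitMeasure)).trans ?_
    simp only [one_mul]
    rw [integral_unitMeasure, hφ.integral_deriv_eq, hφ.eq_zero_of_notMem (x := 0) (by simp),
      hφ.eq_zero_of_notMem (x := 1) (by simp), sub_self]
  have hp' : ∀ h : UnitL2, (∀ φ, inner ℝ h (testDeriv φ) = 0) → ∃ a : ℝ, h = a • hw.toLp _ := by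
    intro h hh
    obtain ⟨a, ha⟩ := ae_eq_const_of_forall_integral_mul_deriv_eq_zero
      (Lp.memLp h).integrable_unit fun φ hφ => by
        have h1 := inner_toLp (Lp.memLp h) (hφ.isTestFunction_deriv.memLp 2 unitMeasure)
        rw [Lp.toLp_coeFn] at h1
        rw [← h1]
        exact hh ⟨φ, hφ⟩
    refine ⟨a, Lp.ext ?_⟩
    filter_upwards [ha, Lp.coeFn_smul a (hw.toLp _), hw.coeFn_toLp] with x h1 h2 h3
    rw [h1, h2, Pi.smul_apply, h3, smul_eq_mul, mul_one]
  obtain ⟨S, hS, hS1, hS2, hS3⟩ := exists_extension_of_bounds (testEmbed hμ) testDeriv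
    (denseRange_testEmbed hμ) (c := 1 / 2) (by norm_num) hup hlow hp hp'
  refine ⟨S, fun v => by simpa using hS1 v, hS2, fun g => ?_, fun v => ?_⟩
  · rw [← hS3, inner_toLp_left]
    simp only [one_mul]
  · refine isWeakDeriv_one_iff.2 ⟨Lp.memLp _, fun φ hφ => ?_⟩
    obtain ⟨ℓ, hℓ⟩ := exists_dual_eq_integral_mul 1 (hφ.isTestFunction_deriv.memLp 2 unitMeasure)
    have e1 : ∀ v : H0 1, ∫ x, v.fn x * deriv φ x ∂unitMeasure = ℓ v := fun v => by
      rw [hℓ]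
      simp only [mul_comm]
    have e2 : ∀ v : H0 1, ∫ x, S v x * φ x ∂unitMeasure =
        inner ℝ ((hφ.memLp 2 unitMeasure).toLp φ) (S v) := fun v => by
      rw [inner_toLp_left]
      simp only [mul_comm]
    -- Both sides are continuous in v, so it suffices to integrate by parts for test functions.
    refine (denseRange_testEmbed hμ).induction_on
      (p := fun v => ∫ x, v.fn x * deriv φ x ∂unitMeasure = -∫ x, S v x * φ x ∂unitMeasure) v ?_ ?_
    · simp only [e1, e2]
      exact isClosed_eq (by fun_prop) (by fun_prop)
    · intro ψ
      have hψ := isTestFunction_coe ψ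
      have h1 := integral_primitive_mul_deriv hψ.isTestFunction_deriv.integrable.restrict hφ
      simp only [hψ.integral_deriv_eq, hψ.eq_zero_of_notMem (x := 0) (by simp), sub_zero] at h1
      have e3 : ∫ x, (testEmbed hμ ψ).fn x * deriv φ x ∂unitMeasure =
          ∫ x, (ψ : ℝ → ℝ) x * deriv φ x ∂unitMeasure := by
        refine integral_congr_ae (EventuallyEq.mul ?_ (ae_eq_refl _))
        exact ae_restrict_of_ae (testEmbed_fn hμ ψ)
      have e4 : ∫ x, S (testEmbed hμ ψ) x * φ x ∂unitMeasure =
          ∫ x, deriv (ψ : ℝ → ℝ) x * φ x ∂unitMeasure := by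
        rw [hS]
        exact integral_congr_ae (EventuallyEq.mul
          (hψ.isTestFunction_deriv.memLp 2 unitMeasure).coeFn_toLp (ae_eq_refl _))
      rw [e3, e4, h1]

end FractionalDerivative

end FracDiff

namespace FracDiff

/-! ### The abstract Petrov–Galerkin problem in Hilbert space. -/

section PetrovGalerkin

variable {W V H : Type*} [NormedAddCommGroup W] [InnerProductSpace ℝ W]
  [NormedAddCommGroup V] [InnerProductSpace ℝ V] [NormedAddCommGroup H] [InnerProductSpace ℝ H]
  {T : W →L[ℝ] H} {S : V →L[ℝ] H} {A J : H →L[ℝ] H} {e p : H}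

/-- Lax–Milgram for the form (S v, S w), coercive because S is bounded below. -/
lemma exists_inner_eq_dual [CompleteSpace V] {c : ℝ} (hc : 0 < c)
    (hS : ∀ v, c * ‖v‖ ≤ ‖S v‖) (f : StrongDual ℝ V) : ∃ v₀, ∀ v, inner ℝ (S v₀) (S v) = f v := by
  let B : V →L[ℝ] V →L[ℝ] ℝ := (innerSL ℝ).bilinearComp S S
  have hB : ∀ v w, B v w = inner ℝ (S v) (S w) := fun v w => rfl
  have hco : IsCoercive B := ⟨c ^ 2, by positivity, fun v => by
    rw [hB, real_inner_self_eq_norm_sq]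
    have := pow_le_pow_left₀ (by positivity) (hS v) 2
    linarith [mul_pow c ‖v‖ 2, this]⟩
  refine ⟨hco.continuousLinearEquivOfBilin.symm ((InnerProductSpace.toDual ℝ V).symm f), fun v => ?_⟩
  rw [← hB, ← hco.continuousLinearEquivOfBilin_apply, ContinuousLinearEquiv.apply_symm_apply,
    InnerProductSpace.toDual_symm_apply]

/-- In the application `A` multiplies by K, `J` divides by K, `e` is the constant 1 and `p` is the
weight. The coefficient of `e` is the one that puts the quotient by K into the range of T. -/
lemma exists_map_eq_sub_smul (hT : ∀ g, inner ℝ p g = 0 ↔ ∃ w, T w = g) (hAJ : ∀ g, A (J g) = g)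
    (hp : inner ℝ p (J e) ≠ 0) (r : H) :
    ∃ w, A (T w) = r - (inner ℝ p (J r) / inner ℝ p (J e)) • e := by
  obtain ⟨w, hw⟩ := (hT (J (r - (inner ℝ p (J r) / inner ℝ p (J e)) • e))).1 (by
    rw [map_sub, map_smul, inner_sub_right, inner_smul_right, div_mul_cancel₀ _ hp, sub_self])
  exact ⟨w, by rw [hw, hAJ]⟩

/-- The multiple of `e` needed to enter the range of T is orthogonal to every S v, so the equation
tested by v is unaffected. -/
lemma exists_forall_inner_eq_dual [CompleteSpace V]
    (hT : ∀ g, inner ℝ p g = 0 ↔ ∃ w, T w = g) (hAJ : ∀ g, A (J g) = g)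
    (hp : inner ℝ p (J e) ≠ 0) (hS : ∀ v, inner ℝ e (S v) = 0) {c : ℝ} (hc : 0 < c)
    (hS' : ∀ v, c * ‖v‖ ≤ ‖S v‖) (f : StrongDual ℝ V) :
    ∃ w, ∀ v, inner ℝ (A (T w)) (S v) = f v := by
  obtain ⟨v₀, hv₀⟩ := exists_inner_eq_dual hc hS' f
  obtain ⟨w, hw⟩ := exists_map_eq_sub_smul hT hAJ hp (S v₀)
  refine ⟨w, fun v => ?_⟩
  rw [hw, inner_sub_left, inner_smul_left, hS, mul_zero, sub_zero, hv₀]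

/-- The inf-sup condition: the supremum is attained up to a constant by the `v` for which `S v` is
the component of `A (T w)` orthogonal to `e`. -/
lemma exists_infSup (hT : ∀ w, inner ℝ p (T w) = 0) (hJA : ∀ g, J (A g) = g)
    (hS : ∀ g, inner ℝ e g = 0 ↔ ∃ v, S v = g) (he : ‖e‖ = 1) {c c' j δ P : ℝ} (hc : 0 < c)
    (hT' : ∀ w, c * ‖w‖ ≤ ‖T w‖) (hc' : 0 ≤ c') (hS' : ∀ v, c' * ‖v‖ ≤ ‖S v‖) (hj : 0 < j)
    (hJ : ∀ g, ‖J g‖ ≤ j * ‖g‖) (hδ : 0 < δ) (hp : δ ≤ inner ℝ p (J e)) (hP : ‖p‖ ≤ P)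
    {w : W} (hw : w ≠ 0) :
    ∃ v, v ≠ 0 ∧ c' * (c / (j * (P * j / δ + 1))) * (‖w‖ * ‖v‖) ≤ inner ℝ (A (T w)) (S v) := by
  set h := A (T w) with hh
  set m : ℝ := inner ℝ e h with hm
  have hP0 : 0 ≤ P := (norm_nonneg p).trans hP
  obtain ⟨v, hv⟩ := (hS (h - m • e)).1 (by
    rw [inner_sub_right, inner_smul_right, real_inner_self_eq_norm_sq, he, ← hm]; ring)
  have heS : inner ℝ e (S v) = 0 := (hS _).2 ⟨v, rfl⟩
  have hdec : h = S v + m • e := by rw [hv, sub_add_cancel]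
  have hA : inner ℝ h (S v) = ‖S v‖ ^ 2 := by
    nth_rewrite 1 [hdec]
    rw [inner_add_left, inner_smul_left, heS, mul_zero, add_zero, real_inner_self_eq_norm_sq]
  have hJh : T w = J (S v) + m • J e := by
    rw [← map_smul, ← map_add, ← hdec, hh, hJA]
  -- The component m along `e` is not free: T w ⊥ p expresses it through S v, since (p, J e) ≥ δ.
  have hmδ : |m| * δ ≤ P * (j * ‖S v‖) := by
    have h0 : m * inner ℝ p (J e) = -inner ℝ p (J (S v)) := by
      have := hT w
      rw [hJh, inner_add_right, inner_smul_right] at this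
      linarith
    calc |m| * δ ≤ |m| * inner ℝ p (J e) := by gcongr
      _ = |m * inner ℝ p (J e)| := by rw [abs_mul, abs_of_pos (hδ.trans_le hp)]
      _ = |inner ℝ p (J (S v))| := by rw [h0, abs_neg]
      _ ≤ ‖p‖ * ‖J (S v)‖ := abs_real_inner_le_norm _ _
      _ ≤ P * (j * ‖S v‖) := by gcongr; exact hJ _
  have hTw : ‖T w‖ ≤ j * (P * j / δ + 1) * ‖S v‖ := by
    have h1 : |m| ≤ P * j / δ * ‖S v‖ := by
      rw [div_mul_eq_mul_div, le_div_iff₀ hδ]; linarith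
    calc ‖T w‖ ≤ ‖J (S v)‖ + ‖m • J e‖ := hJh ▸ norm_add_le _ _
      _ ≤ j * ‖S v‖ + |m| * (j * ‖e‖) := by
        rw [norm_smul, Real.norm_eq_abs]; gcongr <;> exact hJ _
      _ ≤ j * ‖S v‖ + P * j / δ * ‖S v‖ * (j * ‖e‖) := by gcongr
      _ = _ := by rw [he]; ring
  set D := j * (P * j / δ + 1) with hD
  have hD0 : 0 < D := by positivity
  have hSv : c / D * ‖w‖ ≤ ‖S v‖ := by
    rw [div_mul_eq_mul_div, div_le_iff₀ hD0]
    linarith [hT' w]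
  have hwpos : 0 < ‖w‖ := norm_pos_iff.2 hw
  have hSpos : 0 < ‖S v‖ := lt_of_lt_of_le (by positivity) hSv
  refine ⟨v, ?_, ?_⟩
  · rintro rfl
    simp at hSpos
  · rw [hA]
    calc c' * (c / D) * (‖w‖ * ‖v‖) = (c / D * ‖w‖) * (c' * ‖v‖) := by ring
      _ ≤ ‖S v‖ * ‖S v‖ := by gcongr; exact hS' v
      _ = _ := by ring

end PetrovGalerkin

/-! ### Multiplication operators on L². -/

section Multiplication

variable {α : Type*} [MeasurableSpace α] {μ : Measure α}

lemma _root_.MeasureTheory.MemLp.bdd_mul_of_ae {a f : α → ℝ} {C : ℝ} (hf : MemLp f 2 μ)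
    (ha : AEStronglyMeasurable a μ) (hC : ∀ᵐ x ∂μ, |a x| ≤ C) :
    MemLp (fun x => a x * f x) 2 μ := by
  refine hf.of_le_mul (c := C) (ha.mul hf.1) ?_
  filter_upwards [hC] with x hx
  rw [norm_mul, Real.norm_eq_abs]
  gcongr

/-- Multiplication by an essentially bounded function, as an operator on `L²`. -/
lemma exists_mul_operator {a : α → ℝ} {C : ℝ}
    (ha : AEStronglyMeasurable a μ) (hC : ∀ᵐ x ∂μ, |a x| ≤ C) :
    ∃ A : Lp ℝ 2 μ →L[ℝ] Lp ℝ 2 μ, (∀ g, ‖A g‖ ≤ C * ‖g‖) ∧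
      ∀ g, A g =ᵐ[μ] fun x => a x * g x := by
  have hm : ∀ g : Lp ℝ 2 μ, MemLp (fun x => a x * g x) 2 μ := fun g =>
    (Lp.memLp g).bdd_mul_of_ae ha hC
  let L : Lp ℝ 2 μ →ₗ[ℝ] Lp ℝ 2 μ :=
    { toFun := fun g => (hm g).toLp _
      map_add' := fun f g => by
        rw [← MemLp.toLp_add]
        refine MemLp.toLp_congr _ _ ?_
        filter_upwards [Lp.coeFn_add f g] with x hx
        simp only [hx, Pi.add_apply, mul_add]
      map_smul' := fun c g => by
        rw [RingHom.id_apply, ← MemLp.toLp_const_smul]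
        refine MemLp.toLp_congr _ _ ?_
        filter_upwards [Lp.coeFn_smul c g] with x hx
        simp only [hx, Pi.smul_apply, smul_eq_mul, mul_left_comm] }
  have hL : ∀ g, L g =ᵐ[μ] fun x => a x * g x := fun g => (hm g).coeFn_toLp
  have hb : ∀ g, ‖L g‖ ≤ C * ‖g‖ := fun g => by
    refine Lp.norm_le_mul_norm_of_ae_le_mul ?_
    filter_upwards [hL g, hC] with x hx hx'
    rw [hx, norm_mul, Real.norm_eq_abs]
    gcongr
  exact ⟨L.mkContinuous C hb, hb, hL⟩

end Multiplication

end FracDiff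

namespace FracDiff

/-! ### Multiplication by K and K⁻¹; positivity of the weighted mean of K⁻¹. -/

section Coefficient

open Set Filter

variable {β θ Km KM : ℝ} {K : ℝ → ℝ}

lemma IsDiffusivity.le (hK : IsDiffusivity Km KM K) : Km ≤ KM := by
  obtain ⟨x, hx⟩ := hK.2.exists
  exact hx.1.trans hx.2

lemma IsDiffusivity.abs_le (hK : IsDiffusivity Km KM K) (hKm : 0 < Km) :
    ∀ᵐ x ∂unitMeasure, |K x| ≤ KM := by
  filter_upwards [hK.2] with x hx
  rw [abs_of_pos (hKm.trans_le hx.1)]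
  exact hx.2

lemma IsDiffusivity.aestronglyMeasurable_inv (hK : IsDiffusivity Km KM K) :
    AEStronglyMeasurable (fun x => (K x)⁻¹) unitMeasure :=
  hK.1.aemeasurable.inv.aestronglyMeasurable

lemma IsDiffusivity.inv_bounds (hK : IsDiffusivity Km KM K) (hKm : 0 < Km) :
    ∀ᵐ x ∂unitMeasure, KM⁻¹ ≤ (K x)⁻¹ ∧ |(K x)⁻¹| ≤ Km⁻¹ ∧ 0 < (K x)⁻¹ ∧ K x ≠ 0 := by
  filter_upwards [hK.2] with x hx
  have h0 : 0 < K x := hKm.trans_le hx.1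
  exact ⟨inv_anti₀ h0 hx.2, by rw [abs_of_pos (inv_pos.2 h0)]; exact inv_anti₀ hKm hx.1,
    inv_pos.2 h0, h0.ne'⟩

lemma IsDiffusivity.memLp_inv (hK : IsDiffusivity Km KM K) (hKm : 0 < Km) :
    MemLp (fun x => (K x)⁻¹) 2 unitMeasure :=
  MemLp.of_bound hK.aestronglyMeasurable_inv Km⁻¹
    ((hK.inv_bounds hKm).mono fun _ hx => hx.2.1)

lemma exists_coefficient_operators (hK : IsDiffusivity Km KM K) (hKm : 0 < Km) :
    ∃ A J : UnitL2 →L[ℝ] UnitL2, (∀ g, ‖A g‖ ≤ KM * ‖g‖) ∧ (∀ g, ‖J g‖ ≤ Km⁻¹ * ‖g‖) ∧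
      (∀ g, A g =ᵐ[unitMeasure] fun x => K x * g x) ∧
      (∀ g, J g =ᵐ[unitMeasure] fun x => (K x)⁻¹ * g x) ∧
      (∀ g, A (J g) = g) ∧ ∀ g, J (A g) = g := by
  obtain ⟨A, hA, hA'⟩ := exists_mul_operator hK.1 (hK.abs_le hKm)
  obtain ⟨J, hJ, hJ'⟩ := exists_mul_operator hK.aestronglyMeasurable_inv
    ((hK.inv_bounds hKm).mono fun _ hx => hx.2.1)
  refine ⟨A, J, hA, hJ, hA', hJ', fun g => Lp.ext ?_, fun g => Lp.ext ?_⟩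
  · filter_upwards [hA' (J g), hJ' g, hK.inv_bounds hKm] with x h1 h2 h3
    rw [h1, h2, mul_inv_cancel_left₀ h3.2.2.2]
  · filter_upwards [hJ' (A g), hA' g, hK.inv_bounds hKm] with x h1 h2 h3
    rw [h1, h2, inv_mul_cancel_left₀ h3.2.2.2]

lemma ae_weight_pos (β : ℝ) (hθ : θ = 0 ∨ θ = 1) : ∀ᵐ x ∂unitMeasure, 0 < weight β θ x :=
  ae_unitMeasure_of_forall fun _ hx => weight_pos hθ hx

lemma integral_unit_pos {f : ℝ → ℝ} (hf : Integrable f unitMeasure)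
    (h : ∀ᵐ x ∂unitMeasure, 0 < f x) : 0 < ∫ x, f x ∂unitMeasure := by
  rw [integral_pos_iff_support_of_nonneg_ae (h.mono fun _ hx => hx.le) hf, pos_iff_ne_zero]
  intro h0
  obtain ⟨x, hx, hx'⟩ := (h.and (measure_eq_zero_iff_ae_notMem.1 h0)).exists
  exact hx' hx.ne'

lemma integral_weight_pos (hβ' : β < 1 / 2) (hθ : θ = 0 ∨ θ = 1) :
    0 < ∫ x, weight β θ x ∂unitMeasure :=
  integral_unit_pos (memLp_weight hβ' hθ).integrable_unit (ae_weight_pos β hθ)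

/-- The lower bound depends on K only through `KM`, which makes the inf-sup constant uniform in K.
-/
lemma IsDiffusivity.le_integral_weight_mul_inv (hK : IsDiffusivity Km KM K) (hKm : 0 < Km)
    (hβ' : β < 1 / 2) (hθ : θ = 0 ∨ θ = 1) :
    KM⁻¹ * ∫ x, weight β θ x ∂unitMeasure ≤ ∫ x, weight β θ x * (K x)⁻¹ ∂unitMeasure := by
  rw [← integral_const_mul]
  refine integral_mono_ae ((memLp_weight hβ' hθ).integrable_unit.const_mul _)
    (integrable_mul_of_memLp (memLp_weight hβ' hθ) (hK.memLp_inv hKm)) ?_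
  filter_upwards [ae_weight_pos β hθ, hK.inv_bounds hKm] with x h1 h2
  rw [mul_comm]
  exact mul_le_mul_of_nonneg_left h2.1 h1.le

/-- The constant function `1`. -/
noncomputable def unitOne : UnitL2 := (memLp_const (1 : ℝ)).toLp (fun _ => (1 : ℝ))

lemma norm_unitOne : ‖unitOne‖ = 1 := by
  have h : ‖unitOne‖ ^ 2 = 1 := by
    rw [unitOne, norm_sq_toLp]
    simp
  nlinarith [norm_nonneg unitOne]

lemma inner_unitOne (g : UnitL2) : inner ℝ unitOne g = ∫ x, g x ∂unitMeasure := by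
  rw [unitOne, inner_toLp_left]
  simp

lemma inner_weight_apply_unitOne (hβ' : β < 1 / 2) (hθ : θ = 0 ∨ θ = 1) {J : UnitL2 →L[ℝ] UnitL2}
    (hJ : ∀ g, J g =ᵐ[unitMeasure] fun x => (K x)⁻¹ * g x) :
    inner ℝ ((memLp_weight hβ' hθ).toLp (weight β θ)) (J unitOne) =
      ∫ x, weight β θ x * (K x)⁻¹ ∂unitMeasure := by
  rw [inner_toLp_left]
  refine integral_congr_ae ?_
  filter_upwards [hJ unitOne, (memLp_const (1 : ℝ)).coeFn_toLp (μ := unitMeasure) (p := 2)]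
    with x h1 h2
  rw [h1, unitOne, h2, mul_one]

end Coefficient

/-! ### The bilinear form: boundedness, inf-sup condition, solvability. -/

section WeakForm

open Set Filter

variable {β θ Km KM : ℝ} {K : ℝ → ℝ} {T : H0 (1 - β) →L[ℝ] UnitL2} {S : H0 1 →L[ℝ] UnitL2}

lemma isWeakDeriv_fracInt (hT : ∀ w, ∀ x ∈ Icc (0 : ℝ) 1,
      fracInt β θ w.fn x = fracInt β θ w.fn 0 + ∫ s in (0 : ℝ)..x, T w s) (w : H0 (1 - β)) :
    IsWeakDeriv 1 (fracInt β θ w.fn) (T w) :=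
  isWeakDeriv_one_of_eq_primitive (Lp.memLp _)
    (ae_unitMeasure_of_forall fun x hx => hT w x (Ioo_subset_Icc_self hx))

lemma continuousOn_fracInt (hT : ∀ w, ∀ x ∈ Icc (0 : ℝ) 1,
      fracInt β θ w.fn x = fracInt β θ w.fn 0 + ∫ s in (0 : ℝ)..x, T w s) (w : H0 (1 - β)) :
    ContinuousOn (fracInt β θ w.fn) (Icc 0 1) := by
  have := (absolutelyContinuous_primitive (Lp.memLp (T w)).integrable_unit).continuousOn
  rw [uIcc_of_le zero_le_one] at this
  exact (this.const_add _).congr fun x hx => hT w x hx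

lemma _root_.ContinuousOn.memLp_unit {w : ℝ → ℝ} (h : ContinuousOn w (Icc 0 1)) :
    MemLp w 2 unitMeasure := by
  obtain ⟨C, hC⟩ := isCompact_Icc.exists_bound_of_continuousOn h
  refine MemLp.of_bound ((h.mono Ioo_subset_Icc_self).aestronglyMeasurable measurableSet_Ioo) C
    (ae_unitMeasure_of_forall fun x hx => hC x (Ioo_subset_Icc_self hx))

lemma memH_one {w g : ℝ → ℝ} (h : ContinuousOn w (Icc 0 1)) (hg : IsWeakDeriv 1 w g) :
    MemH 1 w := by
  refine ⟨h.memLp_unit, fun k hk => ?_⟩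
  interval_cases k
  exacts [⟨w, isWeakDeriv_zero h.memLp_unit⟩, ⟨g, hg⟩]

lemma memH_one_fracInt (hβ : 0 < β) (hβ' : β < 1 / 2) (hθ : θ = 0 ∨ θ = 1) (w : H0 (1 - β)) :
    MemH 1 (fracInt β θ w.fn) := by
  obtain ⟨c, hc, T, -, -, -, hT⟩ := exists_fracDeriv hβ hβ' hθ
  exact memH_one (continuousOn_fracInt hT w) (isWeakDeriv_fracInt hT w)

lemma formA_eq_inner (hT : ∀ w, ∀ x ∈ Icc (0 : ℝ) 1,
      fracInt β θ w.fn x = fracInt β θ w.fn 0 + ∫ s in (0 : ℝ)..x, T w s)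
    (hS : ∀ v : H0 1, IsWeakDeriv 1 v.fn (S v)) {A : UnitL2 →L[ℝ] UnitL2}
    (hA : ∀ g, A g =ᵐ[unitMeasure] fun x => K x * g x) (w : H0 (1 - β)) (v : H0 1) :
    formA β θ K w v = inner ℝ (A (T w)) (S v) := by
  rw [L2.inner_def]
  refine integral_congr_ae ?_
  filter_upwards [hA (T w), (isWeakDeriv_fracInt hT w).weakDeriv_ae_eq, (hS v).weakDeriv_ae_eq]
    with x h1 h2 h3
  simp [h1, h2, h3, mul_comm]

theorem exists_formA_bilinear (hβ : 0 < β) (hβ' : β < 1 / 2) (hθ : θ = 0 ∨ θ = 1) (hKm : 0 < Km)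
    (hK : IsDiffusivity Km KM K) :
    ∃ B : H0 (1 - β) →L[ℝ] H0 1 →L[ℝ] ℝ, (∀ w v, B w v = formA β θ K w v) ∧ ‖B‖ ≤ |KM| := by
  obtain ⟨c, hc, T, hT1, -, -, hT⟩ := exists_fracDeriv hβ hβ' hθ
  obtain ⟨S, hS1, -, -, hS⟩ := exists_weakDeriv_H0_one
  obtain ⟨A, J, hA1, -, hA, -⟩ := exists_coefficient_operators hK hKm
  refine ⟨(innerSL ℝ).bilinearComp (A ∘L T) S, fun w v => (formA_eq_inner hT hS hA w v).symm,
    ContinuousLinearMap.opNorm_le_bound₂ _ (abs_nonneg _) fun w v => ?_⟩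
  have hKM : 0 ≤ KM := hKm.le.trans hK.le
  calc ‖inner ℝ (A (T w)) (S v)‖ ≤ ‖A (T w)‖ * ‖S v‖ := norm_inner_le_norm _ _
    _ ≤ (KM * ‖w‖) * ‖v‖ := by
      gcongr
      · exact (hA1 _).trans (by gcongr; exact hT1 w)
      · exact hS1 v
    _ = |KM| * ‖w‖ * ‖v‖ := by rw [abs_of_nonneg hKM]

/-- The operators T and S, the weight and δ are all chosen before K, so κ is uniform over the class
of diffusivities. -/
theorem exists_formA_infSup (hβ : 0 < β) (hβ' : β < 1 / 2) (hθ : θ = 0 ∨ θ = 1) (hKm : 0 < Km)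
    (KM : ℝ) : ∃ κ : ℝ, 0 < κ ∧ ∀ K, IsDiffusivity Km KM K → ∀ w : H0 (1 - β), w ≠ 0 →
      ∃ v : H0 1, v ≠ 0 ∧ κ * (‖w‖ * ‖v‖) ≤ formA β θ K w v := by
  obtain ⟨c, hc, T, -, hT2, hTr, hT⟩ := exists_fracDeriv hβ hβ' hθ
  obtain ⟨S, -, hS2, hSr, hS⟩ := exists_weakDeriv_H0_one
  -- If `KM` ≤ 0 the class of diffusivities is empty and any κ serves.
  rcases le_or_gt KM 0 with hKM | hKM
  · exact ⟨1, one_pos, fun K hK => absurd (hKm.trans_le hK.le) hKM.not_gt⟩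
  set p := (memLp_weight hβ' hθ).toLp (weight β θ) with hp
  set δ : ℝ := KM⁻¹ * ∫ x, weight β θ x ∂unitMeasure with hδ
  have hδ0 : 0 < δ := mul_pos (inv_pos.2 hKM) (integral_weight_pos hβ' hθ)
  have hj : 0 < Km⁻¹ := inv_pos.2 hKm
  refine ⟨1 / 2 * (c / (Km⁻¹ * (‖p‖ * Km⁻¹ / δ + 1))), by positivity, fun K hK w hw => ?_⟩
  obtain ⟨A, J, -, hJ1, hA, hJ, -, hJA⟩ := exists_coefficient_operators hK hKm
  simp only [formA_eq_inner hT hS hA]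
  refine exists_infSup (p := p) (e := unitOne) (fun w => ?_) hJA (fun g => ?_) norm_unitOne hc hT2
    (by norm_num) hS2 hj hJ1 hδ0 ?_ le_rfl hw
  · rw [hp, inner_toLp_left]
    exact (hTr _).2 ⟨w, rfl⟩
  · rw [inner_unitOne, hSr]
  · rw [inner_weight_apply_unitOne hβ' hθ hJ]
    exact hK.le_integral_weight_mul_inv hKm hβ' hθ

lemma IsDiffusivity.inner_weight_ne_zero (hK : IsDiffusivity Km KM K) (hKm : 0 < Km)
    (hβ' : β < 1 / 2) (hθ : θ = 0 ∨ θ = 1) {J : UnitL2 →L[ℝ] UnitL2}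
    (hJ : ∀ g, J g =ᵐ[unitMeasure] fun x => (K x)⁻¹ * g x) :
    inner ℝ ((memLp_weight hβ' hθ).toLp (weight β θ)) (J unitOne) ≠ 0 := by
  rw [inner_weight_apply_unitOne hβ' hθ hJ]
  exact ((mul_pos (inv_pos.2 (hKm.trans_le hK.le)) (integral_weight_pos hβ' hθ)).trans_le
    (hK.le_integral_weight_mul_inv hKm hβ' hθ)).ne'

theorem exists_isWeakSolution (hβ : 0 < β) (hβ' : β < 1 / 2) (hθ : θ = 0 ∨ θ = 1) (hKm : 0 < Km)
    (hK : IsDiffusivity Km KM K) (f : HNeg1) : ∃ u, IsWeakSolution β θ K f u := by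
  obtain ⟨c, hc, T, -, -, hTr, hT⟩ := exists_fracDeriv hβ hβ' hθ
  obtain ⟨S, -, hS2, hSr, hS⟩ := exists_weakDeriv_H0_one
  obtain ⟨A, J, -, -, hA, hJ, hAJ, -⟩ := exists_coefficient_operators hK hKm
  simp only [IsWeakSolution, formA_eq_inner hT hS hA]
  refine exists_forall_inner_eq_dual (p := (memLp_weight hβ' hθ).toLp (weight β θ)) (e := unitOne)
    (fun g => ?_) hAJ (hK.inner_weight_ne_zero hKm hβ' hθ hJ) (fun v => ?_)
    (c := 1 / 2) (by norm_num) hS2 f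
  · rw [inner_toLp_left]
    exact hTr g
  · rw [inner_unitOne]
    exact (hSr _).2 ⟨v, rfl⟩

/-- Solve the problem with right-hand side (S v, S ·); its solution u gives A(u,v) = ‖S v‖². -/
theorem exists_formA_pos (hβ : 0 < β) (hβ' : β < 1 / 2) (hθ : θ = 0 ∨ θ = 1) (hKm : 0 < Km)
    (hK : IsDiffusivity Km KM K) {v : H0 1} (hv : v ≠ 0) :
    ∃ u : H0 (1 - β), 0 < formA β θ K u v := by
  obtain ⟨S, -, hS2, -⟩ := exists_weakDeriv_H0_one
  have hSv : S v ≠ 0 := fun h => by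
    have := hS2 v
    rw [h, norm_zero] at this
    linarith [norm_pos_iff.2 hv]
  obtain ⟨u, hu⟩ := exists_isWeakSolution hβ hβ' hθ hKm hK ((innerSL ℝ (S v)).comp S)
  refine ⟨u, ?_⟩
  rw [hu v]
  exact real_inner_self_pos.2 hSv

lemma formA_sub (hβ : 0 < β) (hβ' : β < 1 / 2) (hθ : θ = 0 ∨ θ = 1) (hKm : 0 < Km)
    (hK : IsDiffusivity Km KM K) (u w : H0 (1 - β)) (v : H0 1) :
    formA β θ K (u - w) v = formA β θ K u v - formA β θ K w v := by
  obtain ⟨B, hB, -⟩ := exists_formA_bilinear hβ hβ' hθ hKm hK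
  simp only [← hB, map_sub, sub_apply]

theorem IsWeakSolution.unique (hβ : 0 < β) (hβ' : β < 1 / 2) (hθ : θ = 0 ∨ θ = 1) (hKm : 0 < Km)
    (hK : IsDiffusivity Km KM K) {f : H0 1 → ℝ} {u w : H0 (1 - β)}
    (hu : IsWeakSolution β θ K f u) (hw : IsWeakSolution β θ K f w) : u = w := by
  by_contra hne
  obtain ⟨κ, hκ, h⟩ := exists_formA_infSup hβ hβ' hθ hKm KM
  obtain ⟨v, hv, h'⟩ := h K hK (u - w) (sub_ne_zero.2 hne)
  rw [formA_sub hβ hβ' hθ hKm hK, hu v, hw v, sub_self] at h'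
  have := norm_pos_iff.2 (sub_ne_zero.2 hne)
  have := norm_pos_iff.2 hv
  exact absurd h' (not_le.2 (by positivity))

end WeakForm

end FracDiff

namespace FracDiff

/-! ### The functions w_l and u_l, and the nondegeneracy number. -/

section AuxiliaryProblem

open Set Filter

variable {β θ Km KM : ℝ} {K : ℝ → ℝ} {T : H0 (1 - β) →L[ℝ] UnitL2}

lemma continuousOn_primitive {g : ℝ → ℝ} (hg : Integrable g unitMeasure) :
    ContinuousOn (fun x => ∫ s in (0 : ℝ)..x, g s) (Icc 0 1) := by
  have := (absolutelyContinuous_primitive hg).continuousOn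
  rwa [uIcc_of_le zero_le_one] at this

lemma integral_mul_congr_ae (a : ℝ → ℝ) {f g : ℝ → ℝ} (h : f =ᵐ[unitMeasure] g) :
    ∫ x, a x * f x ∂unitMeasure = ∫ x, a x * g x ∂unitMeasure :=
  integral_congr_ae ((ae_eq_refl a).mul h)

/-- A weak form of the flux equation: `q + ∫_0^x f` is constant. -/
lemma ae_add_primitive_eq_const {q f : ℝ → ℝ} (hq : MemLp q 2 unitMeasure)
    (hf : MemLp f 2 unitMeasure)
    (h : ∀ v : H0 1, ∫ x, q x * weakDeriv 1 v.fn x ∂unitMeasure = ∫ x, f x * v.fn x ∂unitMeasure) :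
    ∃ a : ℝ, ∀ᵐ x ∂unitMeasure, q x + ∫ s in (0 : ℝ)..x, f s = a := by
  have hF := (continuousOn_primitive hf.integrable_unit).memLp_unit
  refine ae_eq_const_of_forall_integral_mul_deriv_eq_zero
    (hq.integrable_unit.add hF.integrable_unit) fun φ hφ => ?_
  have h1 : (1 : ℝ) ∈ Icc (0 : ℝ) 1 := by simp
  have hfn := ae_restrict_of_ae (s := Ioo 0 1) (testEmbed_fn h1 ⟨φ, hφ⟩)
  have hd : IsWeakDeriv 1 (testEmbed h1 ⟨φ, hφ⟩).fn (deriv φ) := by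
    refine isWeakDeriv_one_of_eq_primitive (c := 0) (hφ.isTestFunction_deriv.memLp 2 unitMeasure) ?_
    filter_upwards [hfn] with x hx
    rw [hx, hφ.integral_deriv_eq, hφ.eq_zero_of_notMem (x := 0) (by simp)]
    ring
  have e1 := h (testEmbed h1 ⟨φ, hφ⟩)
  have e2 : ∫ x, q x * weakDeriv 1 (testEmbed h1 ⟨φ, hφ⟩).fn x ∂unitMeasure =
      ∫ x, q x * deriv φ x ∂unitMeasure :=
    integral_mul_congr_ae q hd.weakDeriv_ae_eq
  have e3 : ∫ x, f x * (testEmbed h1 ⟨φ, hφ⟩).fn x ∂unitMeasure = ∫ x, f x * φ x ∂unitMeasure :=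
    integral_mul_congr_ae f hfn
  have hm := hφ.isTestFunction_deriv.memLp 2 unitMeasure
  simp only [add_mul]
  rw [integral_add (integrable_mul_of_memLp hq hm) (integrable_mul_of_memLp hF hm),
    integral_primitive_mul_deriv hf.integrable_unit hφ, ← e3, ← e2, e1, add_neg_cancel]

/-- The explicit solution of the two-point problem for `D (K D w) = 0`. -/
noncomputable def linearProfile (K : ℝ → ℝ) (x : ℝ) : ℝ :=
  1 - (∫ s in (0 : ℝ)..x, (K s)⁻¹) / ∫ s, (K s)⁻¹ ∂unitMeasure

lemma IsDiffusivity.integral_inv_pos (hK : IsDiffusivity Km KM K) (hKm : 0 < Km) :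
    0 < ∫ s, (K s)⁻¹ ∂unitMeasure :=
  integral_unit_pos (hK.memLp_inv hKm).integrable_unit
    ((hK.inv_bounds hKm).mono fun _ hx => hx.2.2.1)

lemma isWl_linearProfile (hK : IsDiffusivity Km KM K) (hKm : 0 < Km) :
    IsWl K (linearProfile K) := by
  have hJ := hK.integral_inv_pos hKm
  have hm := hK.memLp_inv hKm
  have hc : ContinuousOn (linearProfile K) (Icc 0 1) :=
    continuousOn_const.sub ((continuousOn_primitive hm.integrable_unit).div_const _)
  set c : ℝ := ∫ s, (K s)⁻¹ ∂unitMeasure with hc'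
  have hd : IsWeakDeriv 1 (linearProfile K) (fun x => -c⁻¹ * (K x)⁻¹) := by
    refine isWeakDeriv_one_of_eq_primitive (c := 1) (hm.const_mul _) (ae_of_all _ fun x => ?_)
    rw [intervalIntegral.integral_const_mul, linearProfile, ← hc']
    ring
  refine ⟨hc, memH_one hc hd, by simp [linearProfile], ?_, fun v => ?_⟩
  · rw [linearProfile, ← hc', ← integral_unitMeasure, ← hc', div_self hJ.ne', sub_self]
  · obtain ⟨S, -, -, hSr, hS⟩ := exists_weakDeriv_H0_one
    have e : ∫ x, K x * weakDeriv 1 (linearProfile K) x * weakDeriv 1 v.fn x ∂unitMeasure =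
        ∫ x, -c⁻¹ * S v x ∂unitMeasure := by
      refine integral_congr_ae ?_
      filter_upwards [hd.weakDeriv_ae_eq, (hS v).weakDeriv_ae_eq, hK.inv_bounds hKm]
        with x h1 h2 h3
      have := h3.2.2.2
      rw [h1, h2]
      field_simp
    rw [e, integral_const_mul, (hSr _).2 ⟨v, rfl⟩, mul_zero]

/-- The flux K w' is constant, so w is affine in ∫₀ˣ K⁻¹, and the two boundary values fix both
coefficients. -/
lemma IsWl.eqOn (hK : IsDiffusivity Km KM K) (hKm : 0 < Km) {w : ℝ → ℝ} (hw : IsWl K w) :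
    EqOn w (linearProfile K) (Icc 0 1) := by
  obtain ⟨hc, hH, h0, h1, hv⟩ := hw
  obtain ⟨g, hg⟩ := hH.2 1 le_rfl
  have hm := hK.memLp_inv hKm
  obtain ⟨a, ha⟩ := ae_add_primitive_eq_const (f := 0) (q := fun x => K x * weakDeriv 1 w x)
    ((weakDeriv_spec hg).1.bdd_mul_of_ae hK.1 (hK.abs_le hKm)) MemLp.zero
    fun v => by simpa using hv v
  obtain ⟨c, hcw⟩ := hg.exists_eq_primitive hH.1.integrable_unit
  have hga : g =ᵐ[unitMeasure] fun x => a * (K x)⁻¹ := by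
    filter_upwards [ha, hg.weakDeriv_ae_eq, hK.inv_bounds hKm] with x h1 h2 h3
    simp only [Pi.zero_apply, intervalIntegral.integral_zero, add_zero, h2] at h1
    rw [← h1, mul_right_comm, mul_inv_cancel₀ h3.2.2.2, one_mul]
  have hw : EqOn w (fun x => c + a * ∫ s in (0 : ℝ)..x, (K s)⁻¹) (Icc 0 1) := by
    refine eqOn_Icc_of_ae_eq hc
      (((continuousOn_primitive hm.integrable_unit).const_mul a).const_add c) ?_
    filter_upwards [hcw, ae_unitMeasure_of_forall fun x hx => hx] with x hx hx'
    rw [hx, primitive_congr_ae hga (Ioo_subset_Icc_self hx'), intervalIntegral.integral_const_mul]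
  have e0 := hw (show (0 : ℝ) ∈ Icc (0 : ℝ) 1 by simp)
  have e1 := hw (show (1 : ℝ) ∈ Icc (0 : ℝ) 1 by simp)
  simp only [intervalIntegral.integral_same, mul_zero, add_zero, h0] at e0
  simp only [h1, ← integral_unitMeasure, ← e0] at e1
  have hJ := hK.integral_inv_pos hKm
  intro x hx
  have : a = -1 / ∫ s, (K s)⁻¹ ∂unitMeasure := by
    rw [eq_div_iff hJ.ne']; linarith
  rw [hw hx, linearProfile, ← e0, this]
  ring

lemma fracInt_endpoints (β θ : ℝ) (w : ℝ → ℝ) :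
    fracInt β θ w 0 = (1 - θ) * rightInt β w 0 ∧ fracInt β θ w 1 = θ * leftInt β w 1 := by
  simp [fracInt, leftInt, rightInt]

/-- The boundary terms are the endpoint values of I^β_θ u, and their difference is the integral of
its derivative. -/
lemma nondegeneracy_number_eq
    (hT : ∀ w, ∀ x ∈ Icc (0 : ℝ) 1,
      fracInt β θ w.fn x = fracInt β θ w.fn 0 + ∫ s in (0 : ℝ)..x, T w s) (u : H0 (1 - β)) :
    1 + θ * leftInt β u.fn 1 - (1 - θ) * rightInt β u.fn 0 = 1 + ∫ s, T u s ∂unitMeasure := by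
  have h := hT u 1 (by simp)
  obtain ⟨h0, h1⟩ := fracInt_endpoints β θ u.fn
  rw [h0, h1] at h
  rw [integral_unitMeasure, h]
  ring

/-- Both sides of the equation for u_l vanish at x = 0, so it is equivalent to its derivative. The
unknown boundary terms enter only through ∫ T u. -/
lemma isUl_iff
    (hT : ∀ w, ∀ x ∈ Icc (0 : ℝ) 1,
      fracInt β θ w.fn x = fracInt β θ w.fn 0 + ∫ s in (0 : ℝ)..x, T w s) {wl : ℝ → ℝ}
    {u : H0 (1 - β)} (hK : IsDiffusivity Km KM K) (hKm : 0 < Km) (hwl : IsWl K wl) :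
    IsUl β θ wl u ↔ T u =ᵐ[unitMeasure] fun x =>
      (1 + ∫ s, T u s ∂unitMeasure) - (∫ s, (K s)⁻¹ ∂unitMeasure)⁻¹ * (K x)⁻¹ := by
  set J := ∫ s, (K s)⁻¹ ∂unitMeasure with hJ
  set b := 1 + ∫ s, T u s ∂unitMeasure with hb
  have hm := hK.memLp_inv hKm
  have hi : Integrable (fun x => b - J⁻¹ * (K x)⁻¹) unitMeasure :=
    (integrable_const _).sub (hm.integrable_unit.const_mul _)
  have hprim : ∀ x ∈ Icc (0 : ℝ) 1, ∫ s in (0 : ℝ)..x, (b - J⁻¹ * (K s)⁻¹) =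
      b * x + (wl x - 1) := by
    intro x hx
    rw [intervalIntegral.integral_sub (by simp)
      (Integrable.intervalIntegrable_unit (hm.integrable_unit.const_mul _) (by simp) hx),
      intervalIntegral.integral_const, intervalIntegral.integral_const_mul, hwl.eqOn hK hKm hx,
      linearProfile, ← hJ, smul_eq_mul]
    ring
  have hiff : IsUl β θ wl u ↔ ∀ x ∈ Icc (0 : ℝ) 1,
      ∫ s in (0 : ℝ)..x, T u s = ∫ s in (0 : ℝ)..x, (b - J⁻¹ * (K s)⁻¹) := by
    refine forall₂_congr fun x hx => ?_
    have hn := nondegeneracy_number_eq hT u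
    have h0 := (fracInt_endpoints β θ u.fn).1
    rw [hprim x hx, hT u x hx, h0, hb, ← hn]
    constructor <;> intro h <;> linear_combination h
  rw [hiff]
  refine ⟨fun h => ?_, fun h x hx => primitive_congr_ae h hx⟩
  have hTi := (Lp.memLp (T u)).integrable_unit
  have := ae_eq_zero_of_forall_primitive_eq_zero (hTi.sub hi) fun x hx => by
    simp only [Pi.sub_apply]
    rw [intervalIntegral.integral_sub (Integrable.intervalIntegrable_unit hTi (by simp) hx)
      (Integrable.intervalIntegrable_unit hi (by simp) hx), h x hx, sub_self]
  filter_upwards [this] with x hx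
  exact sub_eq_zero.1 hx

/-- The value of `1 + θ (ˡI^β u_l)(1) - (1-θ) (ʳI^β u_l)(0)`. -/
noncomputable def nondegeneracyNumber (β θ : ℝ) (K : ℝ → ℝ) : ℝ :=
  (∫ x, weight β θ x * (K x)⁻¹ ∂unitMeasure) /
    ((∫ s, (K s)⁻¹ ∂unitMeasure) * ∫ x, weight β θ x ∂unitMeasure)

lemma IsDiffusivity.nondegeneracyNumber_pos (hK : IsDiffusivity Km KM K) (hKm : 0 < Km)
    (hβ' : β < 1 / 2) (hθ : θ = 0 ∨ θ = 1) : 0 < nondegeneracyNumber β θ K := by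
  have hKM := inv_pos.2 (hKm.trans_le hK.le)
  exact div_pos ((mul_pos hKM (integral_weight_pos hβ' hθ)).trans_le
    (hK.le_integral_weight_mul_inv hKm hβ' hθ))
    (mul_pos (hK.integral_inv_pos hKm) (integral_weight_pos hβ' hθ))

/-- Thus the right-hand side of the equation for T u_l is admissible, i.e. orthogonal to the weight,
for exactly one value of b. -/
lemma integral_weight_mul_sub (hK : IsDiffusivity Km KM K) (hKm : 0 < Km)
    (hβ' : β < 1 / 2) (hθ : θ = 0 ∨ θ = 1) (b : ℝ) :
    ∫ x, weight β θ x * (b - (∫ s, (K s)⁻¹ ∂unitMeasure)⁻¹ * (K x)⁻¹) ∂unitMeasure =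
      (b - nondegeneracyNumber β θ K) * ∫ x, weight β θ x ∂unitMeasure := by
  have hw := memLp_weight hβ' hθ
  have e : ∀ x, weight β θ x * (b - (∫ s, (K s)⁻¹ ∂unitMeasure)⁻¹ * (K x)⁻¹) =
      b * weight β θ x - (∫ s, (K s)⁻¹ ∂unitMeasure)⁻¹ * (weight β θ x * (K x)⁻¹) :=
    fun x => by ring
  simp only [e]
  rw [integral_sub (hw.integrable_unit.const_mul _)
    ((integrable_mul_of_memLp hw (hK.memLp_inv hKm)).const_mul _), integral_const_mul,
    integral_const_mul, nondegeneracyNumber]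
  have h1 := (integral_weight_pos hβ' hθ).ne'
  have h2 := (hK.integral_inv_pos hKm).ne'
  field_simp

theorem IsUl.nondegeneracy_number (hβ : 0 < β) (hβ' : β < 1 / 2) (hθ : θ = 0 ∨ θ = 1)
    (hKm : 0 < Km) (hK : IsDiffusivity Km KM K) {wl : ℝ → ℝ} (hwl : IsWl K wl) {u : H0 (1 - β)}
    (hu : IsUl β θ wl u) :
    1 + θ * leftInt β u.fn 1 - (1 - θ) * rightInt β u.fn 0 = nondegeneracyNumber β θ K := by
  obtain ⟨c, hc, T, -, -, hTr, hT⟩ := exists_fracDeriv hβ hβ' hθ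
  rw [nondegeneracy_number_eq hT]
  have h0 := (hTr (T u)).2 ⟨u, rfl⟩
  rw [integral_mul_congr_ae _ ((isUl_iff hT hK hKm hwl).1 hu),
    integral_weight_mul_sub hK hKm hβ' hθ] at h0
  exact sub_eq_zero.1 ((mul_eq_zero.1 h0).resolve_right (integral_weight_pos hβ' hθ).ne')

theorem existsUnique_isUl (hβ : 0 < β) (hβ' : β < 1 / 2) (hθ : θ = 0 ∨ θ = 1)
    (hKm : 0 < Km) (hK : IsDiffusivity Km KM K) {wl : ℝ → ℝ} (hwl : IsWl K wl) :
    ∃! u : H0 (1 - β), IsUl β θ wl u := by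
  obtain ⟨c, hc, T, -, hT2, hTr, hT⟩ := exists_fracDeriv hβ hβ' hθ
  have hm := hK.memLp_inv hKm
  set J := ∫ s, (K s)⁻¹ ∂unitMeasure with hJ
  set b := nondegeneracyNumber β θ K with hb
  have hg : MemLp (fun x => b - J⁻¹ * (K x)⁻¹) 2 unitMeasure :=
    (memLp_const _).sub (hm.const_mul _)
  obtain ⟨u, hu⟩ := (hTr (hg.toLp _)).1 (by
    rw [integral_mul_congr_ae _ hg.coeFn_toLp,
      integral_weight_mul_sub hK hKm hβ' hθ, sub_self, zero_mul])
  refine ⟨u, (isUl_iff hT hK hKm hwl).2 ?_, fun u' hu' => ?_⟩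
  -- Consistency: b was chosen in advance, and 1 + ∫ T u returns it because J⁻¹ K⁻¹ has integral 1.
  · have e : ∫ s, T u s ∂unitMeasure = b - 1 := by
      rw [hu, integral_congr_ae hg.coeFn_toLp, integral_sub (integrable_const _)
        (hm.integrable_unit.const_mul _), integral_const_mul, ← hJ,
        inv_mul_cancel₀ (hK.integral_inv_pos hKm).ne']
      simp
    rw [e, add_sub_cancel, hu]
    exact hg.coeFn_toLp
  · have h1 := (isUl_iff hT hK hKm hwl).1 hu'
    rw [← nondegeneracy_number_eq hT, hu'.nondegeneracy_number hβ hβ' hθ hKm hK hwl] at h1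
    have h2 : T u' = T u := by
      rw [hu]
      exact Lp.ext (h1.trans hg.coeFn_toLp.symm)
    have h3 := hT2 (u' - u)
    rw [map_sub, h2, sub_self, norm_zero] at h3
    exact sub_eq_zero.1 (norm_eq_zero.1 (le_antisymm
      (nonpos_of_mul_nonpos_right h3 hc) (norm_nonneg _)))

theorem nondegenerate (hβ : 0 < β) (hβ' : β < 1 / 2) (hθ : θ = 0 ∨ θ = 1)
    (hKm : 0 < Km) (hK : IsDiffusivity Km KM K) : Nondegenerate β θ K := fun _ _ hwl hul => by
  rw [hul.nondegeneracy_number hβ hβ' hθ hKm hK hwl]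
  exact (hK.nondegeneracyNumber_pos hKm hβ' hθ).ne'

end AuxiliaryProblem

end FracDiff

namespace FracDiff

/-! ### Product rule for indefinite integrals. -/

section ProductRule

open Set Filter

lemma derivWithin_eq_deriv {a : ℝ → ℝ} {x : ℝ} (hx : x ∈ Ioo (0 : ℝ) 1) :
    derivWithin a (Icc 0 1) x = deriv a x :=
  derivWithin_of_mem_nhds (Icc_mem_nhds hx.1 hx.2)

/-- Leibniz rule for absolutely continuous functions. The factor `a` is C¹ only on [0,1], hence
`derivWithin`, which is the ordinary derivative inside. -/
lemma mul_eq_primitive {a h g : ℝ → ℝ} {c : ℝ} (ha : ContDiffOn ℝ 1 a (Icc 0 1))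
    (hg : Integrable g unitMeasure)
    (hh : ∀ᵐ x ∂unitMeasure, h x = c + ∫ s in (0 : ℝ)..x, g s) :
    ∀ᵐ x ∂unitMeasure, a x * h x =
      a 0 * c + ∫ s in (0 : ℝ)..x, (derivWithin a (Icc 0 1) s * h s + a s * g s) := by
  set H : ℝ → ℝ := fun x => c + ∫ s in (0 : ℝ)..x, g s with hH
  have hHac : AbsolutelyContinuousOnInterval H 0 1 :=
    (contDiffOn_const.absolutelyContinuousOnInterval (f := fun _ => c)).add
      (absolutelyContinuous_primitive hg)
  have haac : AbsolutelyContinuousOnInterval a 0 1 :=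
    ContDiffOn.absolutelyContinuousOnInterval (by rwa [uIcc_of_le zero_le_one])
  have hd : (fun s => derivWithin a (Icc 0 1) s * h s + a s * g s) =ᵐ[unitMeasure]
      fun s => deriv a s * H s + a s * deriv H s := by
    filter_upwards [hh, ae_hasDerivAt_primitive hg, ae_unitMeasure_of_forall fun x hx => hx]
      with s h1 h2 h3
    rw [derivWithin_eq_deriv h3, h1, hH, (h2.const_add c).deriv]
  filter_upwards [hh, ae_unitMeasure_of_forall fun x hx => hx] with x hx hx01
  have hx' := Ioo_subset_Icc_self hx01
  have hsub : uIcc 0 x ⊆ uIcc (0 : ℝ) 1 := by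
    rw [uIcc_of_le hx'.1, uIcc_of_le zero_le_one]
    exact Icc_subset_Icc_right hx'.2
  rw [primitive_congr_ae hd hx', (haac.mono hsub).integral_deriv_mul_eq_sub (hHac.mono hsub), hx]
  simp [hH]

end ProductRule

/-! ### Quantitative H^n bounds under multiplication and division. -/

section SobolevBounds

open Set Filter

/-- `w ∈ L²(0,1)` with norm at most `C`. -/
def L2Bound (w : ℝ → ℝ) (C : ℝ) : Prop :=
  MemLp w 2 unitMeasure ∧ 0 ≤ C ∧ eLpNorm w 2 unitMeasure ≤ ENNReal.ofReal C

lemma l2Bound_iff {w : ℝ → ℝ} {C : ℝ} :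
    L2Bound w C ↔ MemLp w 2 unitMeasure ∧ 0 ≤ C ∧ ∫ x, w x ^ 2 ∂unitMeasure ≤ C ^ 2 := by
  refine and_congr_right fun hw => and_congr_right fun hC => ?_
  rw [← norm_sq_toLp hw, sq_le_sq₀ (norm_nonneg _) hC, Lp.norm_toLp,
    ENNReal.le_ofReal_iff_toReal_le hw.2.ne hC]

lemma L2Bound.congr {w w' : ℝ → ℝ} {C : ℝ} (h : L2Bound w C) (hw : w =ᵐ[unitMeasure] w') :
    L2Bound w' C :=
  ⟨h.1.ae_eq hw, h.2.1, (eLpNorm_congr_ae hw).symm.trans_le h.2.2⟩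

lemma L2Bound.mono {w : ℝ → ℝ} {C C' : ℝ} (h : L2Bound w C) (hC : C ≤ C') : L2Bound w C' :=
  ⟨h.1, h.2.1.trans hC, h.2.2.trans (ENNReal.ofReal_le_ofReal hC)⟩

lemma L2Bound.add {w w' : ℝ → ℝ} {C C' : ℝ} (h : L2Bound w C) (h' : L2Bound w' C') :
    L2Bound (fun x => w x + w' x) (C + C') := by
  refine ⟨h.1.add h'.1, add_nonneg h.2.1 h'.2.1, ?_⟩
  rw [ENNReal.ofReal_add h.2.1 h'.2.1]
  exact (eLpNorm_add_le h.1.1 h'.1.1 (by norm_num)).trans (add_le_add h.2.2 h'.2.2)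

lemma L2Bound.bdd_mul {a w : ℝ → ℝ} {R C : ℝ} (h : L2Bound w C)
    (ha : AEStronglyMeasurable a unitMeasure) (hR : ∀ᵐ x ∂unitMeasure, |a x| ≤ R) :
    L2Bound (fun x => a x * w x) (R * C) := by
  have hR0 : 0 ≤ R := by
    obtain ⟨x, hx⟩ := hR.exists
    exact (abs_nonneg _).trans hx
  refine ⟨h.1.bdd_mul_of_ae ha hR, mul_nonneg hR0 h.2.1, ?_⟩
  rw [ENNReal.ofReal_mul hR0]
  refine (eLpNorm_le_mul_eLpNorm_of_ae_le_mul (c := R) ?_ 2).trans (by gcongr; exact h.2.2)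
  filter_upwards [hR] with x hx
  rw [norm_mul, Real.norm_eq_abs]
  gcongr

lemma l2Bound_of_abs_le {w : ℝ → ℝ} {C : ℝ} (hw : AEStronglyMeasurable w unitMeasure)
    (h : ∀ᵐ x ∂unitMeasure, |w x| ≤ C) : L2Bound w C := by
  have h1 : L2Bound (fun _ => (1 : ℝ)) 1 := l2Bound_iff.2 ⟨memLp_const _, zero_le_one, by simp⟩
  simpa using h1.bdd_mul hw h

lemma L2Bound.abs_integral_le {w : ℝ → ℝ} {C x : ℝ} (h : L2Bound w C) (hx : x ∈ Icc (0 : ℝ) 1) :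
    |∫ s in (0 : ℝ)..x, w s| ≤ C := by
  have h1 : ∫ s, |w s| ∂unitMeasure ≤ C := by
    refine abs_le_of_sq_le_sq' ?_ h.2.1 |>.2
    have := sq_integral_mul_le (memLp_const (1 : ℝ)) h.1.abs
    simp only [one_mul, one_pow, Pi.abs_apply, sq_abs, integral_const, probReal_univ, smul_eq_mul, mul_one] at this
    exact this.trans (l2Bound_iff.1 h).2.2
  refine le_trans ?_ h1
  rw [integral_unitMeasure]
  refine (intervalIntegral.abs_integral_le_integral_abs hx.1).trans ?_
  exact intervalIntegral.integral_mono_interval le_rfl hx.1 hx.2 (ae_of_all _ fun _ => abs_nonneg _)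
    (Integrable.intervalIntegrable_unit h.1.integrable_unit.abs (by simp) (by simp))

/-- `w ∈ H^n(0,1)`, with `L²` norms of all derivatives up to order `n` at most `C`. -/
def HBound : ℕ → (ℝ → ℝ) → ℝ → Prop
  | 0, w, C => L2Bound w C
  | n + 1, w, C => L2Bound w C ∧ ∃ (c : ℝ) (g : ℝ → ℝ),
      (∀ᵐ x ∂unitMeasure, w x = c + ∫ s in (0 : ℝ)..x, g s) ∧ HBound n g C

variable {n : ℕ} {w w' : ℝ → ℝ} {C C' : ℝ}

lemma HBound.l2Bound (h : HBound n w C) : L2Bound w C := by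
  cases n with
  | zero => exact h
  | succ n => exact h.1

lemma HBound.integrable (h : HBound n w C) : Integrable w unitMeasure := h.l2Bound.1.integrable_unit

lemma HBound.congr (h : HBound n w C) (hw : w =ᵐ[unitMeasure] w') : HBound n w' C := by
  cases n with
  | zero => exact L2Bound.congr h hw
  | succ n =>
    obtain ⟨h0, c, g, hg, h1⟩ := h
    refine ⟨h0.congr hw, c, g, ?_, h1⟩
    filter_upwards [hg, hw] with x hx hx'
    rw [← hx', hx]

lemma HBound.mono (h : HBound n w C) (hC : C ≤ C') : HBound n w C' := by
  induction n generalizing w with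
  | zero => exact L2Bound.mono h hC
  | succ n ih =>
    obtain ⟨h0, c, g, hg, h1⟩ := h
    exact ⟨h0.mono hC, c, g, hg, ih h1⟩

lemma HBound.of_succ (h : HBound (n + 1) w C) : HBound n w C := by
  induction n generalizing w with
  | zero => exact h.1
  | succ n ih =>
    obtain ⟨h0, c, g, hg, h1⟩ := h
    exact ⟨h0, c, g, hg, ih h1⟩

lemma HBound.add (h : HBound n w C) (h' : HBound n w' C') :
    HBound n (fun x => w x + w' x) (C + C') := by
  induction n generalizing w w' with
  | zero => exact L2Bound.add h h'
  | succ n ih =>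
    obtain ⟨h0, c, g, hg, h1⟩ := h
    obtain ⟨h0', c', g', hg', h1'⟩ := h'
    refine ⟨h0.add h0', c + c', _, ?_, ih h1 h1'⟩
    filter_upwards [hg, hg', ae_unitMeasure_of_forall fun x hx => hx] with x hx hx' hx01
    have hm := Ioo_subset_Icc_self hx01
    rw [hx, hx', intervalIntegral.integral_add
      (Integrable.intervalIntegrable_unit h1.integrable (by simp) hm)
      (Integrable.intervalIntegrable_unit h1'.integrable (by simp) hm)]
    ring

lemma HBound.neg (h : HBound n w C) : HBound n (fun x => -w x) C := by
  induction n generalizing w with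
  | zero => exact ⟨h.1.neg, h.2.1, (eLpNorm_neg w 2 unitMeasure).trans_le h.2.2⟩
  | succ n ih =>
    obtain ⟨h0, c, g, hg, h1⟩ := h
    refine ⟨⟨h0.1.neg, h0.2.1, (eLpNorm_neg w 2 unitMeasure).trans_le h0.2.2⟩, -c, _, ?_, ih h1⟩
    filter_upwards [hg] with x hx
    rw [hx, intervalIntegral.integral_neg]
    ring

lemma hBound_const (n : ℕ) (a : ℝ) (h : |a| ≤ C) : HBound n (fun _ => a) C := by
  induction n generalizing a with
  | zero => exact l2Bound_of_abs_le aestronglyMeasurable_const (ae_of_all _ fun _ => h)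
  | succ n ih =>
    exact ⟨l2Bound_of_abs_le aestronglyMeasurable_const (ae_of_all _ fun _ => h), a, fun _ => 0,
      ae_of_all _ fun x => by simp, ih 0 (by simpa using (abs_nonneg a).trans h)⟩

/-- Induction by (ah)' = a'h + ah'; the two terms double the constant at each order. -/
lemma HBound.mul {a h : ℝ → ℝ} {R : ℝ} (ha : ContDiffOn ℝ n a (Icc 0 1))
    (hR : ∀ k ≤ n, ∀ x ∈ Icc (0 : ℝ) 1, |iteratedDerivWithin k a (Icc 0 1) x| ≤ R)
    (hh : HBound n h C) : HBound n (fun x => a x * h x) (2 ^ n * R * C) := by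
  have hbase : ∀ {a : ℝ → ℝ}, ContinuousOn a (Icc 0 1) → (∀ x ∈ Icc (0 : ℝ) 1, |a x| ≤ R) →
      ∀ {h C}, L2Bound h C → L2Bound (fun x => a x * h x) (R * C) := fun ha hR h C hh =>
    hh.bdd_mul ha.memLp_unit.1 (ae_unitMeasure_of_forall fun x hx => hR x (Ioo_subset_Icc_self hx))
  have hR0 : 0 ≤ R := (abs_nonneg _).trans (hR 0 (Nat.zero_le _) 0 (by simp))
  induction n generalizing a h with
  | zero =>
    rw [pow_zero, one_mul]
    exact hbase ha.continuousOn (fun x hx => by simpa using hR 0 le_rfl x hx) hh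
  | succ n ih =>
    have hu : UniqueDiffOn ℝ (Icc (0 : ℝ) 1) := uniqueDiffOn_Icc one_pos
    have hC0 := hh.l2Bound.2.1
    have hd : HBound n (fun x => derivWithin a (Icc 0 1) x * h x) (2 ^ n * R * C) :=
      ih (ha.derivWithin hu (by norm_cast)) (fun k hk x hx => by
        rw [← iteratedDerivWithin_succ']
        exact hR (k + 1) (by omega) x hx) hh.of_succ
    obtain ⟨h0, c, g, hg, h1⟩ := hh
    have hm : HBound n (fun x => a x * g x) (2 ^ n * R * C) :=
      ih (ha.of_le (by norm_cast; omega)) (fun k hk => hR k (by omega)) h1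
    refine ⟨(hbase ha.continuousOn (fun x hx => by simpa using hR 0 (by omega) x hx) h0).mono ?_,
      _, _, mul_eq_primitive (ha.of_le (by norm_cast; omega)) h1.integrable hg,
      (hd.add hm).mono (by rw [pow_succ]; linarith)⟩
    have : (1 : ℝ) ≤ 2 ^ (n + 1) := one_le_pow₀ (by norm_num)
    rw [mul_assoc]
    exact le_mul_of_one_le_left (mul_nonneg hR0 hC0) this

/-- Induction by (q/K)' = K⁻¹(q' - K'·(q/K)): the derivative is again a quotient by K, whose
numerator is bounded one order lower. -/
lemma exists_hBound_div {Km : ℝ} (hKm : 0 < Km) {R : ℝ} (hR0 : 0 ≤ R) (n : ℕ) :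
    ∃ D > 0, ∀ K : ℝ → ℝ, ContDiffOn ℝ n K (Icc 0 1) → (∀ x ∈ Icc (0 : ℝ) 1, Km ≤ K x) →
      (∀ k ≤ n, ∀ x ∈ Icc (0 : ℝ) 1, |iteratedDerivWithin k K (Icc 0 1) x| ≤ R) →
      ∀ q C, HBound n q C → HBound n (fun x => (K x)⁻¹ * q x) (D * C) := by
  have hbase : ∀ {K : ℝ → ℝ}, ContinuousOn K (Icc 0 1) → (∀ x ∈ Icc (0 : ℝ) 1, Km ≤ K x) →
      ∀ {q C}, L2Bound q C → L2Bound (fun x => (K x)⁻¹ * q x) (Km⁻¹ * C) := by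
    intro K hK hm q C hq
    refine hq.bdd_mul (hK.inv₀ fun x hx => (hKm.trans_le (hm x hx)).ne').memLp_unit.1
      (ae_unitMeasure_of_forall fun x hx => ?_)
    have h := hm x (Ioo_subset_Icc_self hx)
    rw [abs_of_pos (inv_pos.2 (hKm.trans_le h))]
    exact inv_anti₀ hKm h
  induction n with
  | zero => exact ⟨Km⁻¹, inv_pos.2 hKm, fun K hK hm _ q C hq => hbase hK.continuousOn hm hq⟩
  | succ n ih =>
    obtain ⟨D, hD, ih⟩ := ih
    -- `Km⁻¹` bounds the function itself; in the other term 1 accounts for q' and 2^n R D for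
    -- K'·(q/K).
    refine ⟨Km⁻¹ + D * (1 + 2 ^ n * R * D), by positivity, fun K hK hm hR q C hq => ?_⟩
    have hC0 := hq.l2Bound.2.1
    have hu : UniqueDiffOn ℝ (Icc (0 : ℝ) 1) := uniqueDiffOn_Icc one_pos
    have hK1 : ContDiffOn ℝ 1 K (Icc 0 1) := hK.of_le (by norm_cast; omega)
    have hKn : ContDiffOn ℝ n K (Icc 0 1) := hK.of_le (by norm_cast; omega)
    have hne : ∀ x ∈ Icc (0 : ℝ) 1, K x ≠ 0 := fun x hx => (hKm.trans_le (hm x hx)).ne'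
    have hg := ih K hKn hm (fun k hk => hR k (by omega)) q C hq.of_succ
    have hKg := HBound.mul (hK.derivWithin hu (m := n) (by norm_cast)) (R := R)
      (fun k hk x hx => by
        rw [← iteratedDerivWithin_succ']
        exact hR (k + 1) (by omega) x hx) hg
    obtain ⟨h0, c, r, hr, h1⟩ := hq
    have hres := ih K hKn hm (fun k hk => hR k (by omega)) _ _ (h1.add hKg.neg)
    have hprod := mul_eq_primitive (hK1.inv hne) h1.integrable hr
    have hb : (0 : ℝ) ≤ D * (1 + 2 ^ n * R * D) * C := by positivity
    have hb' : (0 : ℝ) ≤ Km⁻¹ * C := by positivity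
    refine ⟨(hbase hK.continuousOn hm h0).mono (by linarith), _, _, hprod, (hres.congr ?_).mono ?_⟩
    · refine ae_unitMeasure_of_forall fun x hx => ?_
      have hx' := Ioo_subset_Icc_self hx
      have := hne x hx'
      simp only [derivWithin_inv' (hK1.differentiableOn one_ne_zero x hx') this, Pi.inv_apply]
      field_simp
      ring
    · linarith

end SobolevBounds

end FracDiff

namespace FracDiff

/-! ### Comparison of the inductive bounds with the H^n norm. -/

section SobolevNorm

open Set Filter

variable {n : ℕ} {w : ℝ → ℝ} {C : ℝ}

lemma MemH.isWeakDeriv {m k : ℕ} (h : MemH m w) (hk : k ≤ m) : IsWeakDeriv k w (weakDeriv k w) := by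
  obtain ⟨g, hg⟩ := h.2 k hk
  exact weakDeriv_spec hg

/-- Higher weak derivatives are weak derivatives of the first weak derivative. -/
lemma isWeakDeriv_succ_iff {k : ℕ} {g g' : ℝ → ℝ} (hg : IsWeakDeriv 1 w g) :
    IsWeakDeriv (k + 1) w g' ↔ IsWeakDeriv k g g' := by
  refine and_congr_right fun _ => forall₂_congr fun φ hφ => ?_
  rw [iteratedDeriv_succ, (isWeakDeriv_one_iff.1 hg).2 _ (hφ.isTestFunction_iteratedDeriv k),
    pow_succ, mul_neg_one, neg_mul, neg_inj]

lemma MemH.weakDeriv_one (h : MemH (n + 1) w) : MemH n (weakDeriv 1 w) :=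
  ⟨(h.isWeakDeriv (by omega)).1, fun k hk =>
    ⟨_, (isWeakDeriv_succ_iff (h.isWeakDeriv (by omega))).1 (h.isWeakDeriv (k := k + 1) (by omega))⟩⟩

lemma normH_weakDeriv_one_le (h : MemH (n + 1) w) : normH n (weakDeriv 1 w) ≤ normH (n + 1) w := by
  refine Real.sqrt_le_sqrt ?_
  rw [Finset.sum_range_succ' _ (n + 1)]
  refine le_add_of_le_of_nonneg (Finset.sum_le_sum fun k hk => le_of_eq ?_)
    (integral_nonneg fun x => sq_nonneg _)
  have hk' : k + 1 ≤ n + 1 := by simpa using hk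
  have := (isWeakDeriv_succ_iff (h.isWeakDeriv (by omega))).1 (h.isWeakDeriv hk')
  refine integral_congr_ae ?_
  filter_upwards [this.weakDeriv_ae_eq] with x hx
  rw [hx]

lemma MemH.l2Bound (h : MemH n w) : L2Bound w (normH n w) := by
  refine l2Bound_iff.2 ⟨h.1, Real.sqrt_nonneg _, ?_⟩
  rw [normH, Real.sq_sqrt (Finset.sum_nonneg fun _ _ => integral_nonneg fun x => sq_nonneg _)]
  have e : ∫ x, w x ^ 2 ∂unitMeasure = ∫ x, weakDeriv 0 w x ^ 2 ∂unitMeasure := by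
    refine integral_congr_ae ?_
    filter_upwards [(isWeakDeriv_zero h.1).weakDeriv_ae_eq] with x hx
    rw [hx]
  rw [e]
  exact Finset.single_le_sum (f := fun k => ∫ x, weakDeriv k w x ^ 2 ∂unitMeasure)
    (fun _ _ => integral_nonneg fun x => sq_nonneg _) (by simp)

lemma MemH.hBound (h : MemH n w) : HBound n w (normH n w) := by
  induction n generalizing w with
  | zero => exact h.l2Bound
  | succ n ih =>
    obtain ⟨c, hc⟩ := (h.isWeakDeriv (k := 1) (by omega)).exists_eq_primitive h.1.integrable_unit
    exact ⟨h.l2Bound, c, _, hc, (ih h.weakDeriv_one).mono (normH_weakDeriv_one_le h)⟩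

lemma HBound.exists_isWeakDeriv (h : HBound n w C) {k : ℕ} (hk : k ≤ n) :
    ∃ g, IsWeakDeriv k w g ∧ L2Bound g C := by
  induction k generalizing n w with
  | zero => exact ⟨w, isWeakDeriv_zero h.l2Bound.1, h.l2Bound⟩
  | succ k ih =>
    obtain _ | n := n
    · omega
    obtain ⟨-, c, g, hg, h1⟩ := h
    obtain ⟨g', hg', hb⟩ := ih h1 (by omega)
    exact ⟨g', (isWeakDeriv_succ_iff (isWeakDeriv_one_of_eq_primitive h1.l2Bound.1 hg)).2 hg', hb⟩

lemma HBound.memH (h : HBound n w C) : MemH n w :=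
  ⟨h.l2Bound.1, fun _ hk => (h.exists_isWeakDeriv hk).imp fun _ hg => hg.1⟩

lemma HBound.normH_le (h : HBound n w C) : normH n w ≤ Real.sqrt (n + 1) * C := by
  rw [normH, ← Real.sqrt_sq h.l2Bound.2.1, ← Real.sqrt_mul (by positivity)]
  refine Real.sqrt_le_sqrt ?_
  have : ∀ k ∈ Finset.range (n + 1), ∫ x, weakDeriv k w x ^ 2 ∂unitMeasure ≤ C ^ 2 := by
    intro k hk
    obtain ⟨g, hg, hb⟩ := h.exists_isWeakDeriv (k := k) (by simpa [Nat.lt_succ_iff] using hk)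
    refine le_of_eq_of_le (integral_congr_ae ?_) (l2Bound_iff.1 hb).2.2
    filter_upwards [hg.weakDeriv_ae_eq] with x hx
    rw [hx]
  simpa using Finset.sum_le_card_nsmul _ _ _ this

end SobolevNorm

/-! ### Regularity of the weak solution. -/

section Regularity

open Set Filter

variable {β θ Km KM : ℝ} {K : ℝ → ℝ}

/-- The continuous functions max(K, `Km`) and K agree almost everywhere, hence everywhere on [0,1].
-/
lemma IsDiffusivity.le_of_continuousOn (hK : IsDiffusivity Km KM K) (hc : ContinuousOn K (Icc 0 1)) :
    ∀ x ∈ Icc (0 : ℝ) 1, Km ≤ K x := fun x hx => by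
  have := eqOn_Icc_of_ae_eq (hc.sup continuousOn_const) hc
    (hK.2.mono fun x hx => max_eq_left (b := Km) hx.1) hx
  exact max_eq_left_iff.1 this

lemma abs_iteratedDerivWithin_le_normC {n k : ℕ} (hK : ContDiffOn ℝ n K (Icc 0 1)) (hk : k ≤ n)
    {x : ℝ} (hx : x ∈ Icc (0 : ℝ) 1) : |iteratedDerivWithin k K (Icc 0 1) x| ≤ normC n K := by
  have hnn : ∀ k, 0 ≤ ⨆ x : Icc (0 : ℝ) 1, |iteratedDerivWithin k K (Icc 0 1) x| := fun k =>
    Real.iSup_nonneg fun _ => abs_nonneg _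
  have hc := hK.continuousOn_iteratedDerivWithin (m := k) (by exact_mod_cast hk)
    (uniqueDiffOn_Icc one_pos)
  obtain ⟨M, hM⟩ := isCompact_Icc.exists_bound_of_continuousOn hc
  have hb : BddAbove (range fun x : Icc (0 : ℝ) 1 => |iteratedDerivWithin k K (Icc 0 1) x|) :=
    ⟨M, by rintro _ ⟨y, rfl⟩; exact hM y y.2⟩
  refine (le_ciSup hb ⟨x, hx⟩).trans ?_
  exact Finset.single_le_sum
    (f := fun k => ⨆ x : Icc (0 : ℝ) 1, |iteratedDerivWithin k K (Icc 0 1) x|)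
    (fun k _ => hnn k) (Finset.mem_range.2 (by omega))

lemma normC_nonneg (n : ℕ) (K : ℝ → ℝ) : 0 ≤ normC n K :=
  Finset.sum_nonneg fun _ _ => Real.iSup_nonneg fun _ => abs_nonneg _

lemma HBound.primitive {n : ℕ} {f : ℝ → ℝ} {C : ℝ} (h : HBound n f C) :
    HBound (n + 1) (fun x => ∫ s in (0 : ℝ)..x, f s) C :=
  ⟨l2Bound_of_abs_le (continuousOn_primitive h.integrable).memLp_unit.1
    (ae_unitMeasure_of_forall fun _ hx => h.l2Bound.abs_integral_le (Ioo_subset_Icc_self hx)),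
    0, f, ae_of_all _ fun _ => by simp, h⟩

/-- The flux `K D I^β_θ u` of a weak solution, and a bound for its integration constant. -/
lemma exists_flux_eq (hβ' : β < 1 / 2) (hθ : θ = 0 ∨ θ = 1) (hKm : 0 < Km)
    (hK : IsDiffusivity Km KM K) {g f : ℝ → ℝ} {C : ℝ} (hg : MemLp g 2 unitMeasure)
    (hp : ∫ x, weight β θ x * g x ∂unitMeasure = 0) (hf : L2Bound f C)
    (h : ∀ v : H0 1, ∫ x, K x * g x * weakDeriv 1 v.fn x ∂unitMeasure =
      ∫ x, f x * v.fn x ∂unitMeasure) :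
    ∃ a : ℝ, |a| ≤ C ∧
      g =ᵐ[unitMeasure] fun x => (K x)⁻¹ * (a + -∫ s in (0 : ℝ)..x, f s) := by
  obtain ⟨a, ha⟩ := ae_add_primitive_eq_const (hg.bdd_mul_of_ae hK.1 (hK.abs_le hKm)) hf.1 h
  have hga : g =ᵐ[unitMeasure] fun x => (K x)⁻¹ * (a + -∫ s in (0 : ℝ)..x, f s) := by
    filter_upwards [ha, hK.inv_bounds hKm] with x h1 h2
    rw [← h1, add_neg_cancel_right, inv_mul_cancel_left₀ h2.2.2.2]
  refine ⟨a, ?_, hga⟩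
  have hw := memLp_weight hβ' hθ
  have hq := integrable_mul_of_memLp hw (hK.memLp_inv hKm)
  have hqpos : ∀ᵐ x ∂unitMeasure, 0 < weight β θ x * (K x)⁻¹ := by
    filter_upwards [ae_weight_pos β hθ, hK.inv_bounds hKm] with x h1 h2
    exact mul_pos h1 h2.2.2.1
  have hQ := integral_unit_pos hq hqpos
  have hF : ∀ᵐ x ∂unitMeasure, |∫ s in (0 : ℝ)..x, f s| ≤ C :=
    ae_unitMeasure_of_forall fun x hx => hf.abs_integral_le (Ioo_subset_Icc_self hx)
  have hqF : Integrable (fun x => weight β θ x * (K x)⁻¹ * ∫ s in (0 : ℝ)..x, f s) unitMeasure :=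
    hq.mul_bdd (c := C) (continuousOn_primitive hf.1.integrable_unit).memLp_unit.1 hF
  -- Orthogonality of g to the weight exhibits a as the mean of ∫₀ˣ f for the positive weight p/K,
  -- so it inherits the bound of ∫₀ˣ f.
  have e : a * ∫ x, weight β θ x * (K x)⁻¹ ∂unitMeasure =
      ∫ x, weight β θ x * (K x)⁻¹ * (∫ s in (0 : ℝ)..x, f s) ∂unitMeasure := by
    rw [← integral_const_mul, ← sub_eq_zero, ← integral_sub (hq.const_mul a) hqF]
    refine Eq.trans ?_ hp
    rw [integral_mul_congr_ae _ hga]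
    congr 1
    ext x
    ring
  have hle : |a * ∫ x, weight β θ x * (K x)⁻¹ ∂unitMeasure| ≤
      C * ∫ x, weight β θ x * (K x)⁻¹ ∂unitMeasure := by
    rw [e, ← integral_const_mul]
    refine abs_integral_le_integral_abs.trans (integral_mono_ae hqF.abs (hq.const_mul C) ?_)
    filter_upwards [hF, hqpos] with x h1 h2
    rw [abs_mul, abs_of_pos h2, mul_comm]
    exact mul_le_mul_of_nonneg_right h1 h2.le
  rw [abs_mul, abs_of_pos hQ] at hle
  exact le_of_mul_le_mul_right hle hQ

/-- A one-sided integral vanishes at one endpoint (0 for θ = 1, 1 for θ = 0), so its derivative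
controls it. -/
lemma abs_fracInt_le (hθ : θ = 0 ∨ θ = 1) {T : H0 (1 - β) →L[ℝ] UnitL2}
    (hT : ∀ w, ∀ x ∈ Icc (0 : ℝ) 1,
      fracInt β θ w.fn x = fracInt β θ w.fn 0 + ∫ s in (0 : ℝ)..x, T w s) {u : H0 (1 - β)} {C : ℝ}
    (hC : L2Bound (T u) C) {x : ℝ} (hx : x ∈ Icc (0 : ℝ) 1) : |fracInt β θ u.fn x| ≤ 2 * C := by
  have h0 : |fracInt β θ u.fn 0| ≤ C := by
    rcases hθ with rfl | rfl
    · have h1 := hT u 1 (by simp)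
      rw [show fracInt β 0 u.fn 1 = 0 by simp [fracInt, rightInt]] at h1
      rw [eq_neg_of_add_eq_zero_left h1.symm, abs_neg]
      exact hC.abs_integral_le (by simp)
    · simpa [fracInt, leftInt] using hC.2.1
  rw [hT u x hx, two_mul]
  exact (abs_add_le _ _).trans (add_le_add h0 (hC.abs_integral_le hx))

/-- The primitive of f gains one order, division by K ∈ C^{m+1} preserves it, and I^β_θ u, a
primitive of T u, gains another. The bound is linear in f, with no additive term in K. -/
theorem exists_regularity_bound (hβ : 0 < β) (hβ' : β < 1 / 2) (hθ : θ = 0 ∨ θ = 1) (hKm : 0 < Km)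
    (KM : ℝ) (m : ℕ) (R : ℝ) : ∃ C > 0, ∀ K, IsDiffusivity Km KM K →
      ContDiffOn ℝ (m + 1 : ℕ) K (Icc 0 1) → normC (m + 1) K ≤ R → ∀ f, MemH m f →
      ∀ u : H0 (1 - β), IsWeakSolution β θ K (fun v => ∫ x, f x * v.fn x ∂unitMeasure) u →
        MemH (m + 2) (fracInt β θ u.fn) ∧ normH (m + 2) (fracInt β θ u.fn) ≤ C * normH m f := by
  obtain ⟨c, hc, T, -, -, hTr, hT⟩ := exists_fracDeriv hβ hβ' hθ
  obtain ⟨D, hD, hdiv⟩ := exists_hBound_div hKm (le_max_right R 0) (m + 1)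
  -- The flux is bounded by 2‖f‖, T u by 2D‖f‖ and I^β_θ u by twice that; the root counts the m + 3
  -- derivatives in the norm.
  refine ⟨Real.sqrt ((m + 2 : ℕ) + 1) * (4 * D), by positivity, fun K hK hKc hR f hf u hu => ?_⟩
  have hfb := hf.hBound
  have hd := isWeakDeriv_fracInt hT u
  obtain ⟨a, ha, hga⟩ := exists_flux_eq hβ' hθ hKm hK (Lp.memLp (T u)) ((hTr _).2 ⟨u, rfl⟩)
    hfb.l2Bound fun v => by
      refine Eq.trans ?_ (hu v)
      refine integral_congr_ae ?_
      filter_upwards [hd.weakDeriv_ae_eq] with x hx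
      rw [hx]
  have hflux := (hBound_const (m + 1) a ha).add hfb.primitive.neg
  have hTu : HBound (m + 1) (T u) (D * (normH m f + normH m f)) :=
    (hdiv K hKc (hK.le_of_continuousOn hKc.continuousOn) (fun k hk x hx =>
      (abs_iteratedDerivWithin_le_normC hKc hk hx).trans (hR.trans (le_max_left _ _))) _ _
      hflux).congr hga.symm
  have hN := hfb.l2Bound.2.1
  have hI : HBound (m + 2) (fracInt β θ u.fn) (4 * D * normH m f) := by
    refine ⟨l2Bound_of_abs_le (continuousOn_fracInt hT u).memLp_unit.1
      (ae_unitMeasure_of_forall fun x hx => ?_), _, T u,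
      ae_unitMeasure_of_forall fun x hx => hT u x (Ioo_subset_Icc_self hx), hTu.mono ?_⟩
    · exact (abs_fracInt_le hθ hT hTu.l2Bound (Ioo_subset_Icc_self hx)).trans (by linarith)
    · linarith [mul_nonneg hD.le hN]
  refine ⟨hI.memH, hI.normH_le.trans_eq (by ring)⟩

end Regularity

end FracDiff

/-! ### Assembly of the theorem. -/

open FracDiff in
theorem theorem7p1 (β θ Km KM : ℝ) (hβ : 0 < β) (hβ' : β < 1 / 2) (hθ : θ = 0 ∨ θ = 1)
    (hKm : 0 < Km) :
    -- the auxiliary functions exist and are unique, and the nondegeneracy condition holds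
    (∀ K : ℝ → ℝ, IsDiffusivity Km KM K →
      (∃ wl, IsWl K wl ∧ (∀ w, IsWl K w → Set.EqOn w wl (Set.Icc 0 1)) ∧
        ∃! ul : H0 (1 - β), IsUl β θ wl ul) ∧
      Nondegenerate β θ K) ∧
    -- existence, and uniqueness if and only if the nondegeneracy condition holds
    (∀ K : ℝ → ℝ, IsDiffusivity Km KM K → ∀ f : HNeg1,
      (∃ u, IsWeakSolution β θ K f u) ∧
      ((∃! u, IsWeakSolution β θ K f u) ↔ Nondegenerate β θ K)) ∧
    -- boundedness and weak coercivity of the bilinear form, well-posedness and stability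
    (∃ M κ : ℝ, 0 < κ ∧ ∀ K : ℝ → ℝ, IsDiffusivity Km KM K →
      (∀ u : H0 (1 - β), MemH 1 (fracInt β θ u.fn)) ∧
      (∃ B : H0 (1 - β) →L[ℝ] H0 1 →L[ℝ] ℝ,
        (∀ w v, B w v = formA β θ K w v) ∧ ‖B‖ ≤ M) ∧
      ((κ : EReal) ≤ ⨅ w : {w : H0 (1 - β) // w ≠ 0}, ⨆ v : {v : H0 1 // v ≠ 0},
        ((formA β θ K w v / (‖(w : H0 (1 - β))‖ * ‖(v : H0 1)‖) : ℝ) : EReal)) ∧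
      (∀ v : H0 1, v ≠ 0 → (0 : EReal) < ⨆ w : H0 (1 - β), (formA β θ K w v : EReal)) ∧
      (∀ f : HNeg1, ∃! u, IsWeakSolution β θ K f u) ∧
      (∀ (f : HNeg1) (u : H0 (1 - β)), IsWeakSolution β θ K f u → ‖u‖ ≤ 1 / κ * ‖f‖)) ∧
    -- regularity
    (∀ (m : ℕ) (R : ℝ), ∃ C : ℝ, 0 < C ∧ ∀ K : ℝ → ℝ, IsDiffusivity Km KM K →
      ContDiffOn ℝ (m + 1 : ℕ) K (Set.Icc 0 1) → normC (m + 1) K ≤ R →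
      ∀ f : ℝ → ℝ, MemH m f →
        (∃! u : H0 (1 - β), IsWeakSolution β θ K (fun v => ∫ x, f x * v.fn x ∂unitMeasure) u) ∧
        ∀ u : H0 (1 - β), IsWeakSolution β θ K (fun v => ∫ x, f x * v.fn x ∂unitMeasure) u →
          MemH (m + 2) (fracInt β θ u.fn) ∧
          normH (m + 2) (fracInt β θ u.fn) ≤ C * (normC (m + 1) K + normH m f)) := by
  refine ⟨fun K hK => ⟨⟨_, isWl_linearProfile hK hKm, fun w hw => hw.eqOn hK hKm,
      existsUnique_isUl hβ hβ' hθ hKm hK (isWl_linearProfile hK hKm)⟩,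
      nondegenerate hβ hβ' hθ hKm hK⟩, fun K hK f => ?_, ?_, fun m R => ?_⟩
  · obtain ⟨u, hu⟩ := exists_isWeakSolution hβ hβ' hθ hKm hK f
    -- Uniqueness and nondegeneracy both always hold here, so each implication is proved from its
    -- conclusion.
    exact ⟨⟨u, hu⟩, fun _ => nondegenerate hβ hβ' hθ hKm hK,
      fun _ => ⟨u, hu, fun w hw => hw.unique hβ hβ' hθ hKm hK hu⟩⟩
  · obtain ⟨κ, hκ, hinf⟩ := exists_formA_infSup hβ hβ' hθ hKm KM
    refine ⟨|KM|, κ, hκ, fun K hK => ⟨memH_one_fracInt hβ hβ' hθ,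
      exists_formA_bilinear hβ hβ' hθ hKm hK, ?_, fun v hv => ?_, fun f => ?_, fun f u hu => ?_⟩⟩
    · refine le_iInf fun w => ?_
      obtain ⟨v, hv, h⟩ := hinf K hK w w.2
      refine le_iSup_of_le ⟨v, hv⟩ (EReal.coe_le_coe_iff.2 ?_)
      rwa [le_div_iff₀ (mul_pos (norm_pos_iff.2 w.2) (norm_pos_iff.2 hv))]
    · obtain ⟨w, hw⟩ := exists_formA_pos hβ hβ' hθ hKm hK hv
      exact (EReal.coe_pos.2 hw).trans_le
        (le_iSup (fun w : H0 (1 - β) => (formA β θ K w v : EReal)) w)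
    · obtain ⟨u, hu⟩ := exists_isWeakSolution hβ hβ' hθ hKm hK f
      exact ⟨u, hu, fun w hw => hw.unique hβ hβ' hθ hKm hK hu⟩
    · rcases eq_or_ne u 0 with rfl | hu0
      · rw [norm_zero]
        positivity
      · obtain ⟨v, hv, h⟩ := hinf K hK u hu0
        have hv' := norm_pos_iff.2 hv
        rw [hu v, ← mul_assoc] at h
        have := le_of_mul_le_mul_right (h.trans ((le_abs_self _).trans (f.le_opNorm v))) hv'
        rw [one_div, ← div_eq_inv_mul, le_div_iff₀ hκ]
        linarith
  · obtain ⟨C, hC, h⟩ := exists_regularity_bound hβ hβ' hθ hKm KM m R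
    refine ⟨C, hC, fun K hK hKc hR f hf => ⟨?_, fun u hu => ?_⟩⟩
    · obtain ⟨ℓ, hℓ⟩ := exists_dual_eq_integral_mul 1 hf.1
      obtain ⟨u, hu⟩ := exists_isWeakSolution hβ hβ' hθ hKm hK ℓ
      rw [← funext hℓ]
      exact ⟨u, hu, fun w hw => hw.unique hβ hβ' hθ hKm hK hu⟩
    · obtain ⟨h1, h2⟩ := h K hK hKc hR f hf u hu
      refine ⟨h1, h2.trans (mul_le_mul_of_nonneg_left ?_ hC.le)⟩
      exact le_add_of_nonneg_left (normC_nonneg _ _)
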